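/- **Notation.** Fix an integer $r\ge 1$. Elements of $\mathbb C(z)^r$ are row vectors. *The adelic Grassmannian.* A linear subspace $W\subseteq\mathbb C(z)^r$ is *fat* if $p\,\mathbb C[z]^r\subseteq W\subseteq q^{-1}\mathbb C[z]^r$ for some nonzero polynomials $p,q$. It is *primary decomposable* if $W=\bigcap_{\lambda\in\mathbb C}W_\lambda$, where each $W_\lambda\subseteq\mathbb C(z)^r$ is a linear subspace that contains, for some $N=N(\lambda)$, all $f\in \mathbb C(z)^r$ which are regular at $\lambda$ and vanish there to order at least $N$. Let $L_W\subseteq\mathbb C(z)^r$ be the set consisting of $0$ and all leading coefficients of the rows $D=(D_1,\dots,D_r)$ of operators in $\mathbb C(z)[\partial_z]$ such that $(D_1.p,\dots,D_r.p)\in W$ for all $p\in\mathbb C[z]$. Then $\mathrm{Gr}^{ad}(r)$ is the set of fat, primary decomposable $W$ with $L_W=\mathbb C[z]^r$. *Baker functions.* The stationary Baker function of $W\in\mathrm{Gr}^{ad}(r)$ is the $r\times r$ matrix function $\psi_W(x,z)=\widetilde\psi_W(x,z)e^{xz}$, with $\widetilde\psi_W$ a matrix of rational functions of $(x,z)$,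 such that for all but finitely many $x$ we have $\widetilde\psi_W(x,z)=I+\sum_{i\ge1}a_i(x)z^{-i}$ near $z=\infty$ and every row of $\psi_W(x,\cdot)$ belongs to the closure of $W$ (which is $W+pH_+$ if $p\,\mathbb C[z]^r\subseteq W$, $p\neq0$, where $H_+$ is the closure of $\mathbb C[z]^r$ in the space of vector-valued functions on a large circle). *The involution $b$.* For $n\ge0$ let $\mathcal C_n(r)$ be the space of $GL_n(\mathbb C)$-orbits of quadruples $(X,Y;v,w)$ of complex matrices of sizes $n\times n,\ n\times n,\ n\times r,\ r\times n$ with $[X,Y]+vw=-I$. Let $\beta(X,Y;v,w)$ be the point $W\in\mathrm{Gr}^{ad}(r)$ with $\widetilde\psi_W(x,z)=I+w(xI+X)^{-1}(zI-Y)^{-1}v$. The bispectral involution $b(X,Y;v,w)=-(Y^t,X^t;w^t,v^t)$ induces, through $\beta:\bigsqcup_{n\ge 0}\mathcal C_n(r)\to\mathrm{Gr}^{ad}(r)$, an involution $b$ of $\mathrm{Gr}^{ad}(r)$: if $U=\beta(q)$ then $b(U)=\beta(b(q))$. *The algebra $\mathcal D(U)$.* For $r\times r$ matrices of operators put $D\star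 E:=(E^tD^t)^t$, and for a row or matrix $\varphi$ of functions put $\varphi\star D:=(D^t.\varphi^t)^t$, where the dot is the usual action of operators on functions. For $U\in\mathrm{Gr}^{ad}(r)$, $\mathcal D(U)$ is the $\mathbb C$-algebra, with multiplication $\star$, of all $r\times r$ matrices $D$ with entries in $\mathbb C(z)[\partial_z]$ such that $U\star D\subseteq U$. **Proposition.** Let $U\in\mathrm{Gr}^{ad}(r)$. Then $U=\beta(q)$ for some $n\ge 0$ and some $q\in\mathcal C_n(r)$ for which $\beta(b(q))$ exists too, so that $b(U)\in\mathrm{Gr}^{ad}(r)$ is defined. For every $D\in\mathcal D(U)$ there is exactly one $r\times r$ matrix $\Theta=\Theta(x)$ with entries in $\mathbb C(x)[\partial_x]$ such that $$\psi_U(x,z)\star D(z)=\Theta(x).\psi_U(x,z),$$ and, writing $B(D):=\Theta(z)^t$, the map $B:\mathcal D(U)\to\mathcal D(b(U))$ is a well-defined $\mathbb C$-linear bijection with $B(1)=1$ and $$B(D_1\star D_2)=B(D_2)\star B(D_1)\qquad(D_1,D_2\in\mathcal D(U));$$ that is, $B$ is an anti-isomorphism of $\mathbb C$-algebras. -/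

import Mathlib

open scoped MulOpposite Topology

noncomputable section

namespace AdelicGr

/-! ### Derivations of fraction fields -/

section FracDeriv

set_option linter.unusedSectionVars false

variable {A K : Type} [CommRing A] [IsDomain A] [UniqueFactorizationMonoid A] [Algebra ℂ A]
  [Field K] [Algebra ℂ K] [Algebra A K] [IsScalarTower ℂ A K] [IsFractionRing A K]

/-- The quotient rule applied to the reduced fraction representing `f`. -/
def quotRule (d : Derivation ℂ A A) (f : K) : K :=
  let a : A := IsFractionRing.num A f
  let b : A := IsFractionRing.den A f
  (algebraMap A K b * algebraMap A K (d a) - algebraMap A K a * algebraMap A K (d b)) /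
    algebraMap A K b ^ 2

theorem quotRule_eq (d : Derivation ℂ A A) (a b : A) (hb : b ≠ 0) :
    quotRule d (algebraMap A K a / algebraMap A K b) =
      (algebraMap A K b * algebraMap A K (d a) - algebraMap A K a * algebraMap A K (d b)) /
        algebraMap A K b ^ 2 := by
  have hinj := IsFractionRing.injective A K
  set f : K := algebraMap A K a / algebraMap A K b with hf
  have hq : (IsFractionRing.den A f : A) ≠ 0 := nonZeroDivisors.ne_zero (IsFractionRing.den A f).2
  have key : algebraMap A K (IsFractionRing.num A f) / algebraMap A K (IsFractionRing.den A f)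
      = algebraMap A K a / algebraMap A K b := by
    rw [IsFractionRing.mk'_num_den' A f]
  simp only [quotRule]
  generalize IsFractionRing.num A f = p at *
  generalize (IsFractionRing.den A f : A) = q at *
  have hbK : algebraMap A K b ≠ 0 := by
    rwa [Ne, map_eq_zero_iff _ hinj]
  have hqK : algebraMap A K q ≠ 0 := by
    rwa [Ne, map_eq_zero_iff _ hinj]
  rw [div_eq_div_iff hqK hbK] at key
  have keyA : p * b = a * q := hinj (by simpa using key)
  have hd := congrArg d keyA
  simp only [Derivation.leibniz, smul_eq_mul] at hd
  have hdK := congrArg (algebraMap A K) hd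
  simp only [map_add, map_mul] at hdK
  rw [div_eq_div_iff (pow_ne_zero 2 hqK) (pow_ne_zero 2 hbK)]
  set P := algebraMap A K p
  set Q := algebraMap A K q
  set R := algebraMap A K a
  set S := algebraMap A K b
  set P' := algebraMap A K (d p)
  set Q' := algebraMap A K (d q)
  set R' := algebraMap A K (d a)
  set S' := algebraMap A K (d b)
  linear_combination (Q * S) * hdK - (Q' * S + Q * S') * key

/-- The unique extension to the fraction field `K` of `A` of a derivation of `A`. -/
def fracDeriv (d : Derivation ℂ A A) : Derivation ℂ K K where
  toFun := quotRule d
  map_add' f g := by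
    have hinj := IsFractionRing.injective A K
    obtain ⟨a, b, hb, rfl⟩ := IsFractionRing.div_surjective (A := A) f
    obtain ⟨p, q, hq, rfl⟩ := IsFractionRing.div_surjective (A := A) g
    have hb0 := nonZeroDivisors.ne_zero hb
    have hq0 := nonZeroDivisors.ne_zero hq
    have hbK : algebraMap A K b ≠ 0 := by rwa [Ne, map_eq_zero_iff _ hinj]
    have hqK : algebraMap A K q ≠ 0 := by rwa [Ne, map_eq_zero_iff _ hinj]
    have : algebraMap A K a / algebraMap A K b + algebraMap A K p / algebraMap A K q =
        algebraMap A K (a * q + b * p) / algebraMap A K (b * q) := by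
      simp only [map_add, map_mul]; field_simp
    rw [this, quotRule_eq _ _ _ hb0, quotRule_eq _ _ _ hq0,
      quotRule_eq _ _ _ (mul_ne_zero hb0 hq0)]
    simp only [Derivation.leibniz, map_add, map_mul, smul_eq_mul]
    field_simp
    ring
  map_smul' c f := by
    have hinj := IsFractionRing.injective A K
    obtain ⟨a, b, hb, rfl⟩ := IsFractionRing.div_surjective (A := A) f
    have hb0 := nonZeroDivisors.ne_zero hb
    have hbK : algebraMap A K b ≠ 0 := by rwa [Ne, map_eq_zero_iff _ hinj]
    have hc : ∀ y : A, algebraMap A K (c • y) = algebraMap ℂ K c * algebraMap A K y := by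
      intro y
      rw [Algebra.smul_def, map_mul, ← IsScalarTower.algebraMap_apply]
    have : c • (algebraMap A K a / algebraMap A K b) =
        algebraMap A K (c • a) / algebraMap A K b := by
      rw [hc, Algebra.smul_def, mul_div_assoc]
    rw [this, quotRule_eq _ _ _ hb0, quotRule_eq _ _ _ hb0, Derivation.map_smul]
    simp only [hc, RingHom.id_apply]
    rw [Algebra.smul_def]
    ring
  map_one_eq_zero' := by
    have := quotRule_eq (K := K) d 1 1 one_ne_zero
    simpa using this
  leibniz' f g := by
    have hinj := IsFractionRing.injective A K
    obtain ⟨a, b, hb, rfl⟩ := IsFractionRing.div_surjective (A := A) f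
    obtain ⟨p, q, hq, rfl⟩ := IsFractionRing.div_surjective (A := A) g
    have hb0 := nonZeroDivisors.ne_zero hb
    have hq0 := nonZeroDivisors.ne_zero hq
    have hbK : algebraMap A K b ≠ 0 := by rwa [Ne, map_eq_zero_iff _ hinj]
    have hqK : algebraMap A K q ≠ 0 := by rwa [Ne, map_eq_zero_iff _ hinj]
    have : algebraMap A K a / algebraMap A K b * (algebraMap A K p / algebraMap A K q) =
        algebraMap A K (a * p) / algebraMap A K (b * q) := by
      simp only [map_mul]; field_simp
    simp only [LinearMap.coe_mk, AddHom.coe_mk]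
    rw [this, quotRule_eq _ _ _ hb0, quotRule_eq _ _ _ hq0,
      quotRule_eq _ _ _ (mul_ne_zero hb0 hq0)]
    simp only [Derivation.leibniz, map_add, map_mul, smul_eq_mul]
    field_simp
    ring

end FracDeriv

/-! ### The ring `ℂ(z)[∂]` of differential operators with rational coefficients -/

/-- The field `ℂ(z)` of rational functions of one variable. -/
abbrev Rat1 : Type := RatFunc ℂ

/-- Differentiation `d/dz` on `ℂ(z)`. -/
def ddz : Derivation ℂ Rat1 Rat1 := fracDeriv (A := Polynomial ℂ) Polynomial.derivative'

/-- The operator `F ↦ ∑ k, ι (c k) * δ^k F`, where the `c k ∈ ℂ(z)` are finitely many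
coefficients, `ι` maps them into `K`, and `δ` is a linear map on `K`. -/
def opOfCoeffs {K : Type} [Field K] [Algebra ℂ K] (ι : Rat1 → K) (δ : Module.End ℂ K)
    (c : ℕ →₀ Rat1) : Module.End ℂ K :=
  ∑ k ∈ c.support, LinearMap.mulLeft ℂ (ι (c k)) * δ ^ k

/-- The algebra `ℂ(z)[∂]`, realised faithfully as the algebra of operators on `ℂ(z)` generated by
`∂ = d/dz` and the multiplication operators. -/
def diffOpSubalgebra : Subalgebra ℂ (Module.End ℂ Rat1) :=
  Algebra.adjoin ℂ (insert (ddz : Rat1 →ₗ[ℂ] Rat1) (Set.range fun f : Rat1 => LinearMap.mulLeft ℂ f))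

/-- The algebra `ℂ(z)[∂]`, as a type. The name of the variable is irrelevant, so this is also
`ℂ(x)[∂_x]`. -/
abbrev DiffOp : Type := diffOpSubalgebra

theorem opOfCoeffs_eq_sum (c : ℕ →₀ Rat1) {s : Finset ℕ} (hs : c.support ⊆ s) :
    opOfCoeffs id (ddz : Rat1 →ₗ[ℂ] Rat1) c =
      ∑ k ∈ s, LinearMap.mulLeft ℂ (c k) * (ddz : Rat1 →ₗ[ℂ] Rat1) ^ k := by
  refine Finset.sum_subset hs fun k _ hk => ?_
  simp [Finsupp.notMem_support_iff.mp hk]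

theorem opOfCoeffs_add (c c' : ℕ →₀ Rat1) :
    opOfCoeffs id (ddz : Rat1 →ₗ[ℂ] Rat1) (c + c') =
      opOfCoeffs id (ddz : Rat1 →ₗ[ℂ] Rat1) c + opOfCoeffs id (ddz : Rat1 →ₗ[ℂ] Rat1) c' := by
  classical
  have h1 : c.support ⊆ c.support ∪ c'.support := Finset.subset_union_left
  have h2 : c'.support ⊆ c.support ∪ c'.support := Finset.subset_union_right
  rw [opOfCoeffs_eq_sum _ Finsupp.support_add, opOfCoeffs_eq_sum _ h1, opOfCoeffs_eq_sum _ h2,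
    ← Finset.sum_add_distrib]
  refine Finset.sum_congr rfl fun k _ => ?_
  ext f
  simp [add_mul]

theorem opOfCoeffs_single (k : ℕ) (f : Rat1) :
    opOfCoeffs id (ddz : Rat1 →ₗ[ℂ] Rat1) (Finsupp.single k f) =
      LinearMap.mulLeft ℂ f * (ddz : Rat1 →ₗ[ℂ] Rat1) ^ k := by
  rw [opOfCoeffs_eq_sum _ Finsupp.support_single_subset]
  simp

theorem ddz_mul_mulLeft (f : Rat1) :
    (ddz : Rat1 →ₗ[ℂ] Rat1) * LinearMap.mulLeft ℂ f =
      LinearMap.mulLeft ℂ f * (ddz : Rat1 →ₗ[ℂ] Rat1) + LinearMap.mulLeft ℂ (ddz f) := by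
  ext g
  simp [mul_comm]

/-- Every element of `ℂ(z)[∂]` has the form `∑ c_k ∂^k`. -/
theorem exists_coeffs (D : DiffOp) :
    ∃ c : ℕ →₀ Rat1, opOfCoeffs id (ddz : Rat1 →ₗ[ℂ] Rat1) c = D.1 := by
  obtain ⟨T, hT⟩ := D
  have hone : opOfCoeffs id (ddz : Rat1 →ₗ[ℂ] Rat1) (Finsupp.single 0 1) = 1 := by
    rw [opOfCoeffs_single]
    ext g
    simp
  -- left multiplication by `f` and by `∂` preserve the range
  have hf : ∀ (f : Rat1) (c : ℕ →₀ Rat1), ∃ c', opOfCoeffs id (ddz : Rat1 →ₗ[ℂ] Rat1) c' =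
      LinearMap.mulLeft ℂ f * opOfCoeffs id (ddz : Rat1 →ₗ[ℂ] Rat1) c := by
    intro f c
    induction c using Finsupp.induction_linear with
    | zero => exact ⟨0, by simp [opOfCoeffs]⟩
    | add c d hc hd =>
      obtain ⟨c', hc'⟩ := hc
      obtain ⟨d', hd'⟩ := hd
      exact ⟨c' + d', by rw [opOfCoeffs_add, opOfCoeffs_add, hc', hd', mul_add]⟩
    | single k g =>
      refine ⟨Finsupp.single k (f * g), ?_⟩
      rw [opOfCoeffs_single, opOfCoeffs_single, ← mul_assoc]
      congr 1
      ext h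
      simp
  have hd : ∀ c : ℕ →₀ Rat1, ∃ c', opOfCoeffs id (ddz : Rat1 →ₗ[ℂ] Rat1) c' =
      (ddz : Rat1 →ₗ[ℂ] Rat1) * opOfCoeffs id (ddz : Rat1 →ₗ[ℂ] Rat1) c := by
    intro c
    induction c using Finsupp.induction_linear with
    | zero => exact ⟨0, by simp [opOfCoeffs]⟩
    | add c d hc hd =>
      obtain ⟨c', hc'⟩ := hc
      obtain ⟨d', hd'⟩ := hd
      exact ⟨c' + d', by rw [opOfCoeffs_add, opOfCoeffs_add, hc', hd', mul_add]⟩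
    | single k g =>
      refine ⟨Finsupp.single (k + 1) g + Finsupp.single k (ddz g), ?_⟩
      rw [opOfCoeffs_add, opOfCoeffs_single, opOfCoeffs_single, opOfCoeffs_single, ← mul_assoc,
        ddz_mul_mulLeft, add_mul, pow_succ', mul_assoc]
  have hmul : ∀ S ∈ diffOpSubalgebra, ∀ c : ℕ →₀ Rat1, ∃ c',
      opOfCoeffs id (ddz : Rat1 →ₗ[ℂ] Rat1) c' =
        S * opOfCoeffs id (ddz : Rat1 →ₗ[ℂ] Rat1) c := by
    intro S hS
    induction hS using Algebra.adjoin_induction with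
    | mem S hS =>
      rcases hS with rfl | ⟨f, rfl⟩
      · exact hd
      · exact hf f
    | algebraMap a =>
      intro c
      obtain ⟨c', hc'⟩ := hf (algebraMap ℂ Rat1 a) c
      refine ⟨c', hc'.trans ?_⟩
      congr 1
      ext g
      simp [Algebra.smul_def]
    | add S T _ _ hS hT =>
      intro c
      obtain ⟨c', hc'⟩ := hS c
      obtain ⟨d', hd'⟩ := hT c
      exact ⟨c' + d', by rw [opOfCoeffs_add, hc', hd', add_mul]⟩
    | mul S T _ _ hS hT =>
      intro c
      obtain ⟨c', hc'⟩ := hT c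
      obtain ⟨d', hd'⟩ := hS c'
      exact ⟨d', by rw [hd', hc', mul_assoc]⟩
  obtain ⟨c', hc'⟩ := hmul T hT (Finsupp.single 0 1)
  exact ⟨c', by rw [hc', hone, mul_one]⟩

/-- The coefficients `c_k` of `D = ∑ c_k ∂^k`. They are unique, see `coeffs_unique`. -/
def coeffs (D : DiffOp) : ℕ →₀ Rat1 := (exists_coeffs D).choose

theorem ddz_pow_X_pow (k m : ℕ) :
    ((ddz : Rat1 →ₗ[ℂ] Rat1) ^ k) (RatFunc.X ^ m) =
      (m.descFactorial k : Rat1) * RatFunc.X ^ (m - k) := by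
  have hX : ddz (RatFunc.X : Rat1) = 1 := by
    have := quotRule_eq (K := Rat1) (A := Polynomial ℂ) Polynomial.derivative' Polynomial.X 1
      one_ne_zero
    simp at this
    exact this
  have hpow : ∀ n : ℕ, ddz ((RatFunc.X : Rat1) ^ n) = (n : Rat1) * RatFunc.X ^ (n - 1) := by
    intro n
    rw [Derivation.leibniz_pow, hX]
    simp
  induction k with
  | zero => simp
  | succ k ih =>
    rw [pow_succ', Module.End.mul_apply, ih]
    have h1 : ((m.descFactorial k : Rat1) * RatFunc.X ^ (m - k)) =
        (m.descFactorial k : ℂ) • ((RatFunc.X : Rat1) ^ (m - k)) := by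
      simp [Algebra.smul_def]
    rw [h1, map_smul]
    simp only [Derivation.coeFn_coe, hpow, Nat.descFactorial_succ, Algebra.smul_def]
    push_cast
    rw [Nat.sub_sub]
    ring

/-- The representation `D = ∑ c_k ∂^k` is unique. -/
theorem coeffs_unique (c c' : ℕ →₀ Rat1)
    (h : opOfCoeffs id (ddz : Rat1 →ₗ[ℂ] Rat1) c = opOfCoeffs id (ddz : Rat1 →ₗ[ℂ] Rat1) c') :
    c = c' := by
  classical
  ext1 m
  induction m using Nat.strong_induction_on with
  | _ m ih =>
    have h1 : c.support ⊆ c.support ∪ c'.support ∪ {m} := by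
      intro k; simp; tauto
    have h2 : c'.support ⊆ c.support ∪ c'.support ∪ {m} := by
      intro k; simp; tauto
    rw [opOfCoeffs_eq_sum _ h1, opOfCoeffs_eq_sum _ h2] at h
    have h3 := congrArg (fun T : Module.End ℂ Rat1 => T (RatFunc.X ^ m)) h
    simp only [LinearMap.sum_apply, Module.End.mul_apply, LinearMap.mulLeft_apply,
      ddz_pow_X_pow] at h3
    rw [← sub_eq_zero, ← Finset.sum_sub_distrib, Finset.sum_eq_single m] at h3
    · rw [← sub_mul] at h3
      have : ((m.descFactorial m : Rat1) * RatFunc.X ^ (m - m)) ≠ 0 := by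
        simp [Nat.descFactorial_self, Nat.factorial_ne_zero]
      exact sub_eq_zero.mp ((mul_eq_zero.mp h3).resolve_right this)
    · intro k _ hk
      rcases lt_or_gt_of_ne hk with hk | hk
      · rw [ih k hk, sub_self]
      · rw [Nat.descFactorial_of_lt hk]
        simp
    · intro hm
      simp at hm

/-! ### Subspaces of `ℂ(z)^r` and the adelic Grassmannian -/

/-- `ℂ(z)^r`, regarded as row vectors. -/
abbrev RatVec (r : ℕ) : Type := Fin r → Rat1

/-- The base point `ℂ[z]^r`. -/
def polyVec (r : ℕ) : Submodule ℂ (RatVec r) where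
  carrier := {u | ∀ i, u i ∈ (algebraMap (Polynomial ℂ) Rat1).range}
  add_mem' hu hv i := add_mem (hu i) (hv i)
  zero_mem' _ := zero_mem _
  smul_mem' c u hu i := by
    obtain ⟨p, hp⟩ := hu i
    exact ⟨c • p, by rw [Pi.smul_apply, ← hp]; exact (Algebra.linearMap (Polynomial ℂ) Rat1).map_smul_of_tower c p⟩

/-- `p ℂ[z]^r ⊆ W`. -/
def ContainsMultiples {r : ℕ} (p : Polynomial ℂ) (W : Submodule ℂ (RatVec r)) : Prop :=
  ∀ u ∈ polyVec r, algebraMap (Polynomial ℂ) Rat1 p • u ∈ W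

/-- `W` is fat: `p ℂ[z]^r ⊆ W ⊆ q⁻¹ ℂ[z]^r` for some nonzero polynomials `p`, `q`. -/
def IsFat {r : ℕ} (W : Submodule ℂ (RatVec r)) : Prop :=
  (∃ p : Polynomial ℂ, p ≠ 0 ∧ ContainsMultiples p W) ∧
    ∃ q : Polynomial ℂ, q ≠ 0 ∧ ∀ u ∈ W, algebraMap (Polynomial ℂ) Rat1 q • u ∈ polyVec r

/-- All components of `u` are regular at `lam` and vanish there to order at least `N`. -/
def VanishesToOrder {r : ℕ} (lam : ℂ) (N : ℕ) (u : RatVec r) : Prop :=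
  ∀ i, ∃ g : Rat1, g.denom.eval lam ≠ 0 ∧ u i = (RatFunc.X - RatFunc.C lam) ^ N * g

/-- `W` is primary decomposable: it is an intersection of subspaces `W_lam`, one for each point
`lam ∈ ℂ`, where `W_lam` is primary at `lam`, that is, it contains everything which vanishes to
sufficiently high order at `lam`. -/
def IsPrimaryDecomposable {r : ℕ} (W : Submodule ℂ (RatVec r)) : Prop :=
  ∃ Wloc : ℂ → Submodule ℂ (RatVec r),
    (∀ lam, ∃ N : ℕ, ∀ u : RatVec r, VanishesToOrder lam N u → u ∈ Wloc lam) ∧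
      W = ⨅ lam, Wloc lam

/-- `M_W`: the rows `(D_1, …, D_r)` of differential operators such that
`(D_1.p, …, D_r.p) ∈ W` for every polynomial `p`. -/
def rowOps {r : ℕ} (W : Submodule ℂ (RatVec r)) : Set (Fin r → DiffOp) :=
  {D | ∀ p : Polynomial ℂ, (fun i => (D i).1 (algebraMap (Polynomial ℂ) Rat1 p)) ∈ W}

/-- `L_W`: the set of leading coefficients of elements of `M_W` (together with `0`). -/
def leadingCoeffs {r : ℕ} (W : Submodule ℂ (RatVec r)) : Set (RatVec r) :=
  {l | ∃ D ∈ rowOps W, ∃ m : ℕ,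
    (∀ i, ∀ k, m < k → coeffs (D i) k = 0) ∧ ∀ i, coeffs (D i) m = l i}

/-- The adelic Grassmannian `Gr^ad(r)`: fat, primary decomposable subspaces `W` of `ℂ(z)^r` such
that `L_W = ℂ[z]^r`. -/
def grAd (r : ℕ) : Set (Submodule ℂ (RatVec r)) :=
  {W | IsFat W ∧ IsPrimaryDecomposable W ∧ leadingCoeffs W = (polyVec r : Set (RatVec r))}

/-! ### The stationary Baker function -/

/-- The field `ℂ(x, z)`; the variable number `0` is `x`, the variable number `1` is `z`. -/
abbrev Rat2 : Type := FractionRing (MvPolynomial (Fin 2) ℂ)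

/-- The element `x` of `ℂ(x, z)`. -/
def xx : Rat2 := algebraMap (MvPolynomial (Fin 2) ℂ) Rat2 (MvPolynomial.X 0)

/-- The element `z` of `ℂ(x, z)`. -/
def zz : Rat2 := algebraMap (MvPolynomial (Fin 2) ℂ) Rat2 (MvPolynomial.X 1)

/-- `∂/∂x` on `ℂ(x, z)`. -/
def ddxx : Derivation ℂ Rat2 Rat2 := fracDeriv (MvPolynomial.pderiv (R := ℂ) (0 : Fin 2))

/-- `∂/∂z` on `ℂ(x, z)`. -/
def ddzz : Derivation ℂ Rat2 Rat2 := fracDeriv (MvPolynomial.pderiv (R := ℂ) (1 : Fin 2))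

/-- The value of a rational function of `(x, z)` at a point where the denominator (in lowest
terms) does not vanish. -/
def eval2 (F : Rat2) (x z : ℂ) : ℂ :=
  MvPolynomial.eval ![x, z] (IsFractionRing.num (MvPolynomial (Fin 2) ℂ) F) /
    MvPolynomial.eval ![x, z]
      (IsFractionRing.den (MvPolynomial (Fin 2) ℂ) F : MvPolynomial (Fin 2) ℂ)

/-- The vector valued function `f` (defined up to finitely many points) belongs to the closure
of the fat space `W` in the space of vector valued loops on large circles. If `p ℂ[z]^r ⊆ W` then
this closure is `W + p H₊`, where the space `H₊` is the closure of `ℂ[z]^r`, and consists of the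
functions which extend holomorphically to the interior of the circle. -/
def MemClosure {r : ℕ} (W : Submodule ℂ (RatVec r)) (f : ℂ → Fin r → ℂ) : Prop :=
  ∃ p : Polynomial ℂ, p ≠ 0 ∧ ContainsMultiples p W ∧
    ∃ h ∈ W, ∃ e : Fin r → ℂ → ℂ, (∀ j, Differentiable ℂ (e j)) ∧
      ∀ᶠ z in Filter.cofinite, ∀ j, f z j = (h j).eval (RingHom.id ℂ) z + p.eval z * e j z

/-- `P(x, z) exp(xz)` is a stationary Baker function of `W`: for all `x` outside a finite set,
`P(x, z)` has the form `I + ∑_{i ≥ 1} a_i(x) z^{-i}`, and each row of `P(x, z) exp(xz)` belongs to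
the closure of `W`. -/
def IsReducedBaker {r : ℕ} (W : Submodule ℂ (RatVec r)) (P : Matrix (Fin r) (Fin r) Rat2) : Prop :=
  ∀ᶠ x : ℂ in Filter.cofinite,
    (∀ i j, Filter.Tendsto (fun z => eval2 (P i j) x z) (Bornology.cobounded ℂ)
      (𝓝 ((1 : Matrix (Fin r) (Fin r) ℂ) i j))) ∧
    ∀ i, MemClosure W fun z j => eval2 (P i j) x z * Complex.exp (x * z)

open Classical in
/-- The matrix `P(x, z)` for which `P(x, z) exp(xz)` is the stationary Baker function `ψ_W`. -/
def reducedBaker {r : ℕ} (W : Submodule ℂ (RatVec r)) : Matrix (Fin r) (Fin r) Rat2 :=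
  if h : ∃ P, IsReducedBaker W P then h.choose else 0

/-! ### Calogero-Moser quadruples, the map `β`, and the bispectral involution -/

/-- Quadruples `(X, Y; v, w)` of complex matrices with `[X, Y] + v w = -I`. The points of the
Calogero-Moser space `C_n(r)` are the `GL_n(ℂ)`-orbits of such quadruples. -/
structure CMQuad (n r : ℕ) : Type where
  X : Matrix (Fin n) (Fin n) ℂ
  Y : Matrix (Fin n) (Fin n) ℂ
  v : Matrix (Fin n) (Fin r) ℂ
  w : Matrix (Fin r) (Fin n) ℂ
  moment : X * Y - Y * X + v * w = -1

/-- A complex matrix, as a matrix of constants in `ℂ(x, z)`. -/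
def constMat {m n : ℕ} (M : Matrix (Fin m) (Fin n) ℂ) : Matrix (Fin m) (Fin n) Rat2 :=
  M.map (algebraMap ℂ Rat2)

/-- `I + w (xI + X)⁻¹ (zI - Y)⁻¹ v`, which depends only on the orbit of the quadruple. -/
def CMQuad.baker {n r : ℕ} (q : CMQuad n r) : Matrix (Fin r) (Fin r) Rat2 :=
  1 + constMat q.w * (xx • 1 + constMat q.X)⁻¹ * (zz • 1 - constMat q.Y)⁻¹ * constMat q.v

/-- `W = β(X, Y; v, w)`: the point `W` of `Gr^ad(r)` whose stationary Baker function is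
`(I + w (xI + X)⁻¹ (zI - Y)⁻¹ v) exp(xz)`. -/
def IsBeta {n r : ℕ} (q : CMQuad n r) (W : Submodule ℂ (RatVec r)) : Prop :=
  W ∈ grAd r ∧ IsReducedBaker W q.baker

/-- The bispectral involution `(X, Y; v, w) ↦ -(Yᵗ, Xᵗ; wᵗ, vᵗ)` on quadruples. -/
def CMQuad.bisp {n r : ℕ} (q : CMQuad n r) : CMQuad n r where
  X := -q.Y.transpose
  Y := -q.X.transpose
  v := -q.w.transpose
  w := -q.v.transpose
  moment := by
    have h := congrArg Matrix.transpose q.moment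
    simp only [Matrix.transpose_add, Matrix.transpose_sub, Matrix.transpose_mul,
      Matrix.transpose_neg, Matrix.transpose_one] at h
    simpa [Matrix.neg_mul, Matrix.mul_neg] using h

/-- `V = b(U)`, for the involution `b` of `Gr^ad(r)` induced through `β` by the bispectral
involution of the Calogero-Moser spaces. -/
def IsBispectralImage {r : ℕ} (U V : Submodule ℂ (RatVec r)) : Prop :=
  ∃ (n : ℕ) (q : CMQuad n r), IsBeta q U ∧ IsBeta q.bisp V

open Classical in
/-- The bispectral involution `U ↦ b(U)` of `Gr^ad(r)`. -/
def bisp {r : ℕ} (U : Submodule ℂ (RatVec r)) : Submodule ℂ (RatVec r) :=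
  if h : ∃ V, IsBispectralImage U V then h.choose else U

/-! ### The algebra `𝒟(U)` and the anti-isomorphism -/

/-- `u ⋆ D = (Dᵗ.uᵗ)ᵗ` for a row vector `u` and a matrix `D` of differential operators. The entries
of `D` are put in the opposite ring: the multiplication of matrices over `DiffOpᵐᵒᵖ` is exactly
`D ⋆ E = (Eᵗ Dᵗ)ᵗ`. -/
def starVec {r s : ℕ} (u : RatVec r) (D : Matrix (Fin r) (Fin s) DiffOpᵐᵒᵖ) : RatVec s :=
  fun j => ∑ i, (D i j).unop.1 (u i)

theorem starVec_mul {r s t : ℕ} (u : RatVec r) (D : Matrix (Fin r) (Fin s) DiffOpᵐᵒᵖ)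
    (E : Matrix (Fin s) (Fin t) DiffOpᵐᵒᵖ) : starVec u (D * E) = starVec (starVec u D) E := by
  funext j
  simp only [starVec, Matrix.mul_apply, Finset.unop_sum, MulOpposite.unop_mul,
    AddSubmonoidClass.coe_finsetSum, LinearMap.sum_apply, map_sum]
  rw [Finset.sum_comm]
  rfl

/-- The algebra `𝒟(U)` of all `r × r` matrices `D` of differential operators such that
`U ⋆ D ⊆ U`, with the multiplication `⋆`. -/
def starAlg {r : ℕ} (U : Submodule ℂ (RatVec r)) :
    Subalgebra ℂ (Matrix (Fin r) (Fin r) DiffOpᵐᵒᵖ) where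
  carrier := {D | ∀ u ∈ U, starVec u D ∈ U}
  mul_mem' {D E} hD hE u hu := by
    rw [starVec_mul]
    exact hE _ (hD u hu)
  add_mem' {D E} hD hE u hu := by
    have : starVec u (D + E) = starVec u D + starVec u E := by
      funext j
      simp [starVec, Finset.sum_add_distrib]
    rw [this]
    exact U.add_mem (hD u hu) (hE u hu)
  algebraMap_mem' a u hu := by
    have : starVec u (algebraMap ℂ (Matrix (Fin r) (Fin r) DiffOpᵐᵒᵖ) a) = a • u := by
      funext j
      simp only [starVec, Matrix.algebraMap_matrix_apply]
      rw [Finset.sum_eq_single j]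
      · simp [MulOpposite.algebraMap_apply]
      · intro i _ hij
        simp [hij]
      · simp
    rw [this]
    exact U.smul_mem a hu

/-- `D(z)` applied to `F(x, z) exp(xz)`; the result is `(actZ D F)(x, z) exp(xz)`, because
`∂_z` acts on `F` as `∂_z + x`. -/
def actZ (D : DiffOp) : Module.End ℂ Rat2 :=
  opOfCoeffs (fun f => f.eval (algebraMap ℂ Rat2) zz)
    ((ddzz : Rat2 →ₗ[ℂ] Rat2) + LinearMap.mulLeft ℂ xx) (coeffs D)

/-- `D(x)` applied to `F(x, z) exp(xz)`; the result is `(actX D F)(x, z) exp(xz)`, because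
`∂_x` acts on `F` as `∂_x + z`. -/
def actX (D : DiffOp) : Module.End ℂ Rat2 :=
  opOfCoeffs (fun f => f.eval (algebraMap ℂ Rat2) xx)
    ((ddxx : Rat2 →ₗ[ℂ] Rat2) + LinearMap.mulLeft ℂ zz) (coeffs D)

/-- `ψ_U(x, z) ⋆ D(z) = Θ(x).ψ_U(x, z)`. -/
def BakerRelation {r : ℕ} (U : Submodule ℂ (RatVec r)) (D : Matrix (Fin r) (Fin r) DiffOpᵐᵒᵖ)
    (Θ : Matrix (Fin r) (Fin r) DiffOp) : Prop :=
  ∀ i j, ∑ k, actZ (D k j).unop (reducedBaker U i k) = ∑ k, actX (Θ i k) (reducedBaker U k j)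

end AdelicGr

end

noncomputable section
namespace AdelicGr
open Polynomial

/-! ### Rational functions of one variable: derivative, polynomial part, values -/

/-! An operator `∑ c_k(z) ∂^k` acts on `e^{xz}` as multiplication by `c(x,z) = ∑ c_k(z) x^k`. Its
symbol is therefore a function of `(x,z)` that is polynomial in `x` (`iota`). Under this dictionary,
composition from the right with `∂` and `z` becomes multiplication by `x` and `∂_x + z`, while
composition from the left with an operator in `z` becomes its action through `∂_z + x`. The two
actions commute. The central object is the right module `M = rowSyms U` of rows of operators that
map `ℂ[z]` to `U`.

Link with the closure of `U`: modulo a high power of a polynomial, `e^{xz}` may be replaced by a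
polynomial `T` with `T' ≡ xT`. Hence the values at `x` of the elements of `M` are exactly the
rational rows `u` for which `u e^{xz}` lies in the closure of `U` (`memClosure_of_mem_rowSyms`,
`exists_mem_of_memClosure`). The second inclusion needs every element of `U` to be `D.1` for some `D
∈ M`; primary decomposability gives this (`exists_rowSyms_coeff_zero`).

Link with Calogero-Moser quadruples: the condition `L_U = ℂ[z]^r` makes the passage to polynomial
parts injective on `M`, with image of finite codimension. If `χ` is the characteristic polynomial of
`∂` on the quotient, then `M` has a unique element with polynomial part `χ(∂) e_l`, and it equals
`χ(x)` times row `l` of the reduced Baker function. This proves uniqueness of the Baker function.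
The operators induced by `∂` and `z` on the quotient, together with the coefficients of `z⁻¹`, form
a quadruple that produces this function (`IsFrame.exists_quad`). Conversely, a quadruple defines
explicitly a right module `quadMod` whose constant terms form a point of the Grassmannian with the
prescribed Baker function (`isBeta_quadSpace`). So `β` is surjective and defined on every quadruple,
and `b(U)` exists.

The algebra `𝒟(U)`: once denominators in `x` are allowed, every element of `M` is obtained in
exactly one way from the rows of the Baker function by operators in `x`, because `(∂_x + z)^k`
applied to row `l` has leading term `z^k e_l`. An operator `D` belongs to `𝒟(U)` if and only if
composition with it preserves `M`, hence if and only if `ψ ⋆ D = Θ.ψ` for some `Θ`, which is then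
unique (`mem_starAlg_iff_exists`, `BakerRelation.unique`).

Duality: the Baker function of the bispectral quadruple is the transpose of the original one with
`x` and `z` exchanged (`bakerMat_bisp`). The relation `ψ ⋆ D = Θ.ψ` thus turns into the same kind of
relation for `b(U)`, with `Θᵗ` and `Dᵗ` in place of `D` and `Θ`. This makes `D ↦ Θᵗ` a bijection. It
reverses products because `D ↦ Θ` preserves them and transposition exchanges the factors. -/

/-- The embedding `ℂ[z] → ℂ(z)`. -/
abbrev toRat : ℂ[X] →ₐ[ℂ] Rat1 := IsScalarTower.toAlgHom ℂ ℂ[X] Rat1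

theorem toRat_injective : Function.Injective toRat := IsFractionRing.injective ℂ[X] Rat1

theorem toRat_ne_zero {p : ℂ[X]} (hp : p ≠ 0) : toRat p ≠ 0 := by
  rwa [Ne, map_eq_zero_iff _ toRat_injective]

theorem toRat_X : toRat X = RatFunc.X := RatFunc.algebraMap_X

theorem toRat_C (c : ℂ) : toRat (C c) = RatFunc.C c := RatFunc.algebraMap_C c

theorem exists_eq_toRat_div (f : Rat1) : ∃ a b : ℂ[X], b ≠ 0 ∧ f = toRat a / toRat b :=
  ⟨f.num, f.denom, f.denom_ne_zero, (RatFunc.num_div_denom f).symm⟩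

theorem ddz_toRat (p : ℂ[X]) : ddz (toRat p) = toRat (derivative p) := by
  have := quotRule_eq (K := Rat1) (A := ℂ[X]) Polynomial.derivative' p 1 one_ne_zero
  simp at this
  exact this

theorem ddz_pow_toRat (k : ℕ) (p : ℂ[X]) :
    ((ddz : Rat1 →ₗ[ℂ] Rat1) ^ k) (toRat p) = toRat ((derivative : ℂ[X] →ₗ[ℂ] ℂ[X]) ^ k <| p) := by
  induction k with
  | zero => simp
  | succ k ih =>
    rw [pow_succ', Module.End.mul_apply, ih, pow_succ', Module.End.mul_apply]
    exact ddz_toRat _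

/-- The space of rational functions which vanish at infinity. -/
def proper : Submodule ℂ Rat1 where
  carrier := {f | ∃ a b : ℂ[X], a.degree < b.degree ∧ f = toRat a / toRat b}
  zero_mem' := ⟨0, 1, by simp, by simp⟩
  add_mem' := by
    rintro _ _ ⟨a, b, h, rfl⟩ ⟨c, d, h', rfl⟩
    have hb : b ≠ 0 := by rintro rfl; simp at h
    have hd : d ≠ 0 := by rintro rfl; simp at h'
    refine ⟨a * d + b * c, b * d, ?_, ?_⟩
    · refine (degree_add_le _ _).trans_lt (max_lt ?_ ?_)
      · rw [degree_mul, degree_mul]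
        exact WithBot.add_lt_add_right (by simpa using hd) h
      · rw [degree_mul, degree_mul]
        exact WithBot.add_lt_add_left (by simpa using hb) h'
    · have := toRat_ne_zero hb
      have := toRat_ne_zero hd
      rw [map_add, map_mul, map_mul, map_mul]
      field_simp
  smul_mem' := by
    rintro c _ ⟨a, b, h, rfl⟩
    refine ⟨c • a, b, (degree_smul_le _ _).trans_lt h, ?_⟩
    rw [map_smul, smul_div_assoc]

theorem eq_zero_of_toRat_mem_proper {p : ℂ[X]} (h : toRat p ∈ proper) : p = 0 := by
  obtain ⟨a, b, hab, h⟩ := h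
  have hb : b ≠ 0 := by rintro rfl; simp at hab
  rw [eq_div_iff (toRat_ne_zero hb), ← map_mul] at h
  have h' := toRat_injective h
  by_contra hp
  rw [← h', degree_mul] at hab
  have : (0 : WithBot ℕ) ≤ p.degree := zero_le_degree_iff.mpr hp
  have h2 : b.degree ≤ p.degree + b.degree := le_add_of_nonneg_left this
  exact absurd hab (not_lt.mpr h2)

theorem exists_polyPart (f : Rat1) : ∃ p : ℂ[X], f - toRat p ∈ proper := by
  obtain ⟨a, b, hb, rfl⟩ := exists_eq_toRat_div f
  refine ⟨a / b, a % b, b, EuclideanDomain.mod_lt a hb, ?_⟩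
  have := toRat_ne_zero hb
  have h := congrArg toRat (EuclideanDomain.mod_add_div a b)
  rw [map_add, map_mul] at h
  rw [← h]
  field_simp
  ring

/-- The polynomial part of a rational function. -/
def polyPart : Rat1 →ₗ[ℂ] ℂ[X] where
  toFun f := (exists_polyPart f).choose
  map_add' f g := by
    refine sub_eq_zero.mp (eq_zero_of_toRat_mem_proper ?_)
    have h := sub_mem (add_mem (exists_polyPart f).choose_spec (exists_polyPart g).choose_spec)
      (exists_polyPart (f + g)).choose_spec
    rw [map_sub, map_add]
    convert! h using 1
    ring
  map_smul' c f := by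
    refine sub_eq_zero.mp (eq_zero_of_toRat_mem_proper ?_)
    have h := sub_mem (proper.smul_mem c (exists_polyPart f).choose_spec)
      (exists_polyPart (c • f)).choose_spec
    rw [map_sub, RingHom.id_apply, map_smul]
    convert! h using 1
    rw [smul_sub]
    ring

theorem sub_polyPart_mem (f : Rat1) : f - toRat (polyPart f) ∈ proper :=
  (exists_polyPart f).choose_spec

theorem polyPart_eq {f : Rat1} {p : ℂ[X]} (h : f - toRat p ∈ proper) : polyPart f = p := by
  refine sub_eq_zero.mp (eq_zero_of_toRat_mem_proper ?_)
  have := sub_mem h (sub_polyPart_mem f)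
  rw [map_sub]
  convert! this using 1
  ring

@[simp] theorem polyPart_toRat (p : ℂ[X]) : polyPart (toRat p) = p := polyPart_eq (by simp)

theorem polyPart_eq_zero_iff {f : Rat1} : polyPart f = 0 ↔ f ∈ proper :=
  ⟨fun h => by simpa [h] using sub_polyPart_mem f, fun h => polyPart_eq (by simpa using h)⟩

/-- The coefficient of `z⁻¹` in the expansion at infinity. -/
def resInf : Rat1 →ₗ[ℂ] ℂ :=
  (lcoeff ℂ 0).comp (polyPart.comp (LinearMap.mulLeft ℂ RatFunc.X))

/-- Multiplying a proper fraction by `z` raises the degree of its numerator at most to that of its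
denominator. Only a constant can enter the polynomial part, namely the coefficient of `z⁻¹`. -/
theorem polyPart_X_mul (f : Rat1) :
    polyPart (RatFunc.X * f) = X * polyPart f + C (resInf f) := by
  have key : ∃ c : ℂ, polyPart (RatFunc.X * f) = X * polyPart f + C c := by
    obtain ⟨a, b, hab, h⟩ := sub_polyPart_mem f
    have hb : b ≠ 0 := by rintro rfl; simp at hab
    have hb' := toRat_ne_zero hb
    have hdeg : (X * a / b).natDegree = 0 := by
      by_cases ha : a = 0
      · simp [ha]
      by_cases hle : b.degree ≤ (X * a).degree
      · have h1 := natDegree_lt_natDegree ha hab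
        have h2 := degree_add_div hb hle
        by_cases hq : X * a / b = 0
        · simp [hq]
        rw [← degree_mul] at h2
        have h3 := natDegree_eq_of_degree_eq h2
        rw [natDegree_mul hb hq, natDegree_X_mul ha] at h3
        omega
      · rw [(Polynomial.div_eq_zero_iff hb).mpr (not_le.mp hle), natDegree_zero]
    obtain ⟨c, hc⟩ := natDegree_eq_zero.mp hdeg
    refine ⟨c, polyPart_eq ⟨(X * a) % b, b, EuclideanDomain.mod_lt _ hb, ?_⟩⟩
    rw [hc]
    have h2 : RatFunc.X * f = RatFunc.X * (toRat (polyPart f) + toRat a / toRat b) := by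
      rw [← h]; ring
    rw [h2]
    have h3 := congrArg toRat (EuclideanDomain.mod_add_div (X * a) b)
    rw [map_add, map_mul, map_mul, toRat_X] at h3
    rw [map_add, map_mul, toRat_X]
    generalize toRat (polyPart f) = P at *
    field_simp
    linear_combination -h3
  obtain ⟨c, hc⟩ := key
  have : resInf f = c := by
    simp [resInf, hc, mul_coeff_zero]
  rw [hc, this]

/-! #### Values of rational functions -/

/-- The value of a rational function at a complex number. -/
abbrev val (z : ℂ) (f : Rat1) : ℂ := f.eval (RingHom.id ℂ) z

theorem val_div {a b : ℂ[X]} {z : ℂ} (hb : b.eval z ≠ 0) :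
    val z (toRat a / toRat b) = a.eval z / b.eval z := by
  have hb0 : b ≠ 0 := by rintro rfl; simp at hb
  set f := toRat a / toRat b with hf
  have h : f.num * b = a * f.denom := by
    rw [RatFunc.num_mul_eq_mul_denom_iff hb0]; exact hf
  have hd : f.denom ∣ b := RatFunc.denom_div_dvd a b
  have hd0 : f.denom.eval z ≠ 0 := by
    obtain ⟨c, hc⟩ := hd
    intro h0
    rw [hc, eval_mul, h0, zero_mul] at hb
    exact hb rfl
  have h2 := congrArg (eval z) h
  rw [eval_mul, eval_mul] at h2
  rw [val, RatFunc.eval, eval₂_id, eval₂_id, div_eq_div_iff hd0 hb, h2]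

theorem val_toRat (p : ℂ[X]) (z : ℂ) : val z (toRat p) = p.eval z := by
  simp

/-- Outside a finite set, a polynomial does not vanish. -/
theorem eventually_eval_ne_zero {p : ℂ[X]} (hp : p ≠ 0) :
    ∀ᶠ z : ℂ in Filter.cofinite, p.eval z ≠ 0 := by
  have : {z : ℂ | ¬ p.eval z ≠ 0}.Finite := by
    refine (p.roots.toFinset.finite_toSet).subset fun z hz => ?_
    simp only [not_not, Set.mem_ofPred_eq] at hz
    simpa [hp] using hz
  exact this

theorem eventually_val_mul (f g : Rat1) :
    ∀ᶠ z : ℂ in Filter.cofinite, val z (f * g) = val z f * val z g := by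
  obtain ⟨a, b, hb, rfl⟩ := exists_eq_toRat_div f
  obtain ⟨c, d, hd, rfl⟩ := exists_eq_toRat_div g
  filter_upwards [eventually_eval_ne_zero hb, eventually_eval_ne_zero hd] with z h1 h2
  rw [div_mul_div_comm, ← map_mul, ← map_mul, val_div h1, val_div h2, val_div (by simp [h1, h2])]
  simp [div_mul_div_comm]

theorem eventually_val_add (f g : Rat1) :
    ∀ᶠ z : ℂ in Filter.cofinite, val z (f + g) = val z f + val z g := by
  obtain ⟨a, b, hb, rfl⟩ := exists_eq_toRat_div f
  obtain ⟨c, d, hd, rfl⟩ := exists_eq_toRat_div g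
  filter_upwards [eventually_eval_ne_zero hb, eventually_eval_ne_zero hd] with z h1 h2
  rw [div_add_div _ _ (toRat_ne_zero hb) (toRat_ne_zero hd), ← map_mul, ← map_mul, ← map_mul,
    ← map_add, val_div h1, val_div h2, val_div (by simp [h1, h2]), div_add_div _ _ h1 h2]
  simp

theorem tendsto_val_of_mem_proper {f : Rat1} (hf : f ∈ proper) :
    Filter.Tendsto (fun z => val z f) (Bornology.cobounded ℂ) (𝓝 0) := by
  obtain ⟨a, b, hab, rfl⟩ := hf
  by_cases ha : a = 0
  · subst ha; simp [val]
  have hb : b ≠ 0 := by rintro rfl; simp at hab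
  have hlt := natDegree_lt_natDegree ha hab
  -- Reversed polynomials turn the limit at infinity into continuity at `0` in the variable `z⁻¹`.
  have hrev : ∀ (p : ℂ[X]) (z : ℂ), z ≠ 0 → p.eval z = p.reverse.eval z⁻¹ * z ^ p.natDegree := by
    intro p z hz
    have : Invertible z := invertibleOfNonzero hz
    have := eval₂_reverse_mul_pow (RingHom.id ℂ) z p
    rw [invOf_eq_inv, eval₂_id, eval₂_id] at this
    exact this.symm
  have hinv := Filter.tendsto_inv₀_cobounded (α := ℂ)
  have hT : ∀ p : ℂ[X], Filter.Tendsto (fun z : ℂ => p.reverse.eval z⁻¹) (Bornology.cobounded ℂ)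
      (𝓝 p.leadingCoeff) := by
    intro p
    have : p.leadingCoeff = p.reverse.eval 0 := by
      rw [← coeff_zero_eq_eval_zero, coeff_zero_reverse]
    rw [this]
    exact (p.reverse.continuous.tendsto 0).comp hinv
  have hmain : Filter.Tendsto (fun z : ℂ => a.reverse.eval z⁻¹ / b.reverse.eval z⁻¹ *
      z⁻¹ ^ (b.natDegree - a.natDegree)) (Bornology.cobounded ℂ) (𝓝 0) := by
    have h1 := ((hT a).div (hT b) (by simpa using hb)).mul (hinv.pow (b.natDegree - a.natDegree))
    rwa [zero_pow (by omega), mul_zero] at h1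
  refine hmain.congr' ?_
  filter_upwards [(Filter.le_cofinite_iff_eventually_ne.mp
    (Bornology.le_cofinite ℂ)) 0, (Bornology.le_cofinite ℂ) (eventually_eval_ne_zero hb)] with z hz hbz
  rw [val_div hbz, hrev a z hz, hrev b z hz]
  have e : b.natDegree = a.natDegree + (b.natDegree - a.natDegree) := by omega
  conv_rhs => rw [e, pow_add]
  rw [inv_pow]
  rw [hrev b z hz] at hbz
  have := (mul_ne_zero_iff.mp hbz).1
  field_simp

/-- The polynomial part differs from `f` by a proper fraction, so it also tends to `0`. A
nonconstant polynomial is unbounded at infinity. -/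
theorem mem_proper_of_tendsto {f : Rat1}
    (hf : Filter.Tendsto (fun z => val z f) (Bornology.cobounded ℂ) (𝓝 0)) : f ∈ proper := by
  have h1 := tendsto_val_of_mem_proper (sub_polyPart_mem f)
  rw [← polyPart_eq_zero_iff]
  set p := polyPart f
  have h2 : Filter.Tendsto (fun z => p.eval z) (Bornology.cobounded ℂ) (𝓝 0) := by
    have h3 := hf.sub h1
    rw [sub_zero] at h3
    refine h3.congr' ?_
    filter_upwards [(Bornology.le_cofinite ℂ) (eventually_val_add (f - toRat p) (toRat p))] with z hz
    rw [sub_add_cancel, val_toRat] at hz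
    rw [hz]
    ring
  by_contra hp
  by_cases hdeg : 0 < p.degree
  · have h4 := p.tendsto_norm_atTop hdeg (tendsto_norm_cobounded_atTop (E := ℂ))
    exact not_tendsto_nhds_of_tendsto_atTop h4 _ h2.norm
  · obtain ⟨c, hc⟩ : ∃ c, p = C c := ⟨_, eq_C_of_degree_le_zero (not_lt.mp hdeg)⟩
    rw [hc] at h2
    simp only [eval_C] at h2
    have := tendsto_nhds_unique h2 tendsto_const_nhds
    rw [hc, ← this] at hp
    simp at hp

theorem eq_of_eventually_val_eq {f g : Rat1}
    (h : ∀ᶠ z : ℂ in Filter.cofinite, val z f = val z g) : f = g := by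
  obtain ⟨a, b, hb, rfl⟩ := exists_eq_toRat_div f
  obtain ⟨c, d, hd, rfl⟩ := exists_eq_toRat_div g
  rw [div_eq_div_iff (toRat_ne_zero hb) (toRat_ne_zero hd), ← map_mul, ← map_mul]
  congr 1
  refine eq_of_infinite_eval_eq _ _ ?_
  have : ∀ᶠ z : ℂ in Filter.cofinite, (a * d).eval z = (c * b).eval z := by
    filter_upwards [h, eventually_eval_ne_zero hb, eventually_eval_ne_zero hd] with z h h1 h2
    rw [val_div h1, val_div h2, div_eq_div_iff h1 h2] at h
    simpa using h
  have hne : (Filter.cofinite : Filter ℂ).NeBot := inferInstance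
  exact Filter.frequently_cofinite_iff_infinite.mp this.frequently

end AdelicGr
end

noncomputable section
namespace AdelicGr
open Polynomial

/-! ### Symbols of differential operators and their action on polynomials -/

/-- Symbols `∑ c_k X^k` of differential operators, with `X` in the role of `∂`. -/
abbrev Sym : Type := Polynomial Rat1

/-- The operator `∂ + x` on `ℂ[z]`. -/
def delta (x : ℂ) : Module.End ℂ ℂ[X] := derivative + x • 1

theorem delta_apply (x : ℂ) (f : ℂ[X]) : delta x f = derivative f + C x * f := by
  simp [delta, smul_eq_C_mul]

theorem delta_zero : delta 0 = (derivative : ℂ[X] →ₗ[ℂ] ℂ[X]) := by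
  simp [delta]

/-- This is the commutator `[(∂ + x)^k, z] = k (∂ + x)^(k-1)`. The truncated exponent at `k = 0` is
harmless because its coefficient is `0`. -/
theorem delta_pow_X_mul (x : ℂ) (k : ℕ) (f : ℂ[X]) :
    (delta x ^ k) (X * f) = X * (delta x ^ k) f + (k : ℂ[X]) * (delta x ^ (k - 1)) f := by
  induction k with
  | zero => simp
  | succ k ih =>
    rw [pow_succ', Module.End.mul_apply, ih, Module.End.mul_apply, delta_apply, delta_apply]
    rcases k with _ | k
    · simp; ring
    · rw [pow_succ' (delta x) k, Nat.add_sub_cancel, Nat.add_sub_cancel, pow_succ' (delta x) k]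
      simp only [Module.End.mul_apply, delta_apply, derivative_add, derivative_mul, derivative_X,
        derivative_natCast, derivative_C]
      push_cast
      ring

theorem delta_pow_one (x : ℂ) (k : ℕ) : (delta x ^ k) (1 : ℂ[X]) = C (x ^ k) := by
  induction k with
  | zero => simp
  | succ k ih => rw [pow_succ', Module.End.mul_apply, ih, delta_apply]; simp [pow_succ']

/-- `app x f c` is `∑ c_k (∂ + x)^k f`. -/
def app (x : ℂ) (f : ℂ[X]) : Sym →ₗ[Rat1] Rat1 :=
  Polynomial.lsum fun k => LinearMap.mulRight Rat1 (toRat ((delta x ^ k) f))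

theorem app_apply (x : ℂ) (f : ℂ[X]) (c : Sym) :
    app x f c = c.sum fun k a => a * toRat ((delta x ^ k) f) := rfl

@[simp] theorem app_monomial (x : ℂ) (f : ℂ[X]) (k : ℕ) (a : Rat1) :
    app x f (monomial k a) = a * toRat ((delta x ^ k) f) := by
  rw [app_apply, sum_monomial_index _ _ (by simp)]

theorem app_C_mul (x : ℂ) (f : ℂ[X]) (a : Rat1) (c : Sym) : app x f (C a * c) = a * app x f c := by
  rw [← smul_eq_C_mul, map_smul, smul_eq_mul]

theorem app_add_left (x : ℂ) (f g : ℂ[X]) (c : Sym) : app x (f + g) c = app x f c + app x g c := by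
  induction c using Polynomial.induction_on' with
  | add p q hp hq => rw [map_add, hp, hq, map_add, map_add]; ring
  | monomial k a => simp [mul_add]

theorem app_smul_left (x y : ℂ) (f : ℂ[X]) (c : Sym) : app x (y • f) c = y • app x f c := by
  induction c using Polynomial.induction_on' with
  | add p q hp hq => rw [map_add, hp, hq, map_add, smul_add]
  | monomial k a => simp only [app_monomial, map_smul, mul_smul_comm]

theorem app_X_mul (x : ℂ) (f : ℂ[X]) (c : Sym) : app x f (X * c) = app x (delta x f) c := by
  induction c using Polynomial.induction_on' with
  | add p q hp hq => rw [mul_add, map_add, hp, hq, map_add]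
  | monomial k a => rw [X_mul_monomial, app_monomial, app_monomial, pow_succ, Module.End.mul_apply]

/-- The symbol of `D ∘ z`, where `c` is the symbol of `D`. -/
def zop : Sym →ₗ[ℂ] Sym where
  toFun c := C RatFunc.X * c + derivative c
  map_add' c d := by rw [derivative_add]; ring
  map_smul' a c := by simp

theorem zop_apply (c : Sym) : zop c = C RatFunc.X * c + derivative c := rfl

theorem app_zop (x : ℂ) (f : ℂ[X]) (c : Sym) : app x f (zop c) = app x (X * f) c := by
  induction c using Polynomial.induction_on' with
  | add p q hp hq => rw [map_add, map_add, hp, hq, map_add]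
  | monomial k a =>
    rw [zop_apply, map_add, app_C_mul, derivative_monomial, app_monomial, app_monomial,
      app_monomial, delta_pow_X_mul, map_add, map_mul, map_mul, toRat_X, map_natCast]
    ring

/-- Iterating `app_zop` shows that `aeval zop f c` is the symbol of `D ∘ f` when `c` is the symbol
of `D`. The order of the factors is immaterial since polynomials in `z` commute. -/
theorem app_aeval_zop (x : ℂ) (f g : ℂ[X]) (c : Sym) :
    app x g (aeval zop f c) = app x (f * g) c := by
  induction f using Polynomial.induction_on generalizing c with
  | C a =>
    rw [aeval_C, Module.algebraMap_end_apply, ← smul_eq_C_mul, app_smul_left, LinearMap.map_smul_of_tower]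
  | add p q hp hq =>
    rw [map_add, LinearMap.add_apply, map_add, hp, hq, add_mul, app_add_left]
  | monomial n a ih =>
    rw [pow_succ, ← mul_assoc, map_mul, Module.End.mul_apply, aeval_X, ih, app_zop]
    congr 1
    ring_nf

/-- Since `(∂ + x)^k 1 = x^k`, evaluating a symbol at `x` gives `e^{-xz} D(e^{xz})`. This is how
symbols become functions of `(x,z)`. -/
theorem app_one (x : ℂ) (c : Sym) : app x 1 c = c.eval (RatFunc.C x) := by
  induction c using Polynomial.induction_on' with
  | add p q hp hq => rw [map_add, hp, hq, eval_add]
  | monomial k a => rw [app_monomial, delta_pow_one, toRat_C, eval_monomial, map_pow]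

theorem app_zero_one (c : Sym) : app 0 1 c = c.coeff 0 := by
  rw [app_one, map_zero, ← coeff_zero_eq_eval_zero]

/-! #### Congruences -/

/-- For `T = e^{xz}` one has `∂^k (T f) = T (∂ + x)^k f`. If `T' = xT` holds only modulo `a^n`, the
identity survives with one factor `a` lost per derivative. -/
theorem pow_dvd_delta_mul_sub {a T : ℂ[X]} {x : ℂ} {n : ℕ} (hT : a ^ n ∣ derivative T - C x * T)
    (f : ℂ[X]) {k : ℕ} (hk : k ≤ n) :
    a ^ (n - k) ∣ (delta 0 ^ k) (T * f) - T * (delta x ^ k) f := by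
  induction k with
  | zero => simp
  | succ k ih =>
    have h1 := ih (by omega)
    rw [pow_succ', Module.End.mul_apply, pow_succ', Module.End.mul_apply]
    set u := (delta 0 ^ k) (T * f)
    set v := (delta x ^ k) f
    have e : delta 0 u - T * delta x v = derivative (u - T * v) + (derivative T - C x * T) * v := by
      rw [delta_apply, delta_apply, derivative_sub, derivative_mul]
      simp
      ring
    rw [e]
    refine dvd_add ?_ (((pow_dvd_pow a (by omega)).trans hT).mul_right v)
    have := pow_sub_one_dvd_derivative_of_pow_dvd h1
    rwa [Nat.sub_sub] at this

theorem pow_dvd_delta_zero {a f : ℂ[X]} {n : ℕ} (hf : a ^ n ∣ f) (k : ℕ) :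
    a ^ (n - k) ∣ (delta 0 ^ k) f := by
  rw [delta_zero, Module.End.pow_apply]
  exact pow_sub_dvd_iterate_derivative_of_pow_dvd k hf

/-- `s` is a common denominator of the coefficients of the entries of `c`. -/
def IsDenom {r : ℕ} (s : ℂ[X]) (c : Fin r → Sym) : Prop :=
  ∀ i k, ∃ b : ℂ[X], toRat s * (c i).coeff k = toRat b

theorem exists_isDenom {r : ℕ} (c : Fin r → Sym) : ∃ s : ℂ[X], s ≠ 0 ∧ IsDenom s c := by
  classical
  obtain ⟨b, hb⟩ := IsLocalization.exist_integer_multiples (nonZeroDivisors ℂ[X])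
    ((Finset.univ : Finset (Fin r)).sigma fun i => (c i).support) (fun y => (c y.1).coeff y.2)
  refine ⟨b, nonZeroDivisors.ne_zero b.2, fun i k => ?_⟩
  by_cases hk : k ∈ (c i).support
  · obtain ⟨a, ha⟩ := hb ⟨i, k⟩ (by simpa using hk)
    refine ⟨a, ?_⟩
    have h2 : toRat a = (b : ℂ[X]) • (c i).coeff k := ha
    rw [h2, Algebra.smul_def]
    rfl
  · exact ⟨0, by simp [notMem_support_iff.mp hk]⟩

theorem exists_degree_bound {r : ℕ} (c : Fin r → Sym) : ∃ n : ℕ, ∀ i, (c i).natDegree < n := by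
  obtain ⟨n, hn⟩ := (Set.finite_range fun i => (c i).natDegree).bddAbove
  exact ⟨n + 1, fun i => Nat.lt_succ_of_le (hn ⟨i, rfl⟩)⟩

/-- In each `u k` the factor `s` cancels the denominators of the coefficients, and the factor `p` is
left over. -/
theorem sum_eq_toRat_mul {r : ℕ} {s p : ℂ[X]} {c : Fin r → Sym} (hs : IsDenom s c) {n : ℕ} {i : Fin r}
    (hn : (c i).natDegree < n) {u : ℕ → ℂ[X]} (hu : ∀ k < n, p * s ∣ u k) :
    ∃ g : ℂ[X], ((c i).sum fun k a => a * toRat (u k)) = toRat p * toRat g := by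
  choose b hb using hs i
  choose! q hq using hu
  refine ⟨∑ k ∈ Finset.range n, b k * q k, ?_⟩
  rw [sum_over_range' _ (by simp) n hn, map_sum, Finset.mul_sum]
  refine Finset.sum_congr rfl fun k hk => ?_
  rw [hq k (Finset.mem_range.mp hk), map_mul, map_mul, map_mul, ← hb k]
  ring

theorem mem_polyVec {r : ℕ} {u : RatVec r} : u ∈ polyVec r ↔ ∃ g : Fin r → ℂ[X], ∀ i, u i = toRat (g i) := by
  constructor
  · intro h
    choose g hg using h
    exact ⟨g, fun i => (hg i).symm⟩
  · rintro ⟨g, hg⟩ i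
    exact ⟨g i, (hg i).symm⟩

/-- As `n` exceeds the order of the operators, at least one factor `p * s` survives all the
differentiations in `pow_dvd_delta_mul_sub`. The error of moving `T` across the operator is thus a
multiple of `p`, which `W` absorbs. -/
theorem app_mul_sub_mem {r : ℕ} {s p T : ℂ[X]} {x : ℂ} {c : Fin r → Sym} (hs : IsDenom s c) {n : ℕ}
    (hn : ∀ i, (c i).natDegree < n) (hT : (p * s) ^ n ∣ derivative T - C x * T) (f : ℂ[X]) :
    ∃ g : Fin r → ℂ[X], ∀ i, app 0 (T * f) (c i) - toRat T * app x f (c i) = toRat p * toRat (g i) := by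
  have h : ∀ i, ∃ g : ℂ[X], app 0 (T * f) (c i) - toRat T * app x f (c i) = toRat p * toRat g := by
    intro i
    obtain ⟨g, hg⟩ := sum_eq_toRat_mul (p := p) hs (hn i)
      (u := fun k => (delta 0 ^ k) (T * f) - T * (delta x ^ k) f)
      (fun k hk => (dvd_pow_self _ (by omega)).trans (pow_dvd_delta_mul_sub hT f hk.le))
    refine ⟨g, ?_⟩
    rw [← hg, app_apply, app_apply, sum_def, sum_def, sum_def, Finset.mul_sum,
      ← Finset.sum_sub_distrib]
    refine Finset.sum_congr rfl fun k _ => ?_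
    rw [map_sub, map_mul toRat T]
    ring
  choose g hg using h
  exact ⟨g, hg⟩

theorem app_eq_mul_of_pow_dvd {r : ℕ} {s p f : ℂ[X]} {c : Fin r → Sym} (hs : IsDenom s c) {n : ℕ}
    (hn : ∀ i, (c i).natDegree < n) (hf : (p * s) ^ n ∣ f) :
    ∃ g : Fin r → ℂ[X], ∀ i, app 0 f (c i) = toRat p * toRat (g i) := by
  have h : ∀ i, ∃ g : ℂ[X], app 0 f (c i) = toRat p * toRat g := by
    intro i
    exact sum_eq_toRat_mul (p := p) hs (hn i) (u := fun k => (delta 0 ^ k) f)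
      (fun k hk => (dvd_pow_self _ (by omega)).trans (pow_dvd_delta_zero hf k))
  choose g hg using h
  exact ⟨g, hg⟩

/-! #### Right modules of symbols -/

/-- A space of rows of symbols is stable under composition from the right with `∂` and `z`. -/
structure RightStable {r : ℕ} (M : Submodule ℂ (Fin r → Sym)) : Prop where
  X_mul : ∀ c ∈ M, (fun i => X * c i) ∈ M
  zop_mem : ∀ c ∈ M, (fun i => zop (c i)) ∈ M

/-- `g(∂)` for a polynomial `g` with constant coefficients. -/
abbrev cst : ℂ[X] →+* Sym := mapRingHom (algebraMap ℂ Rat1)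

theorem RightStable.cst_mul {r : ℕ} {M : Submodule ℂ (Fin r → Sym)} (hM : RightStable M) (g : ℂ[X])
    {c : Fin r → Sym} (hc : c ∈ M) : (fun i => cst g * c i) ∈ M := by
  induction g using Polynomial.induction_on with
  | C a =>
    have : (fun i => cst (C a) * c i) = a • c := by
      funext i
      simp [Algebra.smul_def, Polynomial.algebraMap_apply]
    rw [this]
    exact M.smul_mem a hc
  | add p q hp hq =>
    have : (fun i => cst (p + q) * c i) = (fun i => cst p * c i) + fun i => cst q * c i := by
      funext i
      rw [map_add, add_mul]
      rfl
    rw [this]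
    exact M.add_mem hp hq
  | monomial n a ih =>
    have := hM.X_mul _ ih
    convert! this using 2 with i
    simp [pow_succ]
    ring

theorem RightStable.aeval_zop {r : ℕ} {M : Submodule ℂ (Fin r → Sym)} (hM : RightStable M) (f : ℂ[X])
    {c : Fin r → Sym} (hc : c ∈ M) : (fun i => aeval zop f (c i)) ∈ M := by
  induction f using Polynomial.induction_on with
  | C a =>
    have : (fun i => aeval zop (C a) (c i)) = a • c := by
      funext i
      simp [Module.algebraMap_end_apply]
    rw [this]
    exact M.smul_mem a hc
  | add p q hp hq =>
    have : (fun i => aeval zop (p + q) (c i)) =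
        (fun i => aeval zop p (c i)) + fun i => aeval zop q (c i) := by
      funext i
      simp
    rw [this]
    exact M.add_mem hp hq
  | monomial n a ih =>
    have := hM.zop_mem _ ih
    convert! this using 2 with i
    rw [pow_succ', mul_left_comm, map_mul, Module.End.mul_apply, aeval_X]

/-- The symbols of the rows of operators which map `ℂ[z]` to `W`. -/
def rowSyms {r : ℕ} (W : Submodule ℂ (RatVec r)) : Submodule ℂ (Fin r → Sym) where
  carrier := {c | ∀ f : ℂ[X], (fun i => app 0 f (c i)) ∈ W}
  zero_mem' f := by
    convert! W.zero_mem using 1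
  add_mem' hc hd f := by
    convert! W.add_mem (hc f) (hd f) using 1
    funext i
    simp
  smul_mem' a c hc f := by
    convert! W.smul_mem a (hc f) using 1
    funext i
    simp [LinearMap.map_smul_of_tower]

theorem mem_rowSyms {r : ℕ} {W : Submodule ℂ (RatVec r)} {c : Fin r → Sym} :
    c ∈ rowSyms W ↔ ∀ f : ℂ[X], (fun i => app 0 f (c i)) ∈ W := Iff.rfl

theorem rightStable_rowSyms {r : ℕ} (W : Submodule ℂ (RatVec r)) : RightStable (rowSyms W) where
  X_mul c hc f := by simpa only [app_X_mul] using hc (delta 0 f)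
  zop_mem c hc f := by simpa only [app_zop] using hc (X * f)

theorem toRat_mul_mem {r : ℕ} {p : ℂ[X]} {W : Submodule ℂ (RatVec r)} (hp : ContainsMultiples p W)
    (g : Fin r → ℂ[X]) : (fun i => toRat p * toRat (g i)) ∈ W :=
  hp (fun i => toRat (g i)) (mem_polyVec.mpr ⟨g, fun _ => rfl⟩)

/-- The symbol of an operator with polynomial coefficients. -/
abbrev polySym : ℂ[X][X] →+* Sym := mapRingHom (algebraMap ℂ[X] Rat1)

/-- An operator with polynomial coefficients preserves `ℂ[z]`, so `p` times a row of such operators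
lands in `p ℂ[z]^r`. -/
theorem C_mul_polySym_mem {r : ℕ} {p : ℂ[X]} {W : Submodule ℂ (RatVec r)} (hp : ContainsMultiples p W)
    (d : Fin r → ℂ[X][X]) : (fun i => C (toRat p) * polySym (d i)) ∈ rowSyms W := by
  intro f
  have h : ∀ e : ℂ[X][X], ∃ g : ℂ[X], app 0 f (polySym e) = toRat g := by
    intro e
    induction e using Polynomial.induction_on' with
    | add a b ha hb =>
      obtain ⟨g, hg⟩ := ha
      obtain ⟨g', hg'⟩ := hb
      exact ⟨g + g', by rw [map_add, map_add, hg, hg', map_add]⟩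
    | monomial k a =>
      refine ⟨a * (delta 0 ^ k) f, ?_⟩
      rw [coe_mapRingHom, map_monomial, app_monomial, map_mul]
      rfl
  choose g hg using fun i => h (d i)
  have := toRat_mul_mem hp g
  convert! this using 2 with i
  rw [app_C_mul, hg]

end AdelicGr
end

noncomputable section
namespace AdelicGr
open Polynomial

/-! ### The closure of a fat space -/

theorem eq_of_eventually_cofinite {f g : ℂ → ℂ} (hf : Continuous f) (hg : Continuous g)
    (h : ∀ᶠ z in Filter.cofinite, f z = g z) : f = g := by
  refine Continuous.ext_on (s := {z | f z = g z}) ?_ hf hg fun z hz => hz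
  have h1 : {z | ¬ f z = g z}.Finite := h
  have := h1.countable.dense_compl ℂ
  convert! this using 1
  ext z
  simp

/-- Division with remainder of an entire function by a polynomial. -/
theorem exists_eq_add_mul {f : ℂ → ℂ} (hf : Differentiable ℂ f) {a : ℂ[X]} (ha : a ≠ 0) :
    ∃ (T : ℂ[X]) (e : ℂ → ℂ), Differentiable ℂ e ∧ ∀ z, f z = T.eval z + a.eval z * e z := by
  induction hn : a.natDegree generalizing a with
  | zero =>
    obtain ⟨c, rfl⟩ := natDegree_eq_zero.mp hn
    have hc : c ≠ 0 := by simpa using ha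
    refine ⟨0, fun z => c⁻¹ * f z, hf.const_mul _, fun z => ?_⟩
    rw [eval_zero, eval_C, mul_inv_cancel_left₀ hc, zero_add]
  | succ n ih =>
    obtain ⟨l, hl⟩ := Complex.exists_root (f := a) (natDegree_pos_iff_degree_pos.mp (by omega))
    obtain ⟨b, rfl⟩ := dvd_iff_isRoot.mpr hl
    have hb : b ≠ 0 := right_ne_zero_of_mul ha
    rw [natDegree_mul (X_sub_C_ne_zero l) hb, natDegree_X_sub_C] at hn
    obtain ⟨T, e, he, h⟩ := ih hb (by omega)
    refine ⟨T + b * C (e l), dslope e l, ?_, fun z => ?_⟩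
    · rw [← differentiableOn_univ] at he ⊢
      exact (Complex.differentiableOn_dslope Filter.univ_mem).mpr he
    · rw [h]
      have := sub_smul_dslope e l z
      rw [smul_eq_mul] at this
      simp only [eval_add, eval_mul, eval_C, eval_sub, eval_X]
      linear_combination (-(eval z b)) * this

/-- The linear factors of `b` are cancelled one at a time. Away from the root this is division, and
continuity restores the identity at the root. -/
theorem dvd_of_eval_eq_mul {f b : ℂ[X]} {e : ℂ → ℂ} (he : Continuous e) (hb : b ≠ 0)
    (h : ∀ z, f.eval z = b.eval z * e z) : b ∣ f := by
  induction hn : b.natDegree generalizing b f with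
  | zero =>
    obtain ⟨c, rfl⟩ := natDegree_eq_zero.mp hn
    have hc : c ≠ 0 := by simpa using hb
    exact (isUnit_C.mpr (isUnit_iff_ne_zero.mpr hc)).dvd
  | succ n ih =>
    obtain ⟨l, hl⟩ := Complex.exists_root (f := b) (natDegree_pos_iff_degree_pos.mp (by omega))
    obtain ⟨b, rfl⟩ := dvd_iff_isRoot.mpr hl
    have hb : b ≠ 0 := right_ne_zero_of_mul hb
    rw [natDegree_mul (X_sub_C_ne_zero l) hb, natDegree_X_sub_C] at hn
    have hfl : f.IsRoot l := by
      rw [IsRoot, h, hl, zero_mul]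
    obtain ⟨f, rfl⟩ := dvd_iff_isRoot.mpr hfl
    refine mul_dvd_mul_left _ (ih hb ?_ (by omega))
    have key : (fun z => f.eval z) = fun z => b.eval z * e z := by
      refine eq_of_eventually_cofinite f.continuous (b.continuous.mul he) ?_
      filter_upwards [eventually_eval_ne_zero (X_sub_C_ne_zero l)] with z hz
      have := h z
      rw [eval_mul, eval_mul, mul_assoc] at this
      exact mul_left_cancel₀ hz this
    exact fun z => congrFun key z

theorem exists_eq_toRat_mul {f : Rat1} {p : ℂ[X]} (hp : p ≠ 0) {e : ℂ → ℂ} (he : Continuous e)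
    (h : ∀ᶠ z in Filter.cofinite, val z f = p.eval z * e z) :
    ∃ g : ℂ[X], f = toRat p * toRat g := by
  obtain ⟨a, b, hb, rfl⟩ := exists_eq_toRat_div f
  have key : (fun z => a.eval z) = fun z => (b * p).eval z * e z := by
    refine eq_of_eventually_cofinite a.continuous ((b * p).continuous.mul he) ?_
    filter_upwards [h, eventually_eval_ne_zero hb] with z h hz
    rw [val_div hz, div_eq_iff hz] at h
    rw [h, eval_mul]
    ring
  obtain ⟨g, rfl⟩ := dvd_of_eval_eq_mul he (mul_ne_zero hb hp) fun z => congrFun key z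
  refine ⟨g, ?_⟩
  have := toRat_ne_zero hb
  rw [map_mul, map_mul]
  field_simp

/-- A polynomial approximating `exp (x z)` modulo a power of a polynomial. -/
theorem exists_exp_approx (x : ℂ) {a : ℂ[X]} (ha : a ≠ 0) (n : ℕ) :
    ∃ (T : ℂ[X]) (e : ℂ → ℂ), Differentiable ℂ e ∧
      (∀ z, Complex.exp (x * z) = T.eval z + (a ^ (n + 1)).eval z * e z) ∧
      a ^ n ∣ derivative T - C x * T := by
  have hexp : Differentiable ℂ fun z : ℂ => Complex.exp (x * z) := by fun_prop
  -- The exponent is `n + 1` because differentiating the remainder `a^(n+1) e` costs one factor `a`.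
  obtain ⟨T, e, he, h⟩ := exists_eq_add_mul hexp (pow_ne_zero (n + 1) ha)
  refine ⟨T, e, he, h, ?_⟩
  have he' : Continuous (deriv e) := he.contDiff.continuous_deriv (n := 1) le_rfl
  refine dvd_of_eval_eq_mul (e := fun z => x * a.eval z * e z - (n + 1) * (derivative a).eval z * e z
    - a.eval z * deriv e z) ?_ (pow_ne_zero n ha) fun z => ?_
  · have := he.continuous
    have := a.continuous
    have := (derivative a).continuous
    fun_prop
  · have h1 : HasDerivAt (fun z => T.eval z + (a ^ (n + 1)).eval z * e z)
        ((derivative T).eval z + ((derivative (a ^ (n + 1))).eval z * e z +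
          (a ^ (n + 1)).eval z * deriv e z)) z :=
      (T.hasDerivAt z).add (((a ^ (n + 1)).hasDerivAt z).mul (he z).hasDerivAt)
    have h2 : HasDerivAt (fun z : ℂ => Complex.exp (x * z)) (Complex.exp (x * z) * (x * 1)) z :=
      ((hasDerivAt_id z).const_mul x).cexp
    rw [← funext h] at h1
    have h3 := h2.unique h1
    rw [h z] at h3
    simp only [derivative_pow, eval_mul, eval_pow, eval_sub, eval_C, Nat.cast_add,
      Nat.add_sub_cancel] at h3 ⊢
    simp at h3
    linear_combination -h3

theorem IsDenom.exists_app {r : ℕ} {s : ℂ[X]} {c : Fin r → Sym} (hs : IsDenom s c) (x : ℂ)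
    (f : ℂ[X]) (i : Fin r) : ∃ b : ℂ[X], toRat s * app x f (c i) = toRat b := by
  obtain ⟨g, hg⟩ := sum_eq_toRat_mul (p := 1) hs (Nat.lt_succ_self (c i).natDegree)
    (u := fun k => s * (delta x ^ k) f) (fun k _ => by simp)
  refine ⟨g, ?_⟩
  rw [map_one, one_mul] at hg
  rw [← hg, app_apply, sum_def, sum_def, Finset.mul_sum]
  refine Finset.sum_congr rfl fun k _ => ?_
  rw [map_mul]
  ring

/-- Write `u` for the value of `D` at `x`, so that `D(e^{xz}) = u e^{xz}`. With a polynomial `T`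
close to `e^{xz}` modulo a power of `p s`, the row `D.T` lies in `W` and differs from `uT` by a
multiple of `p`. In `u (e^{xz} - T)` one factor `s` cancels the denominators of `u`, and a factor
`p` remains. -/
theorem memClosure_of_mem_rowSyms {r : ℕ} {W : Submodule ℂ (RatVec r)} {p : ℂ[X]} (hp : p ≠ 0)
    (hpW : ContainsMultiples p W) {D : Fin r → Sym} (hD : D ∈ rowSyms W) (x : ℂ) :
    MemClosure W fun z j => val z ((D j).eval (RatFunc.C x)) * Complex.exp (x * z) := by
  simp only [← app_one]
  obtain ⟨s, hs0, hs⟩ := exists_isDenom D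
  obtain ⟨n, hn⟩ := exists_degree_bound D
  have ha : p * s ≠ 0 := mul_ne_zero hp hs0
  obtain ⟨T, e, he, hT, hdvd⟩ := exists_exp_approx x ha n
  obtain ⟨g, hg⟩ := app_mul_sub_mem hs hn hdvd 1
  choose b hb using hs.exists_app x 1
  refine ⟨p, hp, hpW, _, hD T, fun j z => (b j).eval z * ((p * s) ^ n).eval z * e z - (g j).eval z,
    fun j => (((b j).differentiable.mul (Polynomial.differentiable _)).mul he).sub
      (g j).differentiable, ?_⟩
  rw [Filter.eventually_all]
  intro j
  have h1 := hg j
  rw [mul_one] at h1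
  have h2 := hb j
  set u := app x 1 (D j)
  set h := app 0 T (D j)
  have h3 : h = toRat T * u + toRat (p * g j) := by
    rw [map_mul]
    linear_combination h1
  filter_upwards [eventually_val_mul (toRat s) u, eventually_val_mul (toRat T) u,
    eventually_val_add (toRat T * u) (toRat (p * g j))] with z e1 e2 e3
  have e4 : val z h = _ := congrArg (val z) h3
  rw [e3, e2, val_toRat, val_toRat] at e4
  rw [h2, val_toRat, val_toRat] at e1
  change val z u * _ = val z h + _
  rw [e4, hT z, e1]
  simp only [eval_mul, eval_pow]
  ring

/-- Up to `p` times an entire row, `u e^{xz}` equals an element `D.1` of `W` with `D ∈ M`.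
Multiplication by `e^{-xz}` amounts to composing `D` from the right with a polynomial `S`
approximating `e^{-xz}`, and the polynomial error lies in `p ℂ[z]^r`. The module `M` is left general
so that the result applies both to `rowSyms W` and to the explicit module of a quadruple. -/
theorem exists_mem_of_memClosure {r : ℕ} {W : Submodule ℂ (RatVec r)} {M : Submodule ℂ (Fin r → Sym)}
    (hM : RightStable M) {p : ℂ[X]} (hp : p ≠ 0)
    (hpM : ∀ g : Fin r → ℂ[X], (fun i => C (toRat p * toRat (g i))) ∈ M)
    (hW : ∀ u ∈ W, ∃ D ∈ M, ∀ i, (D i).coeff 0 = u i) {x : ℂ} {u : RatVec r}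
    (hu : MemClosure W fun z j => val z (u j) * Complex.exp (x * z)) :
    ∃ D ∈ M, ∀ i, u i = (D i).eval (RatFunc.C x) := by
  obtain ⟨p', hp', hpW', h, hh, e, he, hue⟩ := hu
  -- The witness of the closure uses some `p'`, whereas `M` is only known to contain multiples of
  -- `p`. Dividing the entire part by `p` moves its polynomial remainder, times `p'`, into `W`.
  choose T' e' he' hTe' using fun j => exists_eq_add_mul (he j) hp
  obtain ⟨D, hD, hDh⟩ := hW _ (W.add_mem hh (toRat_mul_mem hpW' T'))
  obtain ⟨s, hs0, hs⟩ := exists_isDenom D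
  obtain ⟨n, hn⟩ := exists_degree_bound D
  have ha : p * s ≠ 0 := mul_ne_zero hp hs0
  obtain ⟨T, ε, hε, hT, hdvd⟩ := exists_exp_approx x ha n
  obtain ⟨S, η, hη, hS, -⟩ := exists_exp_approx (-x) ha n
  -- `T S` approximates `e^{xz} e^{-xz} = 1` to the same order.
  have hTS : (p * s) ^ (n + 1) ∣ 1 - T * S := by
    refine dvd_of_eval_eq_mul (e := fun z => ε z * S.eval z + T.eval z * η z +
      ((p * s) ^ (n + 1)).eval z * ε z * η z) ?_ (pow_ne_zero _ ha) fun z => ?_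
    · have := hε.continuous
      have := hη.continuous
      have := S.continuous
      have := T.continuous
      have := ((p * s) ^ (n + 1)).continuous
      fun_prop
    · have h1 : Complex.exp (x * z) * Complex.exp (-x * z) = 1 := by
        rw [← Complex.exp_add]; simp
      rw [hT, hS] at h1
      rw [eval_sub, eval_one, eval_mul]
      linear_combination -h1
  obtain ⟨g, hg⟩ := app_mul_sub_mem hs hn hdvd S
  obtain ⟨g', hg'⟩ := app_eq_mul_of_pow_dvd (p := p) hs hn ((pow_dvd_pow _ (Nat.le_succ n)).trans hTS)
  choose b hb using hs.exists_app x S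
  -- Splitting `D.1` as `D.(T S) + D.(1 - T S)` gives `T` times the value at `x` of `D ∘ S`, modulo
  -- `p`. Multiplying by `e^{-xz}` compares this value with `u`. The difference is `p` times an
  -- entire function, hence `p` times a polynomial because it is rational.
  have key : ∀ j, ∃ q : ℂ[X], u j - app x S (D j) = toRat p * toRat q := by
    intro j
    have h0 : (D j).coeff 0 = toRat T * app x S (D j) + toRat (p * (g j + g' j)) := by
      have h1 := hg j
      have h2 := hg' j
      have h3 : app 0 1 (D j) = app 0 (T * S) (D j) + app 0 (1 - T * S) (D j) := by
        rw [← app_add_left]; congr 1; ring_nf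
      rw [← app_zero_one, h3, h2, map_mul, map_add]
      linear_combination h1
    have h1 : h j = toRat T * app x S (D j) + toRat (p * (g j + g' j) - p' * T' j) := by
      have := hDh j
      rw [h0, Pi.add_apply] at this
      rw [map_sub, map_mul toRat p', ← add_sub_assoc, this]
      ring
    have h2 := hb j
    set v := app x S (D j)
    refine exists_eq_toRat_mul hp (e := fun z => Complex.exp (-x * z) * ((g j + g' j).eval z +
      p'.eval z * e' j z - (b j).eval z * ((p * s) ^ n).eval z * ε z)) ?_ ?_
    · have := hε.continuous
      have := (he' j).continuous
      have := (g j + g' j).continuous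
      have := p'.continuous
      have := (b j).continuous
      have := ((p * s) ^ n).continuous
      fun_prop
    filter_upwards [hue, eventually_val_add (u j - v) v, eventually_val_mul (toRat s) v,
      eventually_val_mul (toRat T) v,
      eventually_val_add (toRat T * v) (toRat (p * (g j + g' j) - p' * T' j))] with z e1 e2 e3 e4 e5
    have e6 := e1 j
    have e7 : val z (h j) = _ := congrArg (val z) h1
    rw [e5, e4, val_toRat, val_toRat] at e7
    rw [h2, val_toRat, val_toRat] at e3
    rw [sub_add_cancel] at e2
    change val z (u j) * _ = val z (h j) + _ at e6
    rw [e7, hTe', e2] at e6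
    have e8 : Complex.exp (x * z) * Complex.exp (-x * z) = 1 := by
      rw [← Complex.exp_add]; simp
    have e9 := hT z
    simp only [eval_mul, eval_pow, eval_sub, eval_add] at e6 e9 e3 ⊢
    have e10 : val z (u j - v) * Complex.exp (x * z) = eval z p * ((g j).eval z + (g' j).eval z +
      p'.eval z * e' j z - (b j).eval z * ((eval z p * eval z s) ^ n) * ε z) := by
      linear_combination e6 - val z v * e9 + (eval z p * eval z s) ^ n * ε z * eval z p * e3
    linear_combination (-(val z (u j - v))) * e8 + Complex.exp (-x * z) * e10
  choose q hq using key
  refine ⟨_, M.add_mem (hM.aeval_zop S hD) (hpM q), fun i => ?_⟩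
  rw [Pi.add_apply, eval_add, eval_C, ← hq i, ← app_one, app_aeval_zop, mul_one]
  ring

end AdelicGr
end

noncomputable section
namespace AdelicGr
open Polynomial

/-! ### Localisation of operators and primary decomposable spaces -/

theorem exists_forall_pow_dvd_sub (s : Finset ℂ) (N : ℕ) (t : ℂ → ℂ[X]) :
    ∃ e : ℂ[X], ∀ l ∈ s, (X - C l) ^ N ∣ e - t l := by
  obtain ⟨e, he⟩ := Ideal.exists_forall_sub_mem_ideal
    (I := fun l : s => Ideal.span {(X - C (l : ℂ) : ℂ[X]) ^ N}) (fun a b hab => by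
      change IsCoprime (Ideal.span _) (Ideal.span _)
      rw [Ideal.isCoprime_span_singleton_iff]
      exact (isCoprime_X_sub_C_of_isUnit_sub
        (sub_ne_zero.mpr (Subtype.coe_injective.ne hab)).isUnit).pow) (fun l => t l)
  exact ⟨e, fun l hl => Ideal.mem_span_singleton.mp (he ⟨l, hl⟩)⟩

/-- Taylor expansion around the variable point `z`, evaluated at `l`, reads `f(l) = ∑ (l - z)^j
f^{(j)}(z) / j!`. The omitted terms are divisible by `(z - l)^N`. -/
theorem pow_dvd_taylor_sub (l : ℂ) (N : ℕ) (f : ℂ[X]) :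
    (X - C l) ^ N ∣ ∑ j ∈ Finset.range (N + 1),
      C ((j.factorial : ℂ)⁻¹) * (C l - X) ^ j * (delta 0 ^ j) f - C (f.eval l) := by
  have h1 : C (f.eval l) = ∑ j ∈ Finset.range (f.natDegree + N + 1),
      C ((j.factorial : ℂ)⁻¹) * (C l - X) ^ j * (delta 0 ^ j) f := by
    have h2 : (taylor (X : ℂ[X]) (f.map C)).eval (C l - X) = C (f.eval l) := by
      rw [taylor_eval, sub_add_cancel, eval_map, eval₂_hom]
    rw [← h2, eval_eq_sum_range' (n := f.natDegree + N + 1)]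
    · refine Finset.sum_congr rfl fun j _ => ?_
      have hmap : hasseDeriv j (f.map C) = (hasseDeriv j f).map C := by
        ext1 k
        simp [hasseDeriv_coeff]
      rw [taylor_coeff, hmap, eval_map, delta_zero, Module.End.pow_apply,
        ← factorial_smul_hasseDeriv]
      rw [eval₂_C_X, LinearMap.smul_apply, nsmul_eq_mul, ← C_eq_natCast]
      have : C ((j.factorial : ℂ)⁻¹) * C (j.factorial : ℂ) = 1 := by
        rw [← C_mul, inv_mul_cancel₀ (by exact_mod_cast j.factorial_ne_zero), C_1]
      linear_combination (-(hasseDeriv j f * (C l - X) ^ j)) * this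
    · rw [natDegree_taylor]
      exact lt_of_le_of_lt natDegree_map_le (by omega)
  rw [h1, ← Finset.sum_range_add_sum_Ico _ (show N + 1 ≤ f.natDegree + N + 1 by omega),
    sub_add_cancel_left]
  refine (Finset.dvd_sum fun j hj => ?_).neg_right
  have hle : N ≤ j := by have := Finset.mem_Ico.mp hj; omega
  have h3 : (X - C l) ^ N ∣ (C l - X : ℂ[X]) ^ j := by
    have h4 : (C l - X : ℂ[X]) ^ j = (-1) ^ j * (X - C l) ^ j := by rw [← neg_pow, neg_sub]
    rw [h4]
    exact dvd_mul_of_dvd_right (pow_dvd_pow _ hle) _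
  exact (h3.mul_left _).mul_right _

/-- An operator `E` with `E.1 = 1` such that `E.f` is locally constant to high order at given
points. -/
theorem exists_localizer (s : Finset ℂ) (N : ℕ) :
    ∃ E : Sym, E.coeff 0 = 1 ∧ ∀ f : ℂ[X], ∃ h : ℂ[X], app 0 f E = toRat h ∧
      ∀ l ∈ s, (X - C l) ^ N ∣ h - C (f.eval l) := by
  choose e he using fun j : ℕ =>
    exists_forall_pow_dvd_sub s N fun l => C ((j.factorial : ℂ)⁻¹) * (C l - X) ^ j
  -- The chosen `e 0` is only congruent to `1`. Replacing it by `1` keeps the congruences and makes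
  -- `E.1 = 1` exact.
  let e' : ℕ → ℂ[X] := fun j => if j = 0 then 1 else e j
  have he' : ∀ j, ∀ l ∈ s, (X - C l) ^ N ∣ e' j - C ((j.factorial : ℂ)⁻¹) * (C l - X) ^ j := by
    intro j l hl
    by_cases hj : j = 0
    · subst hj
      simp [e']
    · simpa [e', hj] using he j l hl
  refine ⟨∑ j ∈ Finset.range (N + 1), monomial j (toRat (e' j)), ?_, fun f =>
    ⟨∑ j ∈ Finset.range (N + 1), e' j * (delta 0 ^ j) f, ?_, fun l hl => ?_⟩⟩
  · rw [finsetSum_coeff, Finset.sum_eq_single 0]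
    · simp [e']
    · intro j _ hj
      rw [coeff_monomial, if_neg hj]
    · simp
  · rw [map_sum, map_sum]
    exact Finset.sum_congr rfl fun j _ => by rw [app_monomial, map_mul]
  · rw [← sub_add_sub_cancel _ (∑ j ∈ Finset.range (N + 1),
      C ((j.factorial : ℂ)⁻¹) * (C l - X) ^ j * (delta 0 ^ j) f) (C (f.eval l))]
    refine dvd_add ?_ (pow_dvd_taylor_sub l N f)
    rw [← Finset.sum_sub_distrib]
    refine Finset.dvd_sum fun j _ => ?_
    rw [← sub_mul]
    exact (he' j l hl).mul_right _

theorem denom_eval_ne_zero {a b : ℂ[X]} {l : ℂ} (hb : b.eval l ≠ 0) :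
    (toRat a / toRat b).denom.eval l ≠ 0 := by
  obtain ⟨c, hc⟩ := RatFunc.denom_div_dvd a b
  intro h0
  have := congrArg (eval l) hc
  rw [eval_mul] at this
  change _ = (toRat a / toRat b).denom.eval l * _ at this
  rw [h0, zero_mul] at this
  exact hb this

theorem toRat_X_sub_C (l : ℂ) : toRat (X - C l) = RatFunc.X - RatFunc.C l := by
  rw [map_sub, toRat_X, toRat_C]

/-- The multiplicity of `l` in `q` is at most the degree of `q`, so the extra factors in `g`
outweigh any pole of `f` at `l`. -/
theorem exists_eq_pow_mul {l : ℂ} {N : ℕ} {q g b : ℂ[X]} {f : Rat1} (hq : q ≠ 0)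
    (hf : toRat q * f = toRat (g * b)) (hg : (X - C l) ^ (N + q.natDegree) ∣ g) :
    ∃ h : Rat1, h.denom.eval l ≠ 0 ∧ f = (RatFunc.X - RatFunc.C l) ^ N * h := by
  obtain ⟨q', hq', hroot⟩ := exists_eq_pow_rootMultiplicity_mul_and_not_dvd q hq l
  have hm : rootMultiplicity l q ≤ q.natDegree := by
    have := natDegree_le_of_dvd (pow_rootMultiplicity_dvd q l) hq
    rwa [natDegree_pow, natDegree_X_sub_C, mul_one] at this
  generalize rootMultiplicity l q = m at *
  obtain ⟨g', rfl⟩ := hg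
  have hql : q'.eval l ≠ 0 := fun h => hroot (dvd_iff_isRoot.mpr h)
  have hq0 : q' ≠ 0 := by rintro rfl; simp at hql
  refine ⟨toRat ((X - C l) ^ (q.natDegree - m) * g' * b) / toRat q', denom_eval_ne_zero hql, ?_⟩
  rw [← mul_div_assoc, eq_div_iff (toRat_ne_zero hq0), ← toRat_X_sub_C, ← map_pow, ← map_mul]
  have h1 := toRat_ne_zero (pow_ne_zero m (X_sub_C_ne_zero l))
  refine mul_left_cancel₀ h1 ?_
  have h2 : toRat ((X - C l) ^ m) * (f * toRat q') = toRat q * f := by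
    conv_rhs => rw [hq', map_mul]
    ring
  rw [h2, hf, ← map_mul]
  congr 1
  obtain ⟨k, hk⟩ := Nat.exists_eq_add_of_le hm
  rw [hk, Nat.add_sub_cancel_left]
  ring

/-- Since `p` is a unit at `l`, Bézout shows that every row regular at `l` is a polynomial multiple
of `p` modulo rows vanishing there to order `N`. Both summands lie in the local space. -/
theorem mem_of_regular {r : ℕ} {W Wl : Submodule ℂ (RatVec r)} {p : ℂ[X]} {l : ℂ} {N : ℕ}
    (hp : p.eval l ≠ 0) (hpW : ContainsMultiples p W) (hW : W ≤ Wl)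
    (hN : ∀ u, VanishesToOrder l N u → u ∈ Wl) {u : RatVec r} (hu : VanishesToOrder l 0 u) :
    u ∈ Wl := by
  have key : ∀ i, ∃ g : ℂ[X], ∃ h : Rat1, h.denom.eval l ≠ 0 ∧
      u i - toRat p * toRat g = (RatFunc.X - RatFunc.C l) ^ N * h := by
    intro i
    obtain ⟨f, hf, hfu⟩ := hu i
    rw [pow_zero, one_mul] at hfu
    have hcop : IsCoprime (p * f.denom) ((X - C l) ^ N) := by
      refine IsCoprime.pow_right ?_
      refine ((irreducible_X_sub_C l).coprime_iff_not_dvd.mpr ?_).symm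
      rw [dvd_iff_isRoot, IsRoot, eval_mul]
      exact mul_ne_zero hp hf
    obtain ⟨s, t, hst⟩ := hcop
    refine ⟨f.num * s, toRat (f.num * t) / toRat f.denom, denom_eval_ne_zero hf, ?_⟩
    rw [hfu, ← toRat_X_sub_C, ← map_pow]
    have h0 : f = toRat f.num / toRat f.denom := (RatFunc.num_div_denom f).symm
    have h1 := toRat_ne_zero (RatFunc.denom_ne_zero f)
    have h2 := congrArg toRat hst
    rw [map_add, map_mul, map_mul, map_mul, map_one] at h2
    rw [map_mul, map_mul]
    generalize toRat f.num = A at *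
    generalize toRat f.denom = B at *
    rw [h0]
    field_simp
    linear_combination (-A) * h2
  choose g h hh hgh using key
  have : u = (fun i => toRat p * toRat (g i)) + fun i => u i - toRat p * toRat (g i) := by
    funext i
    simp
  rw [this]
  exact Wl.add_mem (hW (toRat_mul_mem hpW g)) (hN _ fun i => ⟨h i, hh i, hgh i⟩)

/-- A fat primary decomposable space `W` consists of the values at `1` of the operators mapping
`ℂ[z]` to `W`. -/
theorem exists_rowSyms_coeff_zero {r : ℕ} {W : Submodule ℂ (RatVec r)} (hfat : IsFat W)
    (hpd : IsPrimaryDecomposable W) {u : RatVec r} (hu : u ∈ W) :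
    ∃ D ∈ rowSyms W, ∀ i, (D i).coeff 0 = u i := by
  obtain ⟨⟨p, hp, hpW⟩, q, hq, hqW⟩ := hfat
  obtain ⟨Wloc, hloc, hW⟩ := hpd
  choose N hN using hloc
  have hle : ∀ l, W ≤ Wloc l := fun l => hW.le.trans (iInf_le _ l)
  let s : Finset ℂ := (p * q).roots.toFinset
  -- `s.sup N` covers the vanishing orders required at the points of `s`, and `q.natDegree`
  -- compensates the poles of `u`. The operator sought is `u` times the localizer: it sends `f` to
  -- `u h` with `h ≡ f(l)` at each point of `s`.
  obtain ⟨E, hE1, hE⟩ := exists_localizer s (s.sup N + q.natDegree)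
  refine ⟨fun i => C (u i) * E, fun f => ?_, fun i => by rw [coeff_C_mul, hE1, mul_one]⟩
  obtain ⟨h, hh, hdvd⟩ := hE f
  obtain ⟨b, hb⟩ := mem_polyVec.mp (hqW u hu)
  rw [hW, Submodule.mem_iInf]
  intro l
  have hval : (fun i => app 0 f (C (u i) * E)) = fun i => u i * toRat h := by
    funext i
    rw [app_C_mul, hh]
  rw [hval]
  by_cases hl : l ∈ s
  · have hsplit : (fun i => u i * toRat h) =
        (f.eval l) • u + fun i => u i * toRat (h - C (f.eval l)) := by
      funext i
      simp [Algebra.smul_def, mul_sub]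
      ring
    rw [hsplit]
    refine (Wloc l).add_mem ((Wloc l).smul_mem _ (hle l hu)) (hN l _ fun i => ?_)
    refine exists_eq_pow_mul (g := h - C (f.eval l)) (b := b i) hq ?_ ((pow_dvd_pow _ ?_).trans (hdvd l hl))
    · have : toRat q * u i = toRat (b i) := hb i
      rw [map_mul, ← this]
      ring
    · exact Nat.add_le_add_right (Finset.le_sup (f := N) hl) _
  · have hl' : (p * q).eval l ≠ 0 := by
      intro h0
      exact hl (by simp [s, hp, hq] at h0 ⊢; exact h0)
    rw [eval_mul, mul_ne_zero_iff] at hl'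
    -- Away from the zeros of `p q` the row `u h` is regular, and the local condition is automatic.
    refine mem_of_regular hl'.1 hpW (hle l) (hN l) fun i => ?_
    refine ⟨toRat (b i * h) / toRat q, denom_eval_ne_zero hl'.2, ?_⟩
    have : toRat q * u i = toRat (b i) := hb i
    have h2 := toRat_ne_zero hq
    rw [map_mul, ← this]
    field_simp

end AdelicGr
end

noncomputable section
namespace AdelicGr
open Polynomial

/-! ### Differential operators and their symbols -/

/-- The symbol of a differential operator. -/
def symOf (D : DiffOp) : Sym := ∑ k ∈ (coeffs D).support, monomial k (coeffs D k)

theorem coeff_symOf (D : DiffOp) (k : ℕ) : (symOf D).coeff k = coeffs D k := by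
  rw [symOf, finsetSum_coeff]
  simp only [coeff_monomial]
  rw [Finset.sum_ite_eq']
  split_ifs with h
  · rfl
  · exact (Finsupp.notMem_support_iff.mp h).symm

theorem support_symOf (D : DiffOp) : (symOf D).support = (coeffs D).support := by
  ext k
  rw [mem_support_iff, coeff_symOf, Finsupp.mem_support_iff]

theorem coeffs_spec (D : DiffOp) : opOfCoeffs id (ddz : Rat1 →ₗ[ℂ] Rat1) (coeffs D) = D.1 :=
  (exists_coeffs D).choose_spec

theorem apply_eq_sum (D : DiffOp) (f : Rat1) :
    D.1 f = (symOf D).sum fun k a => a * ((ddz : Rat1 →ₗ[ℂ] Rat1) ^ k) f := by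
  rw [← coeffs_spec D, opOfCoeffs, sum_def, support_symOf, LinearMap.sum_apply]
  exact Finset.sum_congr rfl fun k _ => by rw [coeff_symOf]; rfl

theorem apply_toRat (D : DiffOp) (f : ℂ[X]) : D.1 (toRat f) = app 0 f (symOf D) := by
  rw [apply_eq_sum, app_apply]
  simp only [ddz_pow_toRat, delta_zero]

/-- The operator with a given symbol. -/
def opOf (c : Sym) : DiffOp :=
  ⟨opOfCoeffs id (ddz : Rat1 →ₗ[ℂ] Rat1) ⟨c.support, c.coeff, fun _ => mem_support_iff⟩, by
    refine sum_mem fun k _ => mul_mem ?_ (pow_mem ?_ k)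
    · exact Algebra.subset_adjoin (Set.mem_insert_of_mem _ ⟨_, rfl⟩)
    · exact Algebra.subset_adjoin (Set.mem_insert _ _)⟩

theorem symOf_opOf (c : Sym) : symOf (opOf c) = c := by
  have h : coeffs (opOf c) = ⟨c.support, c.coeff, fun _ => mem_support_iff⟩ :=
    coeffs_unique _ _ (coeffs_spec (opOf c))
  ext1 k
  rw [coeff_symOf, h]
  rfl

theorem symOf_injective : Function.Injective symOf := by
  intro D E h
  have : coeffs D = coeffs E := by
    ext1 k
    rw [← coeff_symOf, h, coeff_symOf]
  rw [← Subtype.coe_inj, ← coeffs_spec D, this, coeffs_spec]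

theorem mem_rowOps_iff {r : ℕ} {W : Submodule ℂ (RatVec r)} {D : Fin r → DiffOp} :
    D ∈ rowOps W ↔ (fun i => symOf (D i)) ∈ rowSyms W := by
  rw [mem_rowSyms]
  simp only [← apply_toRat]
  rfl

theorem mem_leadingCoeffs_iff {r : ℕ} {W : Submodule ℂ (RatVec r)} {l : RatVec r} :
    l ∈ leadingCoeffs W ↔ ∃ c ∈ rowSyms W, ∃ m : ℕ,
      (∀ i, ∀ k, m < k → (c i).coeff k = 0) ∧ ∀ i, (c i).coeff m = l i := by
  constructor
  · rintro ⟨D, hD, m, h1, h2⟩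
    exact ⟨_, mem_rowOps_iff.mp hD, m, fun i k hk => by rw [coeff_symOf, h1 i k hk],
      fun i => by rw [coeff_symOf, h2]⟩
  · rintro ⟨c, hc, m, h1, h2⟩
    refine ⟨fun i => opOf (c i), mem_rowOps_iff.mpr ?_, m, fun i k hk => ?_, fun i => ?_⟩
    · simpa only [symOf_opOf] using hc
    · rw [← coeff_symOf, symOf_opOf, h1 i k hk]
    · rw [← coeff_symOf, symOf_opOf, h2]

/-! ### Polynomial parts of symbols -/

section MapCoeff
variable {A : Type} [CommRing A] [Algebra ℂ A]

/-- A linear map, applied to all coefficients of a symbol. -/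
def mapCoeff (φ : Rat1 →ₗ[ℂ] A) : Sym →ₗ[ℂ] A[X] where
  toFun c := ∑ k ∈ c.support, monomial k (φ (c.coeff k))
  map_add' c d := by
    ext k
    rw [coeff_add]
    simp only [finsetSum_coeff, coeff_monomial, Finset.sum_ite_eq']
    have h : ∀ e : Sym, (if k ∈ e.support then φ (e.coeff k) else 0) = φ (e.coeff k) := by
      intro e
      split_ifs with h
      · rfl
      · rw [notMem_support_iff.mp h, map_zero]
    rw [h, h, h, coeff_add, map_add]
  map_smul' a c := by
    ext k
    rw [coeff_smul, RingHom.id_apply]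
    simp only [finsetSum_coeff, coeff_monomial, Finset.sum_ite_eq']
    have h : ∀ e : Sym, (if k ∈ e.support then φ (e.coeff k) else 0) = φ (e.coeff k) := by
      intro e
      split_ifs with h
      · rfl
      · rw [notMem_support_iff.mp h, map_zero]
    rw [h, h, coeff_smul, map_smul]

@[simp] theorem coeff_mapCoeff (φ : Rat1 →ₗ[ℂ] A) (c : Sym) (k : ℕ) :
    (mapCoeff φ c).coeff k = φ (c.coeff k) := by
  change (∑ k ∈ c.support, monomial k (φ (c.coeff k))).coeff k = _
  simp only [finsetSum_coeff, coeff_monomial, Finset.sum_ite_eq']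
  split_ifs with h
  · rfl
  · rw [notMem_support_iff.mp h, map_zero]

theorem mapCoeff_X_mul (φ : Rat1 →ₗ[ℂ] A) (c : Sym) : mapCoeff φ (X * c) = X * mapCoeff φ c := by
  ext k
  rcases k with _ | k
  · simp
  · simp [coeff_X_mul]

theorem mapCoeff_cst_mul (φ : Rat1 →ₗ[ℂ] A) (g : ℂ[X]) (c : Sym) :
    mapCoeff φ (cst g * c) = g.map (algebraMap ℂ A) * mapCoeff φ c := by
  induction g using Polynomial.induction_on generalizing c with
  | C a =>
    have : cst (C a) * c = a • c := by
      simp [Algebra.smul_def, Polynomial.algebraMap_apply]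
    rw [this, map_smul, map_C, Algebra.smul_def, Polynomial.algebraMap_apply]
  | add p q hp hq => rw [map_add, add_mul, map_add, hp, hq, Polynomial.map_add, add_mul]
  | monomial n a ih =>
    have h1 : cst (C a * X ^ (n + 1)) * c = cst (C a * X ^ n) * (X * c) := by
      rw [pow_succ, ← mul_assoc, map_mul cst (C a * X ^ n), mul_assoc]
      congr 2
      simp
    have h2 : (C a * X ^ (n + 1)).map (algebraMap ℂ A) = (C a * X ^ n).map (algebraMap ℂ A) * X := by
      simp [pow_succ, mul_assoc]
    rw [h1, ih, mapCoeff_X_mul, h2, mul_assoc]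

theorem mapCoeff_derivative (φ : Rat1 →ₗ[ℂ] A) (c : Sym) :
    mapCoeff φ (derivative c) = derivative (mapCoeff φ c) := by
  ext k
  rw [coeff_mapCoeff, coeff_derivative, coeff_derivative, coeff_mapCoeff]
  have h : ∀ a : Rat1, a * ((k : Rat1) + 1) = ((k + 1 : ℕ) : ℂ) • a := by
    intro a
    rw [Algebra.smul_def, map_natCast]
    push_cast
    ring
  rw [h, map_smul, Algebra.smul_def, map_natCast]
  push_cast
  ring

end MapCoeff

/-- The polynomial part of a symbol. -/
abbrev rho : Sym →ₗ[ℂ] ℂ[X][X] := mapCoeff polyPart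

/-- The coefficient of `z⁻¹` of a symbol. -/
abbrev resSym : Sym →ₗ[ℂ] ℂ[X] := mapCoeff resInf

/-- `g(∂)` as the symbol of an operator with polynomial coefficients. -/
abbrev cstP : ℂ[X] →+* ℂ[X][X] := mapRingHom C

theorem rho_cst_mul (g : ℂ[X]) (c : Sym) : rho (cst g * c) = cstP g * rho c :=
  mapCoeff_cst_mul polyPart g c

theorem resSym_cst_mul (g : ℂ[X]) (c : Sym) : resSym (cst g * c) = g * resSym c := by
  rw [mapCoeff_cst_mul, Algebra.algebraMap_self, Polynomial.map_id]

@[simp] theorem rho_polySym (d : ℂ[X][X]) : rho (polySym d) = d := by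
  ext1 k
  rw [coeff_mapCoeff, coe_mapRingHom, coeff_map]
  exact polyPart_toRat _

theorem polySym_cstP (g : ℂ[X]) : polySym (cstP g) = cst g := by
  rw [coe_mapRingHom, coe_mapRingHom, coe_mapRingHom, map_map]
  rfl

theorem rho_zop (c : Sym) :
    rho (zop c) = C X * rho c + derivative (rho c) + cstP (resSym c) := by
  rw [zop_apply, map_add, mapCoeff_derivative]
  have : rho (C RatFunc.X * c) = C X * rho c + cstP (resSym c) := by
    ext1 k
    rw [coeff_mapCoeff, coeff_C_mul, polyPart_X_mul, coeff_add, coeff_C_mul, coeff_mapCoeff,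
      coe_mapRingHom, coeff_map, coeff_mapCoeff]
  rw [this]
  ring

/-! ### Spaces of symbols with polynomial leading coefficients -/

/-- A right module `M` of symbols whose leading coefficients are polynomial, such that the
polynomial parts of elements of `M` include all multiples of `χ(∂)`. -/
structure IsFrame {r : ℕ} (M : Submodule ℂ (Fin r → Sym)) (χ : ℂ[X]) : Prop where
  stable : RightStable M
  lead : ∀ c ∈ M, ∀ m, (∀ i, ∀ k, m < k → (c i).coeff k = 0) → ∀ i, ∃ p : ℂ[X], (c i).coeff m = toRat p
  monic : χ.Monic
  ann : ∀ d : Fin r → ℂ[X][X], ∃ D ∈ M, ∀ i, rho (D i) = cstP χ * d i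

/-- The top coefficient is a polynomial, hence equal to its own polynomial part, which is zero.
Descending induction on the order kills all coefficients. -/
theorem eq_zero_of_rho_eq_zero {r : ℕ} {M : Submodule ℂ (Fin r → Sym)}
    (hlead : ∀ c ∈ M, ∀ m, (∀ i, ∀ k, m < k → (c i).coeff k = 0) →
      ∀ i, ∃ p : ℂ[X], (c i).coeff m = toRat p)
    {c : Fin r → Sym} (hc : c ∈ M) (h : ∀ i, rho (c i) = 0) : c = 0 := by
  obtain ⟨n, hn⟩ := exists_degree_bound c
  have key : ∀ n, (∀ i k, n ≤ k → (c i).coeff k = 0) → c = 0 := by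
    intro n
    induction n with
    | zero =>
      intro h0
      funext i
      ext1 k
      rw [h0 i k (Nat.zero_le k)]
      simp
    | succ n ih =>
      intro h1
      refine ih fun i k hk => ?_
      rcases Nat.eq_or_lt_of_le hk with rfl | hk
      · obtain ⟨p, hp⟩ := hlead c hc n h1 i
        have h2 : (rho (c i)).coeff n = p := by rw [coeff_mapCoeff, hp, polyPart_toRat]
        rw [h i, coeff_zero] at h2
        rw [hp, ← h2, map_zero]
      · exact h1 i k hk
  exact key n fun i k hk => coeff_eq_zero_of_natDegree_lt ((hn i).trans_le hk)

theorem eq_of_rho_eq {r : ℕ} {M : Submodule ℂ (Fin r → Sym)}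
    (hlead : ∀ c ∈ M, ∀ m, (∀ i, ∀ k, m < k → (c i).coeff k = 0) →
      ∀ i, ∃ p : ℂ[X], (c i).coeff m = toRat p)
    {c d : Fin r → Sym} (hc : c ∈ M) (hd : d ∈ M) (h : ∀ i, rho (c i) = rho (d i)) : c = d := by
  refine sub_eq_zero.mp (eq_zero_of_rho_eq_zero hlead (M.sub_mem hc hd) fun i => ?_)
  rw [Pi.sub_apply, map_sub, h, sub_self]

theorem eval_mapCoeff {A : Type} [CommRing A] [Algebra ℂ A] (φ : Rat1 →ₗ[ℂ] A) (a : Sym) (x : ℂ) :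
    (mapCoeff φ a).eval (algebraMap ℂ A x) = φ (a.eval (RatFunc.C x)) := by
  induction a using Polynomial.induction_on' with
  | add p q hp hq => rw [map_add, eval_add, eval_add, map_add, hp, hq]
  | monomial k a =>
    have h1 : mapCoeff φ (monomial k a) = monomial k (φ a) := by
      ext1 j
      rw [coeff_mapCoeff, coeff_monomial, coeff_monomial]
      split_ifs <;> simp
    have h2 : a * RatFunc.C x ^ k = (x ^ k) • a := by
      rw [Algebra.smul_def, map_pow, mul_comm]
      rfl
    rw [h1, eval_monomial, eval_monomial, h2, map_smul, Algebra.smul_def, map_pow, mul_comm]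

/-- Evaluation at a point which is not a zero of `χ` preserves the injectivity of the polynomial
part. -/
theorem IsFrame.eval_eq_zero {r : ℕ} {M : Submodule ℂ (Fin r → Sym)} {χ : ℂ[X]} (h : IsFrame M χ)
    {x : ℂ} (hx : χ.eval x ≠ 0) {c : Fin r → Sym} (hc : c ∈ M)
    (h0 : ∀ i, (c i).eval (RatFunc.C x) ∈ proper) : ∀ i, (c i).eval (RatFunc.C x) = 0 := by
  have h1 : ∀ i, ∃ d : ℂ[X][X], rho (c i) = (X - C (C x)) * d := by
    intro i
    have : (rho (c i)).IsRoot (C x) := by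
      exact (eval_mapCoeff polyPart (c i) x).trans (polyPart_eq_zero_iff.mpr (h0 i))
    exact dvd_iff_isRoot.mpr this
  choose d hd using h1
  -- The polynomial part of `c` is `(∂ - x) d`, but `d` itself need not be the polynomial part of an
  -- element of `M`. As `χ - χ(x) = (X - x) g`, the combination `(D - g(∂) c) / χ(x)` has polynomial
  -- part `d`. Injectivity then gives `c = (∂ - x) E`, which vanishes at `x`.
  obtain ⟨g, hg⟩ : ∃ g, χ - C (χ.eval x) = (X - C x) * g := X_sub_C_dvd_sub_C_eval
  obtain ⟨D, hD, hDd⟩ := h.ann d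
  have hE : (χ.eval x)⁻¹ • (D - fun i => cst g * c i) ∈ M :=
    M.smul_mem _ (M.sub_mem hD (h.stable.cst_mul g hc))
  set E := (χ.eval x)⁻¹ • (D - fun i => cst g * c i) with hEdef
  have hEd : ∀ i, rho (E i) = d i := by
    intro i
    have h2 := congrArg cstP hg
    rw [map_sub, map_mul, map_sub] at h2
    simp only [coe_mapRingHom, map_C, map_X] at h2
    have h3 : E i = (χ.eval x)⁻¹ • (D i - cst g * c i) := rfl
    rw [h3, map_smul, map_sub, rho_cst_mul, hDd, hd]
    have h4 : cstP χ * d i - cstP g * ((X - C (C x)) * d i) = (χ.eval x) • d i := by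
      rw [Algebra.smul_def]
      change _ = C (C _) * _
      simp only [coe_mapRingHom]
      linear_combination d i * h2
    rw [h4, smul_smul, inv_mul_cancel₀ hx, one_smul]
  have hcE : c = fun i => cst (X - C x) * E i := by
    refine eq_of_rho_eq h.lead hc (h.stable.cst_mul _ hE) fun i => ?_
    rw [rho_cst_mul, hEd, hd, map_sub]
    simp
  intro i
  rw [hcE]
  simp [eval_mul]

end AdelicGr
end

noncomputable section
namespace AdelicGr
open Polynomial

/-! ### Finiteness -/

/-- The polynomial parts of the elements of `M`. -/
def polyParts {r : ℕ} (M : Submodule ℂ (Fin r → Sym)) : Submodule ℂ (Fin r → ℂ[X][X]) :=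
  M.map (rho.compLeft (Fin r))

theorem mem_polyParts {r : ℕ} {M : Submodule ℂ (Fin r → Sym)} {d : Fin r → ℂ[X][X]} :
    d ∈ polyParts M ↔ ∃ c ∈ M, ∀ i, rho (c i) = d i := by
  rw [polyParts, Submodule.mem_map]
  exact exists_congr fun c => and_congr_right fun _ => funext_iff

/-- Composition with `z` multiplies the top coefficient by `z`; the commutator term has lower order.
-/
theorem coeff_aeval_zop {c : Sym} {n : ℕ} (hc : ∀ k, n < k → c.coeff k = 0) (f : ℂ[X]) :
    (∀ k, n < k → (aeval zop f c).coeff k = 0) ∧ (aeval zop f c).coeff n = toRat f * c.coeff n := by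
  induction f using Polynomial.induction_on generalizing c with
  | C a =>
    rw [aeval_C, Module.algebraMap_end_apply, toRat_C]
    exact ⟨fun k hk => by rw [coeff_smul, hc k hk, smul_zero], by rw [coeff_smul, Algebra.smul_def]; rfl⟩
  | add p q hp hq =>
    rw [map_add, LinearMap.add_apply, map_add, add_mul]
    exact ⟨fun k hk => by rw [coeff_add, (hp hc).1 k hk, (hq hc).1 k hk, add_zero],
      by rw [coeff_add, (hp hc).2, (hq hc).2]⟩
  | monomial m a ih =>
    have h1 : ∀ k, n < k → (zop c).coeff k = 0 := fun k hk => by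
      rw [zop_apply, coeff_add, coeff_C_mul, coeff_derivative, hc k hk, hc (k + 1) (by omega)]
      simp
    have h2 : (zop c).coeff n = RatFunc.X * c.coeff n := by
      rw [zop_apply, coeff_add, coeff_C_mul, coeff_derivative, hc (n + 1) (by omega)]
      simp
    have h3 := ih h1
    rw [pow_succ, ← mul_assoc, map_mul, Module.End.mul_apply, aeval_X, map_mul toRat, toRat_X]
    exact ⟨h3.1, by rw [h3.2, h2, mul_assoc]⟩

/-- If the leading coefficients of `M` include `ℂ[z]^r`, and `p ℂ[z][∂]^r ⊆ M`, then the polynomial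
parts of `M` have finite codimension. -/
theorem finite_quotient_polyParts {r : ℕ} {M : Submodule ℂ (Fin r → Sym)} (hM : RightStable M)
    {p : ℂ[X]} (hp : p ≠ 0)
    (hpM : ∀ d : Fin r → ℂ[X][X], (fun i => C (toRat p) * polySym (d i)) ∈ M)
    (hlead : ∀ i : Fin r, ∃ c ∈ M, ∃ m : ℕ, (∀ j, ∀ k, m < k → (c j).coeff k = 0) ∧
      ∀ j, (c j).coeff m = if j = i then 1 else 0) :
    Module.Finite ℂ ((Fin r → ℂ[X][X]) ⧸ polyParts M) := by
  classical
  choose D hD m hD0 hD1 using hlead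
  -- From order `m0` on, composing the given elements with powers of `∂` and polynomials in `z`
  -- realises every polynomial leading coefficient.
  let m0 := Finset.univ.sup m
  have hle : ∀ i, m i ≤ m0 := fun i => Finset.le_sup (f := m) (Finset.mem_univ i)
  -- elements with prescribed leading coefficients
  have hex : ∀ n, m0 ≤ n → ∀ l : Fin r → ℂ[X], ∃ c ∈ M, (∀ j, ∀ k, n < k → (c j).coeff k = 0) ∧
      ∀ j, (c j).coeff n = toRat (l j) := by
    intro n hn l
    have hXD : ∀ i, (fun j => X ^ (n - m i) * D i j) ∈ M := by
      intro i
      have := hM.cst_mul (X ^ (n - m i)) (hD i)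
      simpa using this
    have h0 : ∀ i j k, n < k → (X ^ (n - m i) * D i j).coeff k = 0 := by
      intro i j k hk
      have := hle i
      rw [coeff_X_pow_mul', if_pos (by omega)]
      exact hD0 i j _ (by omega)
    have h1 : ∀ i j, (X ^ (n - m i) * D i j).coeff n = if j = i then 1 else 0 := by
      intro i j
      have := hle i
      rw [coeff_X_pow_mul', if_pos (by omega), ← hD1 i j]
      congr 1
      omega
    refine ⟨∑ i, fun j => aeval zop (l i) (X ^ (n - m i) * D i j),
      M.sum_mem fun i _ => hM.aeval_zop (l i) (hXD i), fun j k hk => ?_, fun j => ?_⟩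
    · rw [Finset.sum_apply, finsetSum_coeff]
      exact Finset.sum_eq_zero fun i _ => (coeff_aeval_zop (h0 i j) (l i)).1 k hk
    · rw [Finset.sum_apply, finsetSum_coeff]
      simp only [(coeff_aeval_zop (h0 _ j) (l _)).2, h1]
      simp
  let S : Set (Fin r → ℂ[X][X]) := Set.range fun t : Fin r × Fin m0 × Fin p.natDegree =>
    Pi.single t.1 (monomial t.2.1 (monomial t.2.2 (1 : ℂ)))
  have hS : S.Finite := Set.finite_range _
  -- reduction modulo `p`
  have hred : ∀ d : Fin r → ℂ[X][X], (∀ i k, m0 ≤ k → (d i).coeff k = 0) →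
      d ∈ polyParts M ⊔ Submodule.span ℂ S := by
    intro d hd
    let q : Fin r → ℂ[X][X] := fun i => ∑ k ∈ Finset.range m0, monomial k ((d i).coeff k / p)
    let e : Fin r → ℂ[X][X] := fun i => ∑ k ∈ Finset.range m0, monomial k ((d i).coeff k % p)
    have hde : d = (fun i => C p * q i) + e := by
      funext i
      rw [Pi.add_apply, Finset.mul_sum, ← Finset.sum_add_distrib]
      ext1 k
      rw [finsetSum_coeff]
      simp only [C_mul_monomial, ← map_add, EuclideanDomain.div_add_mod, coeff_monomial]
      rw [Finset.sum_ite_eq']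
      split_ifs with h
      · rfl
      · exact hd i k (by simpa using h)
    rw [hde]
    refine Submodule.add_mem_sup ?_ ?_
    · refine mem_polyParts.mpr ⟨_, hpM q, fun i => ?_⟩
      have : C (toRat p) * polySym (q i) = polySym (C p * q i) := by
        rw [map_mul, coe_mapRingHom, map_C]
        rfl
      rw [this, rho_polySym]
    · have he : e = ∑ i, ∑ k ∈ Finset.range m0, Pi.single i (monomial k ((d i).coeff k % p)) := by
        funext j
        rw [Finset.sum_apply, Finset.sum_eq_single j]
        · simp [e]
        · intro i _ hij
          simp [Finset.sum_apply, Pi.single_eq_of_ne hij.symm]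
        · simp
      rw [he]
      refine Submodule.sum_mem _ fun i _ => Submodule.sum_mem _ fun k hk => ?_
      -- For constant `p` all remainders vanish. The bound of the remainder's `natDegree` used below
      -- requires positive degree.
      by_cases hdeg : p.natDegree = 0
      · have hz : (d i).coeff k % p = 0 := by
          obtain ⟨c, rfl⟩ := natDegree_eq_zero.mp hdeg
          have hc : c ≠ 0 := by simpa using hp
          exact EuclideanDomain.mod_eq_zero.mpr
            (isUnit_C.mpr (isUnit_iff_ne_zero.mpr hc)).dvd
        rw [hz, map_zero, Pi.single_zero]
        exact Submodule.zero_mem _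
      have hlt : ((d i).coeff k % p).natDegree < p.natDegree := natDegree_mod_lt _ hdeg
      rw [as_sum_range' _ _ hlt, map_sum]
      have hs : Pi.single i (∑ a ∈ Finset.range p.natDegree,
          monomial k (monomial a (((d i).coeff k % p).coeff a))) =
          ∑ a ∈ Finset.range p.natDegree, (((d i).coeff k % p).coeff a) •
            (Pi.single i (monomial k (monomial a (1 : ℂ))) : Fin r → ℂ[X][X]) := by
        rw [← LinearMap.coe_single ℂ (fun _ : Fin r => ℂ[X][X]), map_sum]
        refine Finset.sum_congr rfl fun a _ => ?_
        rw [← map_smul, smul_monomial, smul_monomial, smul_eq_mul, mul_one]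
      rw [hs]
      refine Submodule.sum_mem _ fun a ha => Submodule.smul_mem _ _ (Submodule.subset_span ?_)
      exact ⟨(i, ⟨k, Finset.mem_range.mp hk⟩, ⟨a, Finset.mem_range.mp ha⟩), rfl⟩
  -- reduction of the degree
  have hall : ∀ n, ∀ d : Fin r → ℂ[X][X], (∀ i k, m0 + n ≤ k → (d i).coeff k = 0) →
      d ∈ polyParts M ⊔ Submodule.span ℂ S := by
    intro n
    induction n with
    | zero => exact fun d hd => hred d hd
    | succ n ih =>
      intro d hd
      obtain ⟨c, hc, hc0, hc1⟩ := hex (m0 + n) (by omega) fun i => (d i).coeff (m0 + n)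
      have h1 : (fun i => rho (c i)) ∈ polyParts M := mem_polyParts.mpr ⟨c, hc, fun _ => rfl⟩
      have h2 := ih (d - fun i => rho (c i)) fun i k hk => by
        rw [Pi.sub_apply, coeff_sub, coeff_mapCoeff]
        rcases Nat.eq_or_lt_of_le hk with rfl | hk
        · rw [hc1, polyPart_toRat, sub_self]
        · rw [hc0 i k hk, hd i k (by omega), map_zero, sub_zero]
      have := Submodule.add_mem _ h2 (Submodule.mem_sup_left h1)
      rwa [sub_add_cancel] at this
  have htop : polyParts M ⊔ Submodule.span ℂ S = ⊤ := by
    rw [eq_top_iff]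
    intro d _
    obtain ⟨n, hn⟩ := (Set.finite_range fun i => (d i).natDegree).bddAbove
    refine hall (n + 1) d fun i k hk => coeff_eq_zero_of_natDegree_lt ?_
    have := hn ⟨i, rfl⟩
    simp only at this
    omega
  have : Module.Finite ℂ (Submodule.span ℂ S) := Module.Finite.span_of_finite ℂ hS
  refine Module.Finite.of_surjective ((polyParts M).mkQ.comp (Submodule.span ℂ S).subtype) ?_
  intro y
  obtain ⟨d, rfl⟩ := (polyParts M).mkQ_surjective y
  have hd : d ∈ polyParts M ⊔ Submodule.span ℂ S := htop ▸ Submodule.mem_top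
  obtain ⟨a, ha, b, hb, rfl⟩ := Submodule.mem_sup.mp hd
  refine ⟨⟨b, hb⟩, ?_⟩
  rw [LinearMap.comp_apply, Submodule.subtype_apply, map_add]
  simp [ha]

/-- Multiplication by `X`. -/
def mulX (r : ℕ) : Module.End ℂ (Fin r → ℂ[X][X]) := (LinearMap.mulLeft ℂ X).compLeft (Fin r)

theorem mulX_apply {r : ℕ} (d : Fin r → ℂ[X][X]) (i : Fin r) : mulX r d i = X * d i := rfl

theorem RightStable.mulX_mem {r : ℕ} {M : Submodule ℂ (Fin r → Sym)} (hM : RightStable M) :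
    polyParts M ≤ (polyParts M).comap (mulX r) := by
  intro d hd
  obtain ⟨c, hc, h⟩ := mem_polyParts.mp hd
  exact mem_polyParts.mpr ⟨_, hM.X_mul c hc, fun i => by rw [mapCoeff_X_mul, h]; rfl⟩

theorem aeval_mulX {r : ℕ} (g : ℂ[X]) (d : Fin r → ℂ[X][X]) :
    aeval (mulX r) g d = fun i => cstP g * d i := by
  induction g using Polynomial.induction_on with
  | C a =>
    funext i
    simp [Module.algebraMap_end_apply, Algebra.smul_def, Polynomial.algebraMap_apply]
  | add p q hp hq =>
    funext i
    rw [map_add, LinearMap.add_apply, hp, hq, map_add, add_mul]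
    rfl
  | monomial n a ih =>
    funext i
    rw [pow_succ', mul_left_comm, map_mul, Module.End.mul_apply, ih, aeval_X, mulX_apply, map_mul]
    simp [mul_assoc]

/-- For `χ` one takes the characteristic polynomial of multiplication by `∂` on the
finite-dimensional quotient. By Cayley-Hamilton, `χ(∂) d` is the polynomial part of an element of
the module for every `d`. -/
theorem exists_isFrame {r : ℕ} {W : Submodule ℂ (RatVec r)} (hW : W ∈ grAd r) :
    Module.Finite ℂ ((Fin r → ℂ[X][X]) ⧸ polyParts (rowSyms W)) ∧
      ∃ χ : ℂ[X], IsFrame (rowSyms W) χ := by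
  obtain ⟨⟨⟨p, hp, hpW⟩, -⟩, -, hL⟩ := hW
  have hM := rightStable_rowSyms W
  have hfin : Module.Finite ℂ ((Fin r → ℂ[X][X]) ⧸ polyParts (rowSyms W)) := by
    refine finite_quotient_polyParts hM hp (C_mul_polySym_mem hpW) fun i => ?_
    have hi : (fun j => if j = i then (1 : Rat1) else 0) ∈ leadingCoeffs W := by
      rw [hL]
      refine mem_polyVec.mpr ⟨fun j => if j = i then 1 else 0, fun j => ?_⟩
      by_cases h : j = i <;> simp [h]
    obtain ⟨c, hc, m, h0, h1⟩ := mem_leadingCoeffs_iff.mp hi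
    exact ⟨c, hc, m, h0, h1⟩
  refine ⟨hfin, ((polyParts (rowSyms W)).mapQ _ _ hM.mulX_mem).charpoly, hM, ?_,
    LinearMap.charpoly_monic _, fun d => ?_⟩
  · intro c hc m h0 i
    have h1 : (fun i => (c i).coeff m) ∈ leadingCoeffs W :=
      mem_leadingCoeffs_iff.mpr ⟨c, hc, m, h0, fun _ => rfl⟩
    rw [hL] at h1
    obtain ⟨g, hg⟩ := mem_polyVec.mp h1
    exact ⟨g i, hg i⟩
  · set T := (polyParts (rowSyms W)).mapQ _ _ hM.mulX_mem
    have h1 := LinearMap.congr_fun T.aeval_self_charpoly ((polyParts (rowSyms W)).mkQ d)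
    have h2 : ∀ g : ℂ[X], aeval T g ((polyParts (rowSyms W)).mkQ d) =
        (polyParts (rowSyms W)).mkQ (aeval (mulX r) g d) := by
      intro g
      induction g using Polynomial.induction_on with
      | C a => simp [Module.algebraMap_end_apply]
      | add p q hp hq => simp only [map_add, LinearMap.add_apply, hp, hq]
      | monomial n a ih =>
        rw [pow_succ', mul_left_comm, map_mul (aeval T) X, map_mul (aeval (mulX r)) X,
          Module.End.mul_apply, ih, aeval_X, aeval_X]
        rfl
    rw [h2, LinearMap.zero_apply, Submodule.mkQ_apply, Submodule.Quotient.mk_eq_zero, aeval_mulX] at h1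
    exact mem_polyParts.mp h1

end AdelicGr
end

noncomputable section
namespace AdelicGr
open Polynomial

/-! ### The quadruple attached to a space of symbols -/

/-- `f` minus its polynomial part. -/
def tailPart : Rat1 →ₗ[ℂ] Rat1 := LinearMap.id - toRat.toLinearMap.comp polyPart

theorem tailPart_apply (f : Rat1) : tailPart f = f - toRat (polyPart f) := rfl

/-- A symbol minus its polynomial part. -/
abbrev tail : Sym →ₗ[ℂ] Sym := mapCoeff tailPart

theorem tail_eq (c : Sym) : tail c = c - polySym (rho c) := by
  ext1 k
  rw [coeff_mapCoeff, coeff_sub, coe_mapRingHom, coeff_map, coeff_mapCoeff]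
  rfl

theorem tail_cst_mul (g : ℂ[X]) (c : Sym) : tail (cst g * c) = cst g * tail c :=
  mapCoeff_cst_mul tailPart g c

/-- Composition with `z` moves exactly the coefficient of `z⁻¹` from the tail to the polynomial
part. -/
theorem tail_zop (c : Sym) : tail (zop c) = zop (tail c) - cst (resSym c) := by
  rw [tail_eq, tail_eq, rho_zop, map_add, map_add, map_mul, polySym_cstP, map_sub, zop_apply,
    zop_apply]
  have h1 : polySym (derivative (rho c)) = derivative (polySym (rho c)) := by
    rw [coe_mapRingHom, derivative_map]
  have h2 : polySym (C X) = C RatFunc.X := by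
    rw [coe_mapRingHom, map_C]
    exact congrArg C toRat_X
  rw [h1, h2]
  ring

section MonicDiv
variable {A : Type} [CommRing A] {p : A[X]}

/-- One step of Euclidean division: `X` times the remainder exceeds the allowed degree only by its
top coefficient, which passes to the quotient. -/
theorem X_mul_div_mod [Nontrivial A] (hp : p.Monic) (f : A[X]) :
    (X * f) /ₘ p = X * (f /ₘ p) + C ((f %ₘ p).coeff (p.natDegree - 1)) ∧
      (X * f) %ₘ p = X * (f %ₘ p) - p * C ((f %ₘ p).coeff (p.natDegree - 1)) := by
  refine div_modByMonic_unique _ _ hp ⟨?_, ?_⟩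
  · conv_rhs => rw [← modByMonic_add_div f p]
    ring
  · rw [degree_eq_natDegree hp.ne_zero, degree_lt_iff_coeff_zero]
    have h0 : ∀ k, p.natDegree ≤ k → (f %ₘ p).coeff k = 0 := by
      have := degree_modByMonic_lt f hp
      rwa [degree_eq_natDegree hp.ne_zero, degree_lt_iff_coeff_zero] at this
    intro k hk
    rw [coeff_sub, coeff_mul_C]
    rcases Nat.eq_or_lt_of_le hk with rfl | hk
    · rw [hp.coeff_natDegree, one_mul]
      -- In degree `0` the truncated index `natDegree - 1` is `0`, where the remainder vanishes.
      rcases hn : p.natDegree with _ | n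
      · rw [coeff_X_mul_zero, h0 _ (by omega), sub_zero]
      · rw [coeff_X_mul]
        simp
    · obtain ⟨k, rfl⟩ := Nat.exists_eq_succ_of_ne_zero (show k ≠ 0 by omega)
      rw [coeff_eq_zero_of_natDegree_lt hk, zero_mul, sub_zero, Nat.succ_eq_add_one, coeff_X_mul,
        h0 k (by omega)]

/-- Division by a monic polynomial, as a linear map. -/
def divHom [Nontrivial A] [Algebra ℂ A] (p : A[X]) (hp : p.Monic) : A[X] →ₗ[ℂ] A[X] where
  toFun f := f /ₘ p
  map_add' f g := by
    refine (div_modByMonic_unique (r := f %ₘ p + g %ₘ p) _ hp ⟨?_, ?_⟩).1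
    · conv_rhs => rw [← modByMonic_add_div f p, ← modByMonic_add_div g p]
      ring
    · exact (degree_add_le _ _).trans_lt
        (max_lt (degree_modByMonic_lt f hp) (degree_modByMonic_lt g hp))
  map_smul' a f := by
    refine (div_modByMonic_unique (r := a • (f %ₘ p)) _ hp ⟨?_, ?_⟩).1
    · conv_rhs => rw [← modByMonic_add_div f p]
      rw [RingHom.id_apply, smul_add, mul_smul_comm]
    · exact (degree_smul_le _ _).trans_lt (degree_modByMonic_lt f hp)

/-- The coefficient of `X ^ (n - 1)` of the remainder modulo a monic polynomial of degree `n`. -/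
def topRem [Algebra ℂ A] (p : A[X]) : A[X] →ₗ[ℂ] A :=
  ((lcoeff A (p.natDegree - 1)).comp (modByMonicHom p)).restrictScalars ℂ

theorem topRem_apply [Algebra ℂ A] (p f : A[X]) :
    topRem p f = (f %ₘ p).coeff (p.natDegree - 1) := rfl

end MonicDiv


/-! ### The operators induced by `∂` and `z` on polynomial rows, and the remainders of the tails. -/

variable {r : ℕ} {M : Submodule ℂ (Fin r → Sym)} {χ : ℂ[X]}

/-- The element of `M` with polynomial part `χ(∂) d`. -/
def IsFrame.lift (h : IsFrame M χ) : (Fin r → ℂ[X][X]) →ₗ[ℂ] (Fin r → Sym) where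
  toFun d := (h.ann d).choose
  map_add' d e := by
    refine eq_of_rho_eq h.lead (h.ann _).choose_spec.1
      (M.add_mem (h.ann _).choose_spec.1 (h.ann _).choose_spec.1) fun i => ?_
    rw [(h.ann _).choose_spec.2, Pi.add_apply, Pi.add_apply, map_add, (h.ann _).choose_spec.2,
      (h.ann _).choose_spec.2, mul_add]
  map_smul' a d := by
    refine eq_of_rho_eq h.lead (h.ann _).choose_spec.1
      (M.smul_mem a (h.ann _).choose_spec.1) fun i => ?_
    rw [(h.ann _).choose_spec.2, RingHom.id_apply, Pi.smul_apply, Pi.smul_apply, map_smul,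
      (h.ann _).choose_spec.2, mul_smul_comm]

theorem IsFrame.lift_mem (h : IsFrame M χ) (d : Fin r → ℂ[X][X]) : h.lift d ∈ M :=
  (h.ann d).choose_spec.1

theorem IsFrame.rho_lift (h : IsFrame M χ) (d : Fin r → ℂ[X][X]) (i : Fin r) :
    rho (h.lift d i) = cstP χ * d i :=
  (h.ann d).choose_spec.2 i

theorem IsFrame.lift_eq (h : IsFrame M χ) {d : Fin r → ℂ[X][X]} {c : Fin r → Sym} (hc : c ∈ M)
    (hd : ∀ i, rho (c i) = cstP χ * d i) : h.lift d = c :=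
  eq_of_rho_eq h.lead (h.lift_mem d) hc fun i => by rw [h.rho_lift, hd]

theorem IsFrame.lift_mulX (h : IsFrame M χ) (d : Fin r → ℂ[X][X]) :
    h.lift (mulX r d) = fun i => X * h.lift d i :=
  h.lift_eq (h.stable.X_mul _ (h.lift_mem d)) fun i => by
    rw [mapCoeff_X_mul, h.rho_lift, mulX_apply, mul_left_comm]

theorem IsFrame.lift_rho (h : IsFrame M χ) {c : Fin r → Sym} (hc : c ∈ M) :
    h.lift (fun i => rho (c i)) = fun i => cst χ * c i :=
  h.lift_eq (h.stable.cst_mul _ hc) fun _ => rho_cst_mul _ _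

/-- Composition with `z`, corrected by the polynomial part of the coefficient of `z⁻¹`. -/
def IsFrame.mulZ (h : IsFrame M χ) : Module.End ℂ (Fin r → ℂ[X][X]) :=
  LinearMap.pi fun i =>
    (LinearMap.mulLeft ℂ (C X) + derivative.restrictScalars ℂ).comp (LinearMap.proj i) +
      (mapAlgHom (Algebra.ofId ℂ ℂ[X])).toLinearMap.comp ((divHom χ h.monic).comp
        (resSym.comp ((LinearMap.proj i).comp h.lift)))

theorem IsFrame.mulZ_apply (h : IsFrame M χ) (d : Fin r → ℂ[X][X]) (i : Fin r) :
    h.mulZ d i = C X * d i + derivative (d i) + cstP (resSym (h.lift d i) /ₘ χ) := rfl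

/-- The coefficient of `∂⁻¹ z⁻¹`. -/
def IsFrame.resid (h : IsFrame M χ) : (Fin r → ℂ[X][X]) →ₗ[ℂ] (Fin r → ℂ) :=
  LinearMap.pi fun i => (topRem χ).comp (resSym.comp ((LinearMap.proj i).comp h.lift))

theorem IsFrame.resid_apply (h : IsFrame M χ) (d : Fin r → ℂ[X][X]) (i : Fin r) :
    h.resid d i = topRem χ (resSym (h.lift d i)) := rfl

/-- The remainder of the tail modulo `χ`. -/
def IsFrame.remainder (h : IsFrame M χ) : (Fin r → ℂ[X][X]) →ₗ[ℂ] (Fin r → Sym) :=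
  LinearMap.pi fun i => ((modByMonicHom (cst χ)).restrictScalars ℂ).comp
    (tail.comp ((LinearMap.proj i).comp h.lift))

theorem IsFrame.remainder_apply (h : IsFrame M χ) (d : Fin r → ℂ[X][X]) (i : Fin r) :
    h.remainder d i = tail (h.lift d i) %ₘ cst χ := rfl

theorem IsFrame.monic_cst (h : IsFrame M χ) : (cst χ).Monic := h.monic.map _

theorem IsFrame.natDegree_cst (h : IsFrame M χ) : (cst χ).natDegree = χ.natDegree :=
  h.monic.natDegree_map _

/-- The leading coefficient of the remainder of the tail modulo `χ`. -/
def IsFrame.leadRem (h : IsFrame M χ) : (Fin r → ℂ[X][X]) →ₗ[ℂ] (Fin r → Rat1) :=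
  LinearMap.pi fun i => (topRem (cst χ)).comp (tail.comp ((LinearMap.proj i).comp h.lift))

theorem IsFrame.leadRem_apply (h : IsFrame M χ) (d : Fin r → ℂ[X][X]) (i : Fin r) :
    h.leadRem d i = (h.remainder d i).coeff (χ.natDegree - 1) := by
  rw [← h.natDegree_cst]
  rfl

/-- If `d` is the polynomial part of `c ∈ M`, then `h.lift d` is `χ(∂) c`, so the division by `χ` in
`mulZ` is exact. The result is the polynomial part of `c ∘ z`. -/
theorem IsFrame.mulZ_mem (h : IsFrame M χ) : polyParts M ≤ (polyParts M).comap h.mulZ := by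
  intro d hd
  obtain ⟨c, hc, hcd⟩ := mem_polyParts.mp hd
  obtain rfl : (fun i => rho (c i)) = d := funext hcd
  refine mem_polyParts.mpr ⟨_, h.stable.zop_mem c hc, fun i => ?_⟩
  rw [rho_zop, h.mulZ_apply, h.lift_rho hc, resSym_cst_mul, mul_divByMonic_cancel_left _ h.monic]

/-- On polynomial parts of elements `c` of `M` the lift is `χ(∂) c`, whose tail is divisible by `χ`.
The remainder therefore factors through the finite-dimensional quotient. -/
theorem IsFrame.remainder_mem (h : IsFrame M χ) : polyParts M ≤ LinearMap.ker h.remainder := by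
  intro d hd
  obtain ⟨c, hc, hcd⟩ := mem_polyParts.mp hd
  obtain rfl : (fun i => rho (c i)) = d := funext hcd
  rw [LinearMap.mem_ker]
  funext i
  rw [h.remainder_apply, h.lift_rho hc, tail_cst_mul, mul_comm, mul_self_modByMonic h.monic_cst]
  rfl

/-- The term `d` comes from `[d/dX, X] = 1`. The constant row is the change in the quotient by `χ`
when its argument is multiplied by `X`. On the quotient space this becomes the moment equation. -/
theorem IsFrame.mulZ_mulX (h : IsFrame M χ) (d : Fin r → ℂ[X][X]) :
    h.mulZ (mulX r d) - mulX r (h.mulZ d) = d + fun i => C (C (h.resid d i)) := by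
  funext i
  rw [Pi.sub_apply, h.mulZ_apply, mulX_apply, mulX_apply, h.mulZ_apply, h.lift_mulX, mapCoeff_X_mul,
    (X_mul_div_mod h.monic _).1, map_add, map_mul cstP, Pi.add_apply, h.resid_apply, topRem_apply,
    derivative_mul, derivative_X]
  simp only [coe_mapRingHom, map_X, map_C]
  ring

theorem IsFrame.remainder_mulX (h : IsFrame M χ) (d : Fin r → ℂ[X][X]) (i : Fin r) :
    h.remainder (mulX r d) i = X * h.remainder d i - cst χ * C (h.leadRem d i) := by
  rw [h.remainder_apply, h.lift_mulX, mapCoeff_X_mul, (X_mul_div_mod h.monic_cst _).2]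
  rfl

/-- The top coefficients of `c` are polynomials, so `c` has no higher order than its polynomial
part. At order `n` the coefficient is still polynomial, and the tail starts strictly below. -/
theorem IsFrame.coeff_tail_eq_zero (h : IsFrame M χ) {c : Fin r → Sym} (hc : c ∈ M) {n : ℕ}
    (hn : ∀ i k, n < k → (rho (c i)).coeff k = 0) (i : Fin r) {k : ℕ} (hk : n ≤ k) :
    (tail (c i)).coeff k = 0 := by
  have hpoly : ∀ m, (∀ i k, m < k → (c i).coeff k = 0) → ∀ i,
      (c i).coeff m = toRat ((rho (c i)).coeff m) := by
    intro m hm i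
    obtain ⟨p, hp⟩ := h.lead c hc m hm i
    rw [coeff_mapCoeff, hp, polyPart_toRat]
  have hdesc : ∀ m, (∀ i k, n + m < k → (c i).coeff k = 0) → ∀ i k, n < k → (c i).coeff k = 0 := by
    intro m
    induction m with
    | zero => exact fun h => h
    | succ m ih =>
      intro hm
      refine ih fun i k hk => ?_
      rcases Nat.eq_or_lt_of_le (Nat.succ_le_of_lt hk) with rfl | hk
      · rw [Nat.succ_eq_add_one, add_assoc, hpoly _ hm, hn i _ (by omega), map_zero]
      · exact hm i k hk
  obtain ⟨m, hm⟩ := exists_degree_bound c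
  have h0 := hdesc m fun i k hk => coeff_eq_zero_of_natDegree_lt ((hm i).trans (by omega))
  rw [coeff_mapCoeff, tailPart_apply]
  rcases Nat.eq_or_lt_of_le hk with rfl | hk
  · have h1 := hpoly n h0 i
    rw [coeff_mapCoeff] at h1
    rw [← h1, sub_self]
  · rw [h0 i k hk]
    simp

/-- The generators of the free module of rows of polynomial operators. -/
def unitRow (l : Fin r) : Fin r → ℂ[X][X] := fun i => if i = l then 1 else 0

theorem coeff_cstP_mul_unitRow_eq_zero (l i : Fin r) {k : ℕ} (hk : χ.natDegree < k) :
    (cstP χ * unitRow l i).coeff k = 0 := by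
  rw [unitRow]
  split_ifs
  · rw [mul_one, coe_mapRingHom, coeff_map, coeff_eq_zero_of_natDegree_lt hk, map_zero]
  · rw [mul_zero, coeff_zero]

/-- Here the polynomial part `χ(∂) e_l` has order `deg χ`, so the tail has smaller order and is its
own remainder. -/
theorem IsFrame.tail_lift_unitRow (h : IsFrame M χ) (l i : Fin r) :
    tail (h.lift (unitRow l) i) = h.remainder (unitRow l) i := by
  rw [h.remainder_apply, (modByMonic_eq_self_iff h.monic_cst).mpr]
  rw [degree_eq_natDegree h.monic_cst.ne_zero, degree_lt_iff_coeff_zero, h.natDegree_cst]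
  intro k hk
  refine h.coeff_tail_eq_zero (h.lift_mem _) (fun i k hk => ?_) i hk
  rw [h.rho_lift]
  exact coeff_cstP_mul_unitRow_eq_zero l i hk

theorem IsFrame.lift_unitRow (h : IsFrame M χ) (l i : Fin r) :
    h.lift (unitRow l) i = cst χ * (if i = l then 1 else 0) + h.remainder (unitRow l) i := by
  rw [← h.tail_lift_unitRow, tail_eq, h.rho_lift, map_mul, polySym_cstP, unitRow]
  split_ifs
  · rw [map_one]
    ring
  · rw [map_zero]
    ring

/-- Both sides lie in `M`, so comparing polynomial parts suffices. The term with `χ'` is the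
commutator of `χ(∂)` with `z`; the sum compensates the remainder modulo `χ` that `mulZ` discards. -/
theorem IsFrame.cst_mul_lift_mulZ (h : IsFrame M χ) (d : Fin r → ℂ[X][X]) (i : Fin r) :
    cst χ * h.lift (h.mulZ d) i = cst χ * zop (h.lift d i) - cst (derivative χ) * h.lift d i -
      ∑ l, cst (resSym (h.lift d l) %ₘ χ) * h.lift (unitRow l) i := by
  have h1 : (fun i => cst χ * h.lift (h.mulZ d) i) ∈ M := h.stable.cst_mul _ (h.lift_mem _)
  have h2 : ((fun i => cst χ * zop (h.lift d i)) - (fun i => cst (derivative χ) * h.lift d i) -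
      ∑ l, fun i => cst (resSym (h.lift d l) %ₘ χ) * h.lift (unitRow l) i) ∈ M :=
    M.sub_mem (M.sub_mem (h.stable.cst_mul _ (h.stable.zop_mem _ (h.lift_mem _)))
      (h.stable.cst_mul _ (h.lift_mem _)))
      (M.sum_mem fun l _ => h.stable.cst_mul _ (h.lift_mem _))
  have h3 := congrFun (eq_of_rho_eq h.lead h1 h2 fun i => ?_) i
  · rw [h3, Pi.sub_apply, Pi.sub_apply, Finset.sum_apply]
  · rw [Pi.sub_apply, Pi.sub_apply, Finset.sum_apply, map_sub, map_sub, map_sum, rho_cst_mul,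
      rho_cst_mul, rho_cst_mul, h.rho_lift, h.rho_lift, rho_zop, h.rho_lift, h.mulZ_apply]
    simp only [rho_cst_mul, h.rho_lift]
    have h4 : ∑ l, cstP (resSym (h.lift d l) %ₘ χ) * (cstP χ * unitRow l i) =
        cstP χ * cstP (resSym (h.lift d i) %ₘ χ) := by
      rw [Finset.sum_eq_single i]
      · simp [unitRow, mul_comm]
      · intro l _ hl
        simp [unitRow, Ne.symm hl]
      · simp
    have h5 : cstP (resSym (h.lift d i)) = cstP (resSym (h.lift d i) %ₘ χ) +
        cstP χ * cstP (resSym (h.lift d i) /ₘ χ) := by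
      rw [← map_mul, ← map_add, modByMonic_add_div]
    have h6 : derivative (cstP χ) = cstP (derivative χ) := by
      rw [coe_mapRingHom, derivative_map]
    rw [h4, h5, derivative_mul, h6]
    ring

theorem IsFrame.coeff_remainder_eq_zero (h : IsFrame M χ) (d : Fin r → ℂ[X][X]) (i : Fin r) {k : ℕ}
    (hk : χ.natDegree ≤ k) : (h.remainder d i).coeff k = 0 := by
  have := degree_modByMonic_lt (tail (h.lift d i)) h.monic_cst
  rw [degree_eq_natDegree h.monic_cst.ne_zero, degree_lt_iff_coeff_zero, h.natDegree_cst] at this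
  exact this k hk

/-- The tails in `IsFrame.cst_mul_lift_mulZ` are divided by `χ`. For degree reasons the quotients
cancel, and the relation sought is the coefficient of `X^(2 deg χ - 1)` in what remains. -/
theorem IsFrame.leadRem_mulZ (h : IsFrame M χ) (d : Fin r → ℂ[X][X]) (i : Fin r) :
    h.leadRem (h.mulZ d) i = RatFunc.X * h.leadRem d i - RatFunc.C (h.resid d i) := by
  rcases Nat.eq_zero_or_pos χ.natDegree with hn | hn
  · have hu : IsUnit χ :=
      h.monic.isUnit_iff.mpr (h.monic.natDegree_eq_zero.mp hn)
    rw [h.leadRem_apply, h.leadRem_apply, h.coeff_remainder_eq_zero _ _ (by omega),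
      h.coeff_remainder_eq_zero _ _ (by omega), h.resid_apply, topRem_apply,
      (modByMonic_eq_zero_iff_dvd h.monic).mpr hu.dvd]
    simp
  obtain ⟨n, hn⟩ : ∃ n, χ.natDegree = n + 1 := ⟨χ.natDegree - 1, by omega⟩
  have key := congrArg tail (h.cst_mul_lift_mulZ d i)
  rw [map_sub, map_sub, map_sum, tail_cst_mul, tail_cst_mul, tail_cst_mul, tail_zop] at key
  simp only [tail_cst_mul, h.tail_lift_unitRow] at key
  have e1 := modByMonic_add_div (tail (h.lift (h.mulZ d) i)) (cst χ)
  have e2 := modByMonic_add_div (tail (h.lift d i)) (cst χ)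
  have e3 := congrArg cst (modByMonic_add_div (resSym (h.lift d i)) χ)
  rw [← h.remainder_apply] at e1 e2
  rw [map_add, map_mul] at e3
  have hz1 := fun k hk => h.coeff_remainder_eq_zero (h.mulZ d) i (k := k) hk
  have hz2 := fun k hk => h.coeff_remainder_eq_zero d i (k := k) hk
  have hz3 := fun l k hk => h.coeff_remainder_eq_zero (unitRow l) i (k := k) hk
  have hz4 : ∀ l k, χ.natDegree ≤ k → (resSym (h.lift d l) %ₘ χ).coeff k = 0 := by
    intro l k hk
    have := degree_modByMonic_lt (resSym (h.lift d l)) h.monic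
    rw [degree_eq_natDegree h.monic.ne_zero, degree_lt_iff_coeff_zero] at this
    exact this k hk
  rw [h.leadRem_apply, h.leadRem_apply, h.resid_apply, topRem_apply]
  set ρ₁ := h.remainder (h.mulZ d) i
  set ρ := h.remainder d i
  set m := fun l => resSym (h.lift d l) %ₘ χ
  set t₁ := tail (h.lift (h.mulZ d) i) /ₘ cst χ
  set t := tail (h.lift d i) /ₘ cst χ
  set k := resSym (h.lift d i) /ₘ χ
  rw [← e1, ← e2, ← e3, zop_apply, derivative_add, derivative_mul] at key
  have hder : derivative (cst χ) = cst (derivative χ) := by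
    rw [coe_mapRingHom, derivative_map]
  -- The remainders are collected on the left and the quotients on the right.
  have hL : cst χ * (ρ₁ - C RatFunc.X * ρ + cst (m i) - derivative ρ) + cst (derivative χ) * ρ +
      ∑ l, cst (m l) * h.remainder (unitRow l) i =
      cst χ * cst χ * (C RatFunc.X * t + derivative t - t₁ - cst k) := by
    rw [hder] at key
    linear_combination key
  have hdeg : ∀ {p : Sym}, (∀ k, χ.natDegree ≤ k → p.coeff k = 0) → p.natDegree ≤ n := by
    intro p hp
    refine natDegree_le_iff_coeff_eq_zero.mpr fun k hk => hp k (by omega)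
  have hχn : (cst χ).natDegree ≤ n + 1 := by rw [h.natDegree_cst, hn]
  have hχn' : (cst (derivative χ)).natDegree ≤ n := by
    refine natDegree_map_le.trans ?_
    have := natDegree_derivative_le χ
    omega
  have hm : ∀ l, (cst (m l)).natDegree ≤ n := fun l =>
    hdeg fun k hk => by rw [coe_mapRingHom, coeff_map, hz4 l k hk, map_zero]
  have hρd : (derivative ρ).natDegree ≤ n - 1 :=
    (natDegree_derivative_le ρ).trans (Nat.sub_le_sub_right (hdeg hz2) 1)
  have hfac : (ρ₁ - C RatFunc.X * ρ + cst (m i) - derivative ρ).natDegree ≤ n := by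
    refine hdeg fun k hk => ?_
    rw [coeff_sub, coeff_add, coeff_sub, coeff_C_mul, hz1 k hk, hz2 k hk, coe_mapRingHom, coeff_map,
      hz4 i k hk, coeff_derivative, hz2 (k + 1) (by omega)]
    simp
  have hdegL : (cst χ * (ρ₁ - C RatFunc.X * ρ + cst (m i) - derivative ρ) + cst (derivative χ) * ρ +
      ∑ l, cst (m l) * h.remainder (unitRow l) i).natDegree ≤ n + 1 + n := by
    refine natDegree_add_le_of_degree_le (natDegree_add_le_of_degree_le
      (natDegree_mul_le_of_le hχn hfac) ((natDegree_mul_le_of_le hχn' (hdeg hz2)).trans (by omega))) ?_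
    exact natDegree_sum_le_of_forall_le _ _ fun l _ =>
      (natDegree_mul_le_of_le (hm l) (hdeg (hz3 l))).trans (by omega)
  -- The right side of `hL` is a multiple of the monic `χ²`, while the left side has degree less
  -- than `2 deg χ`.
  have hzero : C RatFunc.X * t + derivative t - t₁ - cst k = 0 := by
    by_contra hne
    have h1 := (h.monic_cst.mul h.monic_cst).natDegree_mul' hne
    rw [h.monic_cst.natDegree_mul h.monic_cst, h.natDegree_cst, hn, ← hL] at h1
    omega
  rw [hzero, mul_zero] at hL
  have hc := congrArg (fun p : Sym => p.coeff (n + 1 + n)) hL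
  simp only [coeff_add, finsetSum_coeff, coeff_zero] at hc
  rw [coeff_mul_add_eq_of_natDegree_le hχn hfac, Finset.sum_eq_zero, add_zero,
    coeff_eq_zero_of_natDegree_lt (p := cst (derivative χ) * ρ), add_zero] at hc
  · have h1 : (cst χ).coeff (n + 1) = 1 := by
      rw [← hn, ← h.natDegree_cst]
      exact h.monic_cst.coeff_natDegree
    have h2 : (derivative ρ).coeff n = 0 := by
      rw [coeff_derivative, hz2 _ (by omega), zero_mul]
    rw [h1, one_mul, coeff_sub, h2, sub_zero, coeff_add, coeff_sub, coeff_C_mul, coe_mapRingHom,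
      coeff_map] at hc
    rw [hn, Nat.add_sub_cancel]
    have h3 : RatFunc.C ((m i).coeff n) = algebraMap ℂ Rat1 ((m i).coeff n) := rfl
    rw [h3]
    linear_combination hc
  · exact lt_of_le_of_lt (natDegree_mul_le_of_le hχn' (hdeg hz2)) (by omega)
  · intro l _
    refine coeff_eq_zero_of_natDegree_lt
      (lt_of_le_of_lt (natDegree_mul_le_of_le (hm l) (hdeg (hz3 l))) (by omega))

end AdelicGr
end

noncomputable section
namespace AdelicGr
open Polynomial

/-! ### Rational functions of one variable and symbols as rational functions of two variables -/

/-- The variables of `ℂ(x, z)`. -/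
abbrev var2 (i : Fin 2) : Rat2 := algebraMap (MvPolynomial (Fin 2) ℂ) Rat2 (MvPolynomial.X i)

/-- A polynomial of one variable as a polynomial of two variables. -/
abbrev polyVar (i : Fin 2) : ℂ[X] →ₐ[ℂ] MvPolynomial (Fin 2) ℂ := aeval (MvPolynomial.X i)

theorem polyVar_injective (i : Fin 2) : Function.Injective (polyVar i) :=
  transcendental_iff_injective.mp (MvPolynomial.transcendental_X ℂ i)

/-- A polynomial of one variable as a rational function of two variables. -/
abbrev polyVar2 (i : Fin 2) : ℂ[X] →ₐ[ℂ] Rat2 := aeval (var2 i)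

theorem polyVar2_apply (i : Fin 2) (p : ℂ[X]) :
    polyVar2 i p = algebraMap (MvPolynomial (Fin 2) ℂ) Rat2 (polyVar i p) :=
  aeval_algebraMap_apply _ _ _

theorem polyVar2_injective (i : Fin 2) : Function.Injective (polyVar2 i) := fun p q h => by
  rw [polyVar2_apply, polyVar2_apply] at h
  exact polyVar_injective i (IsFractionRing.injective _ Rat2 h)

/-- A rational function of one variable as a rational function of two variables. -/
def embed (i : Fin 2) : Rat1 →ₐ[ℂ] Rat2 :=
  RatFunc.liftAlgHom (polyVar2 i)
    (nonZeroDivisors_le_comap_nonZeroDivisors_of_injective _ (polyVar2_injective i))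

theorem embed_toRat (i : Fin 2) (p : ℂ[X]) : embed i (toRat p) = polyVar2 i p := by
  have := RatFunc.liftAlgHom_apply_div (polyVar2 i)
    (nonZeroDivisors_le_comap_nonZeroDivisors_of_injective _ (polyVar2_injective i)) p 1
  rw [map_one, map_one, div_one, div_one] at this
  exact this

theorem eval_eq_embed (i : Fin 2) (f : Rat1) : f.eval (algebraMap ℂ Rat2) (var2 i) = embed i f :=
  (RatFunc.liftAlgHom_apply (polyVar2 i)
    (nonZeroDivisors_le_comap_nonZeroDivisors_of_injective _ (polyVar2_injective i)) f).symm

theorem embed_X (i : Fin 2) : embed i RatFunc.X = var2 i := by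
  rw [← toRat_X, embed_toRat, aeval_X]

theorem embed_C (i : Fin 2) (c : ℂ) : embed i (RatFunc.C c) = algebraMap ℂ Rat2 c := by
  rw [← toRat_C, embed_toRat, aeval_C]

/-- A polynomial symbol as a polynomial of two variables. -/
def biPoly : ℂ[X][X] →+* MvPolynomial (Fin 2) ℂ :=
  eval₂RingHom (polyVar 1 : ℂ[X] →+* MvPolynomial (Fin 2) ℂ) (MvPolynomial.X 0)

theorem eval_polyVar (i : Fin 2) (x : Fin 2 → ℂ) (p : ℂ[X]) :
    MvPolynomial.eval x (polyVar i p) = p.eval (x i) := by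
  rw [polyVar, aeval_def, hom_eval₂, MvPolynomial.eval_X]
  have : (MvPolynomial.eval x).comp (algebraMap ℂ (MvPolynomial (Fin 2) ℂ)) = RingHom.id ℂ := by
    ext c
    simp
  rw [this]
  rfl

theorem eval_biPoly (d : ℂ[X][X]) (x z : ℂ) :
    MvPolynomial.eval ![x, z] (biPoly d) = (d.eval (C x)).eval z := by
  induction d using Polynomial.induction_on' with
  | add p q hp hq => rw [map_add, map_add, hp, hq, eval_add, eval_add]
  | monomial k a =>
    rw [biPoly, coe_eval₂RingHom, eval₂_monomial, map_mul, map_pow, MvPolynomial.eval_X]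
    have := eval_polyVar 1 ![x, z] a
    simpa using Or.inl this

theorem biPoly_injective : Function.Injective biPoly := by
  rw [injective_iff_map_eq_zero]
  intro d hd
  have h : ∀ x z : ℂ, (d.eval (C x)).eval z = 0 := fun x z => by rw [← eval_biPoly, hd, map_zero]
  have h1 : ∀ x : ℂ, d.eval (C x) = 0 := fun x => Polynomial.funext fun z => by rw [h, eval_zero]
  refine Polynomial.eq_zero_of_infinite_isRoot d ?_
  refine (Set.infinite_range_of_injective (C_injective (R := ℂ))).mono ?_
  rintro _ ⟨x, rfl⟩
  exact h1 x

/-- A symbol as a rational function of `(x, z)`. -/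
def iota : Sym →+* Rat2 := eval₂RingHom (embed 1 : Rat1 →+* Rat2) xx

theorem iota_X : iota X = xx := eval₂_X _ _

theorem iota_C (f : Rat1) : iota (C f) = embed 1 f := eval₂_C _ _

theorem iota_cst (g : ℂ[X]) : iota (cst g) = polyVar2 0 g := by
  have : iota.comp cst = (polyVar2 0 : ℂ[X] →+* Rat2) := by
    refine Polynomial.ringHom_ext (fun c => ?_) ?_
    · simp only [RingHom.comp_apply, coe_mapRingHom, map_C, iota_C]
      simpa using embed_C 1 c
    · simp [iota_X]
      rfl
  exact congrFun (congrArg DFunLike.coe this) g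

theorem iota_polySym (d : ℂ[X][X]) :
    iota (polySym d) = algebraMap (MvPolynomial (Fin 2) ℂ) Rat2 (biPoly d) := by
  have : iota.comp polySym = (algebraMap (MvPolynomial (Fin 2) ℂ) Rat2).comp biPoly := by
    refine Polynomial.ringHom_ext (fun p => ?_) ?_
    · simp only [RingHom.comp_apply, coe_mapRingHom, map_C, iota_C, biPoly, coe_eval₂RingHom,
        eval₂_C]
      exact (embed_toRat 1 p).trans (polyVar2_apply 1 p)
    · simp only [RingHom.comp_apply, coe_mapRingHom, map_X, iota_X, biPoly, coe_eval₂RingHom,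
        eval₂_X]
      rfl
  exact congrFun (congrArg DFunLike.coe this) d

theorem exists_mul_eq_polySym (c : Sym) :
    ∃ s : ℂ[X], s ≠ 0 ∧ ∃ d : ℂ[X][X], C (toRat s) * c = polySym d := by
  obtain ⟨b, hb, h⟩ := IsLocalization.integerNormalization_spec (nonZeroDivisors ℂ[X]) c
  refine ⟨b, nonZeroDivisors.ne_zero hb,
    IsLocalization.integerNormalization (nonZeroDivisors ℂ[X]) c, ?_⟩
  rw [coe_mapRingHom, h, Algebra.smul_def]
  rfl

theorem iota_injective : Function.Injective iota := by
  rw [injective_iff_map_eq_zero]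
  intro c hc
  obtain ⟨s, hs, d, hd⟩ := exists_mul_eq_polySym c
  have h1 := congrArg iota hd
  rw [map_mul, hc, mul_zero, iota_polySym, eq_comm] at h1
  have h2 : d = 0 := biPoly_injective (IsFractionRing.injective _ Rat2 (by rw [h1, map_zero, map_zero]))
  rw [h2, map_zero] at hd
  exact (mul_eq_zero.mp hd).resolve_left (by simpa using hs)

/-! ### The quadruple -/

theorem det_sub_constMat_ne_zero {n : ℕ} (i : Fin 2) (Y : Matrix (Fin n) (Fin n) ℂ) :
    (var2 i • (1 : Matrix (Fin n) (Fin n) Rat2) - constMat Y).det ≠ 0 := by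
  have h : (var2 i • (1 : Matrix (Fin n) (Fin n) Rat2) - constMat Y) =
      (polyVar2 i : ℂ[X] →+* Rat2).mapMatrix Y.charmatrix := by
    ext k l
    by_cases hkl : k = l
    · subst hkl
      simp only [constMat, Matrix.sub_apply, Matrix.smul_apply, Matrix.one_apply_eq, smul_eq_mul,
        mul_one, Matrix.map_apply, RingHom.mapMatrix_apply, Matrix.charmatrix_apply_eq, map_sub,
        RingHom.coe_coe, aeval_X, aeval_C]
    · simp [constMat, hkl]
  rw [h, ← RingHom.map_det]
  exact fun h0 => Y.charpoly_monic.ne_zero (polyVar2_injective i (h0.trans (map_zero _).symm))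

theorem det_add_constMat_ne_zero {n : ℕ} (i : Fin 2) (Y : Matrix (Fin n) (Fin n) ℂ) :
    (var2 i • (1 : Matrix (Fin n) (Fin n) Rat2) + constMat Y).det ≠ 0 := by
  have h := det_sub_constMat_ne_zero i (-Y)
  have : constMat (-Y) = -constMat Y := by
    ext k l
    simp [constMat]
  rwa [this, sub_neg_eq_add] at h

theorem exists_coordinates {A : Type} [AddCommGroup A] [Module ℂ A] (P : Submodule ℂ A)
    [Module.Finite ℂ (A ⧸ P)] :
    ∃ (n : ℕ) (e : Fin n → A) (a : A →ₗ[ℂ] (Fin n → ℂ)), P ≤ LinearMap.ker a ∧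
      (∀ k, a (e k) = Pi.single k 1) ∧ ∀ d, d - ∑ k, a d k • e k ∈ P := by
  let b := Module.finBasis ℂ (A ⧸ P)
  choose e he using fun k => P.mkQ_surjective (b k)
  refine ⟨_, e, b.equivFun.toLinearMap.comp P.mkQ, ?_, ?_, ?_⟩
  · intro d hd
    have : P.mkQ d = 0 := by simpa using hd
    rw [LinearMap.mem_ker, LinearMap.comp_apply, this, map_zero]
  · intro k
    rw [LinearMap.comp_apply, he]
    ext j
    simp [Pi.single_apply, eq_comm]
  · intro d
    rw [← Submodule.Quotient.mk_eq_zero, ← Submodule.mkQ_apply, map_sub, map_sum]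
    simp only [map_smul, he]
    exact sub_eq_zero.mpr (b.sum_equivFun (P.mkQ d)).symm

variable {r : ℕ} {M : Submodule ℂ (Fin r → Sym)} {χ : ℂ[X]}

/-- The elements of `M` with polynomial parts `χ(∂) e_l` are given by a Calogero-Moser quadruple. -/
theorem IsFrame.exists_quad (h : IsFrame M χ)
    (hfin : Module.Finite ℂ ((Fin r → ℂ[X][X]) ⧸ polyParts M)) :
    ∃ (n : ℕ) (q : CMQuad n r), ∀ l i, iota (h.lift (unitRow l) i) = polyVar2 0 χ * q.baker l i := by
  obtain ⟨n, e, a, haP, hae, hrep⟩ := exists_coordinates (polyParts M)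
  -- Every map that kills `polyParts M` is determined by its values on the representatives `e k`.
  -- Remainders and induced operators are all of this kind.
  have hlin : ∀ {B : Type} [AddCommGroup B] [Module ℂ B] (f : (Fin r → ℂ[X][X]) →ₗ[ℂ] B),
      polyParts M ≤ LinearMap.ker f → ∀ d, f d = ∑ k, a d k • f (e k) := by
    intro B _ _ f hf d
    have := hf (hrep d)
    rw [LinearMap.mem_ker, map_sub, map_sum, sub_eq_zero] at this
    rw [this]
    simp only [map_smul]
  have hleadmem : polyParts M ≤ LinearMap.ker h.leadRem := by
    intro d hd
    rw [LinearMap.mem_ker]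
    funext i
    have := h.remainder_mem hd
    rw [LinearMap.mem_ker] at this
    rw [h.leadRem_apply, this]
    simp
  have hmX : polyParts M ≤ LinearMap.ker (a.comp (mulX r)) := fun d hd =>
    haP (h.stable.mulX_mem hd)
  have hmZ : polyParts M ≤ LinearMap.ker (a.comp h.mulZ) := fun d hd => haP (h.mulZ_mem hd)
  let T : Matrix (Fin n) (Fin n) ℂ := fun k j => a (mulX r (e k)) j
  let Y : Matrix (Fin n) (Fin n) ℂ := fun k j => a (h.mulZ (e k)) j
  let v : Matrix (Fin n) (Fin r) ℂ := fun k i => h.resid (e k) i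
  let w : Matrix (Fin r) (Fin n) ℂ := fun i k => a (unitRow i) k
  -- Matrices act on the basis from the left, row by row, so `mulZ ∘ mulX` corresponds to `T * Y`,
  -- in this order.
  have hmom : T * Y - Y * T = 1 + v * w := by
    ext k j
    have h1 := congrFun (congrArg a (h.mulZ_mulX (e k))) j
    have h2 := congrFun (hlin _ hmZ (mulX r (e k))) j
    have h3 := congrFun (hlin _ hmX (h.mulZ (e k))) j
    have h4 : (fun i => C (C (h.resid (e k) i)) : Fin r → ℂ[X][X]) =
        ∑ i, h.resid (e k) i • unitRow i := by
      funext i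
      rw [Finset.sum_apply, Finset.sum_eq_single i]
      · rw [Pi.smul_apply, unitRow, if_pos rfl, Algebra.smul_def, mul_one]
        rfl
      · intro l _ hl
        rw [Pi.smul_apply, unitRow, if_neg hl.symm, smul_zero]
      · simp
    rw [h4, map_sub, map_add, map_sum, hae] at h1
    simp only [map_smul, Pi.sub_apply, Pi.add_apply, Finset.sum_apply, Pi.smul_apply, smul_eq_mul,
      LinearMap.comp_apply] at h1 h2 h3
    rw [h2, h3] at h1
    rw [Matrix.sub_apply, Matrix.add_apply, Matrix.mul_apply, Matrix.mul_apply, Matrix.mul_apply]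
    refine h1.trans ?_
    congr 1
    rw [Matrix.one_apply, Pi.single_apply]
    simp only [eq_comm]
  -- The sign of `T` turns `x - T` into the `x + X` of the Baker function and fixes the sign of the
  -- moment equation.
  let q : CMQuad n r := ⟨-T, Y, v, w, by
    rw [Matrix.neg_mul, Matrix.mul_neg, sub_neg_eq_add]
    rw [← neg_inj, neg_neg, ← sub_eq_iff_eq_add.mpr hmom]
    abel⟩
  refine ⟨n, q, fun l i => ?_⟩
  let R : Matrix (Fin n) (Fin r) Rat2 := fun k i => iota (h.remainder (e k) i)
  let Φ : Matrix (Fin n) (Fin r) Rat2 := fun k i => embed 1 (h.leadRem (e k) i)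
  have hiota : ∀ (c : ℂ) (f : Sym), iota (c • f) = algebraMap ℂ Rat2 c * iota f := by
    intro c f
    rw [Algebra.smul_def, map_mul]
    congr 1
    exact (iota_C _).trans (embed_C 1 c)
  -- `IsFrame.remainder_mulX`, written in the basis `e k`.
  have hR : (xx • 1 + constMat q.X) * R = polyVar2 0 χ • Φ := by
    ext k i
    have h1 := congrFun (hlin _ h.remainder_mem (mulX r (e k))) i
    rw [h.remainder_mulX] at h1
    have h2 := congrArg iota h1
    rw [map_sub, map_mul, map_mul, iota_X, iota_cst, iota_C, Finset.sum_apply, map_sum] at h2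
    simp only [Pi.smul_apply, hiota] at h2
    rw [Matrix.add_mul, Matrix.smul_mul, Matrix.one_mul, Matrix.add_apply, Matrix.smul_apply,
      Matrix.smul_apply, smul_eq_mul, smul_eq_mul, Matrix.mul_apply]
    have h3 : ∑ j, constMat q.X k j * R j i = -∑ j, algebraMap ℂ Rat2 (a (mulX r (e k)) j) *
        iota (h.remainder (e j) i) := by
      rw [← Finset.sum_neg_distrib]
      refine Finset.sum_congr rfl fun j _ => ?_
      change algebraMap ℂ Rat2 (-(a (mulX r (e k)) j)) * _ = _
      rw [map_neg, neg_mul]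
    rw [h3, ← h2]
    ring
  -- `IsFrame.leadRem_mulZ`, written in the basis `e k`. Together with `hR` it solves for the
  -- remainders by inverting two matrices.
  have hΦ : (zz • 1 - constMat q.Y) * Φ = constMat q.v := by
    ext k i
    have h1 := congrFun (hlin _ hleadmem (h.mulZ (e k))) i
    rw [h.leadRem_mulZ, Finset.sum_apply] at h1
    have h2 := congrArg (embed 1) h1
    rw [map_sub, map_mul, embed_X, embed_C, map_sum] at h2
    simp only [Pi.smul_apply, Algebra.smul_def, map_mul, AlgHom.commutes] at h2
    rw [Matrix.sub_mul, Matrix.smul_mul, Matrix.one_mul, Matrix.sub_apply, Matrix.smul_apply,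
      smul_eq_mul, Matrix.mul_apply]
    have h3 : ∑ j, constMat q.Y k j * Φ j i = ∑ j, algebraMap ℂ Rat2 (a (h.mulZ (e k)) j) *
        embed 1 (h.leadRem (e j) i) := rfl
    rw [h3, ← h2]
    exact sub_sub_cancel _ _
  have hXu := (det_add_constMat_ne_zero 0 q.X).isUnit
  have hYu := (det_sub_constMat_ne_zero 1 q.Y).isUnit
  have hΦ' : Φ = (zz • 1 - constMat q.Y)⁻¹ * constMat q.v := by
    rw [← hΦ]
    exact (Matrix.nonsing_inv_mul_cancel_left _ _ hYu).symm
  have hR' : R = polyVar2 0 χ • ((xx • 1 + constMat q.X)⁻¹ * Φ) := by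
    rw [← Matrix.mul_smul, ← hR]
    exact (Matrix.nonsing_inv_mul_cancel_left _ _ hXu).symm
  have hrem : iota (h.remainder (unitRow l) i) = (constMat q.w * R) l i := by
    have h1 := congrFun (hlin _ h.remainder_mem (unitRow l)) i
    have h2 := congrArg iota h1
    rw [Finset.sum_apply, map_sum] at h2
    simp only [Pi.smul_apply, hiota] at h2
    exact h2
  rw [h.lift_unitRow, map_add, map_mul, iota_cst, hrem, hR', hΦ', CMQuad.baker, Matrix.mul_smul,
    Matrix.smul_apply, Matrix.add_apply, smul_eq_mul, mul_add, Matrix.one_apply]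
  congr 1
  · congr 1
    simp only [eq_comm (a := i)]
    split_ifs <;> simp
  · simp only [Matrix.mul_assoc]

end AdelicGr
end

noncomputable section
namespace AdelicGr
open Polynomial

/-! ### Existence and uniqueness of the stationary Baker function -/

/-- `eval2` uses the reduced fraction. Its denominator divides `B`, so it does not vanish at the
point either. -/
theorem eval2_div {A B : MvPolynomial (Fin 2) ℂ} {x z : ℂ} (hB : MvPolynomial.eval ![x, z] B ≠ 0) :
    eval2 (algebraMap _ Rat2 A / algebraMap _ Rat2 B) x z =
      MvPolynomial.eval ![x, z] A / MvPolynomial.eval ![x, z] B := by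
  have hinj := IsFractionRing.injective (MvPolynomial (Fin 2) ℂ) Rat2
  have hB0 : B ≠ 0 := by rintro rfl; simp at hB
  have hBK : algebraMap _ Rat2 B ≠ 0 := by rwa [Ne, map_eq_zero_iff _ hinj]
  set f : Rat2 := algebraMap _ Rat2 A / algebraMap _ Rat2 B with hf
  have hq : (IsFractionRing.den (MvPolynomial (Fin 2) ℂ) f : MvPolynomial (Fin 2) ℂ) ≠ 0 :=
    nonZeroDivisors.ne_zero (IsFractionRing.den _ f).2
  have hqK := (map_eq_zero_iff (algebraMap _ Rat2) hinj).not.mpr hq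
  have key : algebraMap _ Rat2 (IsFractionRing.num (MvPolynomial (Fin 2) ℂ) f) /
      algebraMap _ Rat2 (IsFractionRing.den (MvPolynomial (Fin 2) ℂ) f : MvPolynomial (Fin 2) ℂ) =
      algebraMap _ Rat2 A / algebraMap _ Rat2 B := by
    rw [IsFractionRing.mk'_num_den' _ f]
  have hred := IsFractionRing.num_den_reduced (MvPolynomial (Fin 2) ℂ) f
  rw [eval2]
  generalize IsFractionRing.num (MvPolynomial (Fin 2) ℂ) f = p at *
  generalize (IsFractionRing.den (MvPolynomial (Fin 2) ℂ) f : MvPolynomial (Fin 2) ℂ) = q at *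
  rw [div_eq_div_iff hqK hBK, ← map_mul, ← map_mul] at key
  have h1 := hinj key
  have hdvd : q ∣ B := hred.symm.dvd_of_dvd_mul_left ⟨A, by rw [h1, mul_comm]⟩
  have hq0 : MvPolynomial.eval ![x, z] q ≠ 0 := by
    obtain ⟨c, rfl⟩ := hdvd
    intro h0
    rw [map_mul, h0, zero_mul] at hB
    exact hB rfl
  have h2 := congrArg (MvPolynomial.eval ![x, z]) h1
  rw [map_mul, map_mul] at h2
  rw [div_eq_div_iff hq0 hB, h2]

theorem biPoly_surjective : Function.Surjective biPoly := by
  intro A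
  induction A using MvPolynomial.induction_on with
  | C a => exact ⟨C (C a), by simp [biPoly, MvPolynomial.algebraMap_eq]⟩
  | add p q hp hq =>
    obtain ⟨a, rfl⟩ := hp
    obtain ⟨b, rfl⟩ := hq
    exact ⟨a + b, map_add _ _ _⟩
  | mul_X p i hp =>
    obtain ⟨a, rfl⟩ := hp
    fin_cases i
    · exact ⟨a * X, by rw [map_mul]; congr 1; exact eval₂_X _ _⟩
    · exact ⟨a * C X, by rw [map_mul]; congr 1; simp [biPoly]⟩

/-- Every element of `ℂ(x, z)` is a quotient of polynomials. -/
theorem exists_eq_iota_div (F : Rat2) :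
    ∃ a b : ℂ[X][X], b ≠ 0 ∧ F = iota (polySym a) / iota (polySym b) := by
  obtain ⟨A, B, hB, rfl⟩ := IsFractionRing.div_surjective (A := MvPolynomial (Fin 2) ℂ) F
  obtain ⟨a, rfl⟩ := biPoly_surjective A
  obtain ⟨b, rfl⟩ := biPoly_surjective B
  refine ⟨a, b, ?_, by rw [iota_polySym, iota_polySym]⟩
  rintro rfl
  exact nonZeroDivisors.ne_zero hB (map_zero _)

theorem eventually_eval_C_ne_zero {b : ℂ[X][X]} (hb : b ≠ 0) :
    ∀ᶠ x : ℂ in Filter.cofinite, b.eval (C x) ≠ 0 := by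
  have : {x : ℂ | ¬ b.eval (C x) ≠ 0}.Finite := by
    refine Set.Finite.subset (Set.Finite.preimage C_injective.injOn b.roots.toFinset.finite_toSet)
      fun x hx => ?_
    simp only [not_not, Set.mem_ofPred_eq] at hx
    simpa [hb] using hx
  exact this

theorem eventually_eval2 {a b : ℂ[X][X]} {x : ℂ} (hb : b.eval (C x) ≠ 0) :
    ∀ᶠ z : ℂ in Filter.cofinite, eval2 (iota (polySym a) / iota (polySym b)) x z =
      val z (toRat (a.eval (C x)) / toRat (b.eval (C x))) := by
  filter_upwards [eventually_eval_ne_zero hb] with z hz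
  rw [iota_polySym, iota_polySym, eval2_div (by rwa [eval_biPoly]), val_div hz, eval_biPoly,
    eval_biPoly]

theorem eval_polySym (d : ℂ[X][X]) (x : ℂ) :
    (polySym d).eval (RatFunc.C x) = toRat (d.eval (C x)) := by
  rw [← toRat_C, coe_mapRingHom, eval_map]
  exact eval₂_hom _ _

theorem eventually_eval2_iota_div (c : Sym) {g : ℂ[X]} {x : ℂ} (hg : g.eval x ≠ 0) :
    ∀ᶠ z : ℂ in Filter.cofinite, eval2 (iota c / polyVar2 0 g) x z =
      val z ((g.eval x)⁻¹ • c.eval (RatFunc.C x)) := by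
  obtain ⟨s, hs, d, hd⟩ := exists_mul_eq_polySym c
  have hg0 : polyVar2 0 g ≠ 0 := by
    intro h
    have : g = 0 := polyVar2_injective 0 (h.trans (map_zero _).symm)
    rw [this, eval_zero] at hg
    exact hg rfl
  have hs1 : polySym (C s) = C (toRat s) := by
    rw [coe_mapRingHom, map_C]
    rfl
  have hs0 : iota (C (toRat s)) ≠ 0 := by
    rw [← map_zero iota]
    exact iota_injective.ne (by simpa using hs)
  have h1 : iota c / polyVar2 0 g = iota (polySym d) / iota (polySym (C s * cstP g)) := by
    rw [← hd, map_mul polySym, map_mul iota, map_mul iota, polySym_cstP, iota_cst, hs1,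
      mul_div_mul_left _ _ hs0]
  have h2 : (cstP g).eval (C x) = C (g.eval x) := by
    rw [coe_mapRingHom, eval_map]
    exact eval₂_hom _ _
  have h3 : (C s * cstP g).eval (C x) ≠ 0 := by
    rw [eval_mul, eval_C, h2]
    exact mul_ne_zero hs (by simpa using hg)
  have h4 := congrArg (eval (RatFunc.C x)) hd
  rw [eval_mul, eval_C, eval_polySym] at h4
  rw [h1]
  filter_upwards [eventually_eval2 (a := d) h3] with z hz
  rw [hz, eval_mul, eval_C, h2, ← h4, map_mul, toRat_C, mul_div_mul_left _ _ (toRat_ne_zero hs),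
    Algebra.smul_def]
  congr 1
  rw [div_eq_inv_mul, ← map_inv₀]
  rfl

theorem MemClosure.congr {r : ℕ} {W : Submodule ℂ (RatVec r)} {f g : ℂ → Fin r → ℂ}
    (hf : MemClosure W f) (h : ∀ᶠ z in Filter.cofinite, ∀ j, g z j = f z j) : MemClosure W g := by
  obtain ⟨p, hp, hpW, u, hu, e, he, hfe⟩ := hf
  refine ⟨p, hp, hpW, u, hu, e, he, ?_⟩
  filter_upwards [h, hfe] with z h1 h2 j
  rw [h1, h2]

theorem eventually_val_smul (a : ℂ) (f : Rat1) :
    ∀ᶠ z : ℂ in Filter.cofinite, val z (a • f) = a * val z f := by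
  filter_upwards [eventually_val_mul (RatFunc.C a) f] with z hz
  rw [← toRat_C, val_toRat, eval_C, toRat_C] at hz
  rw [← hz, Algebra.smul_def]
  rfl

theorem eval_mem_proper {c : Sym} (hc : ∀ k, c.coeff k ∈ proper) (x : ℂ) :
    c.eval (RatFunc.C x) ∈ proper := by
  rw [eval_eq_sum, sum_def]
  refine proper.sum_mem fun k _ => ?_
  have : c.coeff k * RatFunc.C x ^ k = (x ^ k) • c.coeff k := by
    rw [Algebra.smul_def, map_pow, mul_comm]
    rfl
  rw [this]
  exact proper.smul_mem _ (hc k)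

theorem eval_cst (g : ℂ[X]) (x : ℂ) : (cst g).eval (RatFunc.C x) = RatFunc.C (g.eval x) := by
  rw [coe_mapRingHom, eval_map]
  exact eval₂_hom (algebraMap ℂ Rat1) x

variable {r : ℕ} {W : Submodule ℂ (RatVec r)} {χ : ℂ[X]}

/-- Outside the zeros of `χ` the rows are values at `x` of elements of `rowSyms W`, hence in the
closure after multiplication by `e^{xz}`. Their tails are proper, which gives the normalisation at
infinity. -/
theorem isReducedBaker_of_mem_rowSyms (hW : IsFat W) (hχ : χ ≠ 0)
    {D : Fin r → Fin r → Sym} (hD : ∀ l, D l ∈ rowSyms W)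
    (htail : ∀ l i k, (D l i - cst χ * (if i = l then 1 else 0)).coeff k ∈ proper)
    {P : Matrix (Fin r) (Fin r) Rat2} (hP : ∀ l i, iota (D l i) = polyVar2 0 χ * P l i) :
    IsReducedBaker W P := by
  obtain ⟨⟨p, hp, hpW⟩, -⟩ := hW
  have hχ0 : polyVar2 0 χ ≠ 0 := fun h => hχ (polyVar2_injective 0 (h.trans (map_zero _).symm))
  filter_upwards [eventually_eval_ne_zero hχ] with x hx
  have hev : ∀ l i, ∀ᶠ z : ℂ in Filter.cofinite, eval2 (P l i) x z =
      val z (((χ.eval x)⁻¹ • D l i).eval (RatFunc.C x)) := by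
    intro l i
    have h1 : P l i = iota (D l i) / polyVar2 0 χ := by
      rw [hP, mul_div_cancel_left₀ _ hχ0]
    rw [h1]
    filter_upwards [eventually_eval2_iota_div (D l i) hx] with z hz
    rw [hz, eval_smul]
  refine ⟨fun l i => ?_, fun l => ?_⟩
  · have h1 := tendsto_val_of_mem_proper (eval_mem_proper (htail l i) x)
    set e := (D l i - cst χ * (if i = l then 1 else 0)).eval (RatFunc.C x) with he
    have h2 : (D l i).eval (RatFunc.C x) = e + RatFunc.C (χ.eval x * if i = l then 1 else 0) := by
      rw [he, eval_sub, eval_mul, eval_cst]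
      split_ifs <;> simp
    have h3 := (h1.add_const (χ.eval x * if i = l then 1 else 0)).const_mul (χ.eval x)⁻¹
    have h4 : (χ.eval x)⁻¹ * (0 + χ.eval x * if i = l then 1 else 0) =
        (1 : Matrix (Fin r) (Fin r) ℂ) l i := by
      rw [Matrix.one_apply, zero_add, inv_mul_cancel_left₀ hx]
      simp only [eq_comm]
    rw [h4] at h3
    refine h3.congr' ?_
    filter_upwards [(Bornology.le_cofinite ℂ) (hev l i), (Bornology.le_cofinite ℂ)
      (eventually_val_smul (χ.eval x)⁻¹ ((D l i).eval (RatFunc.C x))), (Bornology.le_cofinite ℂ)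
      (eventually_val_add e (RatFunc.C (χ.eval x * if i = l then 1 else 0)))] with z hz1 hz2 hz3
    rw [hz1, eval_smul, hz2, h2, hz3, ← toRat_C, val_toRat, eval_C]
  · refine (memClosure_of_mem_rowSyms hp hpW ((rowSyms W).smul_mem (χ.eval x)⁻¹ (hD l)) x).congr ?_
    filter_upwards [Filter.eventually_all.mpr (hev l)] with z hz i
    rw [hz]
    rfl

/-- The stationary Baker function is determined by a frame of the module of operators. -/
theorem IsFrame.eq_of_isReducedBaker (hW : W ∈ grAd r) (h : IsFrame (rowSyms W) χ)
    {P : Matrix (Fin r) (Fin r) Rat2} (hP : IsReducedBaker W P) (l i : Fin r) :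
    iota (h.lift (unitRow l) i) = polyVar2 0 χ * P l i := by
  obtain ⟨hfat, hpd, -⟩ := hW
  obtain ⟨⟨p, hp, hpW⟩, -⟩ := id hfat
  choose a b hb hab using fun i => exists_eq_iota_div (P l i)
  obtain ⟨s, hs, d, hd⟩ := exists_mul_eq_polySym (h.lift (unitRow l) i)
  have hev : ∀ᶠ x : ℂ in Filter.cofinite, (C s * cstP χ * a i - b i * d).eval (C x) = 0 := by
    filter_upwards [hP, eventually_eval_ne_zero h.monic.ne_zero,
      Filter.eventually_all.mpr fun i => eventually_eval_C_ne_zero (hb i)] with x hPx hχ hbx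
    let u : RatVec r := fun i => toRat ((a i).eval (C x)) / toRat ((b i).eval (C x))
    have hu : ∀ i, ∀ᶠ z : ℂ in Filter.cofinite, eval2 (P l i) x z = val z (u i) := by
      intro i
      rw [hab]
      exact eventually_eval2 (hbx i)
    have hM : MemClosure W fun z j => val z (u j) * Complex.exp (x * z) := by
      refine (hPx.2 l).congr ?_
      filter_upwards [Filter.eventually_all.mpr hu] with z hz j
      rw [hz]
    -- For fixed generic `x` the row of `P` is the value at `x` of some `D` in the module, with `D`
    -- depending on `x`.
    obtain ⟨D, hD, hDu⟩ := exists_mem_of_memClosure (rightStable_rowSyms W) hp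
      (fun g => by simpa using C_mul_polySym_mem hpW fun i => C (g i))
      (fun u hu => exists_rowSyms_coeff_zero hfat hpd hu) hM
    -- Both rows have the form unit row plus a proper row, so their difference is proper. By
    -- `IsFrame.eval_eq_zero` it vanishes.
    have hprop : ∀ i, ((D - (χ.eval x)⁻¹ • h.lift (unitRow l)) i).eval (RatFunc.C x) ∈ proper := by
      intro i
      have h1 : u i - RatFunc.C (if i = l then 1 else 0) ∈ proper := by
        refine mem_proper_of_tendsto ?_
        have h2 := ((hPx.1 l i).sub_const (if i = l then 1 else 0))
        have h3 : (1 : Matrix (Fin r) (Fin r) ℂ) l i - (if i = l then 1 else 0) = 0 := by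
          rw [Matrix.one_apply, sub_eq_zero]
          simp only [eq_comm]
        rw [h3] at h2
        refine h2.congr' ?_
        filter_upwards [(Bornology.le_cofinite ℂ) (hu i), (Bornology.le_cofinite ℂ)
          (eventually_val_add (u i) (RatFunc.C (-if i = l then 1 else 0)))] with z h4 h5
        rw [h4, sub_eq_add_neg (u i), ← map_neg, h5, ← toRat_C, val_toRat, eval_C, sub_eq_add_neg]
      have h2 : (h.remainder (unitRow l) i).eval (RatFunc.C x) ∈ proper := by
        rw [← h.tail_lift_unitRow]
        refine eval_mem_proper (fun k => ?_) x
        rw [coeff_mapCoeff]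
        exact sub_polyPart_mem _
      have h3 : ((D - (χ.eval x)⁻¹ • h.lift (unitRow l)) i).eval (RatFunc.C x) =
          (u i - RatFunc.C (if i = l then 1 else 0)) -
            (χ.eval x)⁻¹ • (h.remainder (unitRow l) i).eval (RatFunc.C x) := by
        rw [Pi.sub_apply, Pi.smul_apply, h.lift_unitRow, eval_sub, eval_smul, ← hDu, eval_add,
          eval_mul, eval_cst, smul_add, ← sub_sub]
        congr 2
        have h4 : (χ.eval x)⁻¹ • RatFunc.C (χ.eval x) = 1 := by
          rw [Algebra.smul_def]
          change RatFunc.C _ * _ = _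
          rw [← map_mul, inv_mul_cancel₀ hχ, map_one]
        split_ifs
        · rw [eval_one, mul_one, h4, map_one]
        · rw [eval_zero, mul_zero, smul_zero, map_zero]
      rw [h3]
      exact proper.sub_mem h1 (proper.smul_mem _ h2)
    have hz := h.eval_eq_zero hχ
      ((rowSyms W).sub_mem hD ((rowSyms W).smul_mem _ (h.lift_mem (unitRow l)))) hprop i
    rw [Pi.sub_apply, Pi.smul_apply, eval_sub, eval_smul, ← hDu, sub_eq_zero] at hz
    have h4 := congrArg (eval (RatFunc.C x)) hd
    rw [eval_mul, eval_C, eval_polySym] at h4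
    have h5 : (cstP χ).eval (C x) = C (χ.eval x) := by
      rw [coe_mapRingHom, eval_map]
      exact eval₂_hom _ _
    rw [eval_sub, eval_mul, eval_mul, eval_mul, h5, eval_C, sub_eq_zero]
    refine toRat_injective ?_
    rw [map_mul, map_mul, map_mul, ← h4, toRat_C]
    have h6 : toRat ((a i).eval (C x)) = toRat ((b i).eval (C x)) * u i :=
      (mul_div_cancel₀ _ (toRat_ne_zero (hbx i))).symm
    have h7 : RatFunc.C (χ.eval x) * u i = (h.lift (unitRow l) i).eval (RatFunc.C x) := by
      rw [hz, Algebra.smul_def]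
      change _ * (RatFunc.C _ * _) = _
      rw [← mul_assoc, ← map_mul, mul_inv_cancel₀ hχ, map_one, one_mul]
    rw [h6, ← h7]
    ring
  -- A polynomial identity that holds for all but finitely many `x`.
  have hpoly : C s * cstP χ * a i - b i * d = 0 := by
    by_contra hne
    have h1 := hev.and (eventually_eval_C_ne_zero hne)
    obtain ⟨x, hx⟩ := h1.exists
    exact hx.2 hx.1
  have h1 := congrArg (fun e => iota (polySym e)) (sub_eq_zero.mp hpoly)
  simp only [map_mul, polySym_cstP, iota_cst] at h1
  have hs1 : polySym (C s) = C (toRat s) := by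
    rw [coe_mapRingHom, map_C]
    rfl
  have hs0 : iota (C (toRat s)) ≠ 0 := by
    rw [← map_zero iota]
    exact iota_injective.ne (by simpa using hs)
  have hb0 : iota (polySym (b i)) ≠ 0 := by
    rw [← map_zero iota]
    refine iota_injective.ne ?_
    rw [← map_zero polySym]
    exact (map_injective _ toRat_injective).ne (hb i)
  rw [hs1, ← hd, map_mul] at h1
  rw [hab, ← mul_right_inj' hs0, mul_div_assoc', mul_div_assoc', eq_div_iff hb0]
  linear_combination -h1

theorem IsReducedBaker.unique (hW : W ∈ grAd r) {P Q : Matrix (Fin r) (Fin r) Rat2}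
    (hP : IsReducedBaker W P) (hQ : IsReducedBaker W Q) : P = Q := by
  obtain ⟨-, χ, h⟩ := exists_isFrame hW
  have hχ0 : polyVar2 0 χ ≠ 0 :=
    fun h0 => h.monic.ne_zero (polyVar2_injective 0 (h0.trans (map_zero _).symm))
  ext l i
  exact mul_left_cancel₀ hχ0
    ((h.eq_of_isReducedBaker hW hP l i).symm.trans (h.eq_of_isReducedBaker hW hQ l i))

theorem reducedBaker_eq (hW : W ∈ grAd r) {P : Matrix (Fin r) (Fin r) Rat2}
    (hP : IsReducedBaker W P) : reducedBaker W = P := by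
  have h : ∃ P, IsReducedBaker W P := ⟨P, hP⟩
  rw [reducedBaker, dif_pos h]
  exact h.choose_spec.unique hW hP

/-- Every point of the adelic Grassmannian comes from a Calogero-Moser quadruple. -/
theorem exists_isBeta (hW : W ∈ grAd r) : ∃ (n : ℕ) (q : CMQuad n r), IsBeta q W := by
  obtain ⟨hfin, χ, h⟩ := exists_isFrame hW
  obtain ⟨n, q, hq⟩ := h.exists_quad hfin
  refine ⟨n, q, hW, isReducedBaker_of_mem_rowSyms hW.1 h.monic.ne_zero
    (fun l => h.lift_mem (unitRow l)) (fun l i k => ?_) hq⟩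
  rw [h.lift_unitRow, add_sub_cancel_left, ← h.tail_lift_unitRow, coeff_mapCoeff]
  exact sub_polyPart_mem _

end AdelicGr
end

noncomputable section
namespace AdelicGr
open Polynomial

/-! ### Constant terms of right modules of symbols -/

/-- The ring of rational functions which are regular at `l`. -/
def regularAt (l : ℂ) : Subalgebra ℂ Rat1 where
  carrier := {f | f.denom.eval l ≠ 0}
  mul_mem' {f g} hf hg := by
    obtain ⟨c, hc⟩ := RatFunc.denom_mul_dvd f g
    intro h0
    have := congrArg (eval l) hc
    rw [eval_mul, eval_mul, h0, zero_mul] at this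
    exact mul_ne_zero hf hg this
  add_mem' {f g} hf hg := by
    obtain ⟨c, hc⟩ := RatFunc.denom_add_dvd f g
    intro h0
    have := congrArg (eval l) hc
    rw [eval_mul, eval_mul, h0, zero_mul] at this
    exact mul_ne_zero hf hg this
  algebraMap_mem' a := by
    change (RatFunc.C a).denom.eval l ≠ 0
    simp

theorem toRat_div_mem_regularAt {l : ℂ} {a b : ℂ[X]} (hb : b.eval l ≠ 0) :
    toRat a / toRat b ∈ regularAt l := denom_eval_ne_zero hb

theorem toRat_mem_regularAt (l : ℂ) (a : ℂ[X]) : toRat a ∈ regularAt l := by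
  simpa using toRat_div_mem_regularAt (l := l) (a := a) (b := 1) (by simp)

theorem exists_eq_toRat_of_mem_regularAt {f : Rat1} (h : ∀ l, f ∈ regularAt l) :
    ∃ g : ℂ[X], f = toRat g := by
  have hdeg : f.denom.degree = 0 := by
    by_contra hne
    obtain ⟨l, hl⟩ := IsAlgClosed.exists_root f.denom hne
    exact h l hl
  have h1 : f.denom = 1 := by
    have hm := RatFunc.monic_denom f
    exact hm.natDegree_eq_zero.mp (natDegree_eq_of_degree_eq_some hdeg)
  refine ⟨f.num, ?_⟩
  conv_lhs => rw [← RatFunc.num_div_denom f, h1, map_one, div_one]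
  rfl

/-- Rows which vanish at `l` to order at least `N`. -/
def vanishing (r : ℕ) (l : ℂ) (N : ℕ) : Submodule ℂ (RatVec r) where
  carrier := {u | VanishesToOrder l N u}
  zero_mem' i := ⟨0, (regularAt l).zero_mem, by simp⟩
  add_mem' hu hv i := by
    obtain ⟨f, hf, hfu⟩ := hu i
    obtain ⟨g, hg, hgv⟩ := hv i
    exact ⟨f + g, (regularAt l).add_mem hf hg, by rw [Pi.add_apply, hfu, hgv, mul_add]⟩
  smul_mem' a u hu i := by
    obtain ⟨f, hf, hfu⟩ := hu i
    exact ⟨a • f, (regularAt l).smul_mem hf a, by rw [Pi.smul_apply, hfu, mul_smul_comm]⟩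

theorem mem_vanishing {r : ℕ} {l : ℂ} {N : ℕ} {u : RatVec r} :
    u ∈ vanishing r l N ↔ ∀ i, ∃ g ∈ regularAt l, u i = (RatFunc.X - RatFunc.C l) ^ N * g := Iff.rfl

theorem mem_vanishing_zero {r : ℕ} {l : ℂ} {u : RatVec r} :
    u ∈ vanishing r l 0 ↔ ∀ i, u i ∈ regularAt l := by
  simp [mem_vanishing]

theorem vanishing_le_zero {r : ℕ} {l : ℂ} {N : ℕ} : vanishing r l N ≤ vanishing r l 0 := by
  intro u hu
  refine mem_vanishing_zero.mpr fun i => ?_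
  obtain ⟨g, hg, h⟩ := mem_vanishing.mp hu i
  rw [h, ← toRat_X_sub_C]
  exact (regularAt l).mul_mem ((regularAt l).pow_mem (toRat_mem_regularAt l _) N) hg

/-- The quotient by `p` is regular at every point: at a root of `p` the vanishing order `deg p`
exceeds or equals the multiplicity. -/
theorem exists_eq_toRat_mul_of_vanishing {r : ℕ} {p : ℂ[X]} (hp : p ≠ 0) {u : RatVec r}
    (h1 : ∀ l, p.eval l = 0 → u ∈ vanishing r l p.natDegree)
    (h2 : ∀ l, p.eval l ≠ 0 → u ∈ vanishing r l 0) (i : Fin r) :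
    ∃ g : ℂ[X], u i = toRat p * toRat g := by
  suffices h : ∀ l, u i / toRat p ∈ regularAt l by
    obtain ⟨g, hg⟩ := exists_eq_toRat_of_mem_regularAt h
    exact ⟨g, by rw [← hg, mul_div_cancel₀ _ (toRat_ne_zero hp)]⟩
  intro l
  by_cases hl : p.eval l = 0
  · obtain ⟨f, hf, hfu⟩ := mem_vanishing.mp (h1 l hl) i
    obtain ⟨q, hq, hroot⟩ := exists_eq_pow_rootMultiplicity_mul_and_not_dvd p hp l
    have hm : rootMultiplicity l p ≤ p.natDegree := by
      have := natDegree_le_of_dvd (pow_rootMultiplicity_dvd p l) hp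
      rwa [natDegree_pow, natDegree_X_sub_C, mul_one] at this
    generalize rootMultiplicity l p = m at *
    have hql : q.eval l ≠ 0 := fun h => hroot (dvd_iff_isRoot.mpr h)
    have hq0 : q ≠ 0 := by rintro rfl; simp at hql
    have h3 : u i / toRat p = toRat ((X - C l) ^ (p.natDegree - m)) / toRat q * f := by
      rw [hfu, div_eq_iff (toRat_ne_zero hp), div_mul_eq_mul_div, div_mul_eq_mul_div,
        eq_div_iff (toRat_ne_zero hq0), ← toRat_X_sub_C]
      obtain ⟨k, hk⟩ := Nat.exists_eq_add_of_le hm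
      rw [hk, Nat.add_sub_cancel_left]
      conv_rhs => rw [hq]
      simp only [map_mul, map_pow]
      ring
    rw [h3]
    exact (regularAt l).mul_mem (toRat_div_mem_regularAt hql) hf
  · rw [div_eq_mul_inv, inv_eq_one_div, ← map_one toRat]
    exact (regularAt l).mul_mem (mem_vanishing_zero.mp (h2 l hl) i) (toRat_div_mem_regularAt hl)

/-- Of the vanishing order of `f`, at most `n` is spent on derivatives and `deg p` on the poles of
the coefficients. -/
theorem app_mem_vanishing {r : ℕ} {p f : ℂ[X]} (hp : p ≠ 0) {c : Fin r → Sym} (hc : IsDenom p c)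
    {n : ℕ} (hn : ∀ i, (c i).natDegree < n) {l : ℂ} {N : ℕ}
    (hf : (X - C l) ^ (N + p.natDegree + n) ∣ f) :
    (fun i => app 0 f (c i)) ∈ vanishing r l N := by
  refine mem_vanishing.mpr fun i => ?_
  choose b hb using hc i
  have hdvd : ∀ k < n, (X - C l) ^ (N + p.natDegree) ∣ (delta 0 ^ k) f := fun k hk =>
    (pow_dvd_pow _ (by omega)).trans (pow_dvd_delta_zero hf k)
  choose! g hg using hdvd
  have h1 : toRat p * app 0 f (c i) =
      toRat ((X - C l) ^ (N + p.natDegree) * ∑ k ∈ Finset.range n, b k * g k) := by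
    have h0 : app 0 f (c i) =
        ∑ k ∈ Finset.range n, (c i).coeff k * toRat ((delta 0 ^ k) f) := by
      rw [app_apply, sum_def]
      refine Finset.sum_subset
        (fun k hk => Finset.mem_range.mpr ((le_natDegree_of_mem_supp k hk).trans_lt (hn i)))
        fun k _ hk => ?_
      rw [notMem_support_iff.mp hk, zero_mul]
    rw [h0, Finset.mul_sum, Finset.mul_sum, map_sum]
    refine Finset.sum_congr rfl fun k hk => ?_
    rw [← mul_assoc, hb, ← map_mul, hg k (Finset.mem_range.mp hk), mul_left_comm]
  obtain ⟨h, hh, hfh⟩ := exists_eq_pow_mul hp h1 dvd_rfl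
  exact ⟨h, hh, hfh⟩

/-- The coefficients of `∂^0` of the elements of a space of symbols. -/
def constTerms {r : ℕ} (M : Submodule ℂ (Fin r → Sym)) : Submodule ℂ (RatVec r) :=
  M.map (LinearMap.pi fun i => ((lcoeff Rat1 0).restrictScalars ℂ).comp (LinearMap.proj i))

theorem mem_constTerms {r : ℕ} {M : Submodule ℂ (Fin r → Sym)} {u : RatVec r} :
    u ∈ constTerms M ↔ ∃ D ∈ M, ∀ i, (D i).coeff 0 = u i :=
  exists_congr fun _ => and_congr_right fun _ => funext_iff

/-- `D.f` is the constant term of `D ∘ f`, which lies in `M`. -/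
theorem RightStable.le_rowSyms {r : ℕ} {M : Submodule ℂ (Fin r → Sym)} (hM : RightStable M) :
    M ≤ rowSyms (constTerms M) := fun c hc f =>
  mem_constTerms.mpr ⟨_, hM.aeval_zop f hc, fun i => by rw [← app_zero_one, app_aeval_zop, mul_one]⟩

/-- The constant terms of a right module of operators with a common denominator are a primary
decomposable space. -/
theorem RightStable.isPrimaryDecomposable {r : ℕ} {M : Submodule ℂ (Fin r → Sym)}
    (hM : RightStable M) {p : ℂ[X]} (hp : p ≠ 0) (hden : ∀ D ∈ M, IsDenom p D)
    (hpM : ContainsMultiples p (constTerms M)) : IsPrimaryDecomposable (constTerms M) := by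
  refine ⟨fun l => constTerms M ⊔ vanishing r l p.natDegree,
    fun l => ⟨p.natDegree, fun u hu => Submodule.mem_sup_right hu⟩, le_antisymm
      (le_iInf fun l => le_sup_left) fun u hu => ?_⟩
  have hreg : ∀ l, p.eval l ≠ 0 → constTerms M ≤ vanishing r l 0 := by
    intro l hl w hw
    obtain ⟨D, hD, hDw⟩ := mem_constTerms.mp hw
    refine mem_vanishing_zero.mpr fun i => ?_
    obtain ⟨b, hb⟩ := hden D hD i 0
    rw [← hDw, ← mul_div_cancel_left₀ ((D i).coeff 0) (toRat_ne_zero hp), hb]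
    exact toRat_div_mem_regularAt hl
  have hsplit : ∀ l, ∃ D ∈ M, u - (fun i => (D i).coeff 0) ∈ vanishing r l p.natDegree := by
    intro l
    obtain ⟨w, hw, v, hv, hwv⟩ := Submodule.mem_sup.mp (Submodule.mem_iInf _ |>.mp hu l)
    obtain ⟨D, hD, hDw⟩ := mem_constTerms.mp hw
    refine ⟨D, hD, ?_⟩
    rwa [show (fun i => (D i).coeff 0) = w from funext hDw, ← hwv, add_sub_cancel_left]
  choose D hD hDu using hsplit
  choose n hn using fun l => exists_degree_bound (D l)
  let s : Finset ℂ := p.roots.toFinset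
  have hs : ∀ l, l ∈ s ↔ p.eval l = 0 := fun l => by simp [s, hp]
  -- Partition of unity: `h l` is close to `1` at `l` and to `0` at the other roots of `p`. The row
  -- `∑ D_l.(h_l)` then agrees with `u` to high order at every root. The exponent adds the order
  -- required, the poles and the derivatives.
  choose h hh using fun l => exists_forall_pow_dvd_sub s (p.natDegree + p.natDegree + s.sup n)
    fun m => if m = l then 1 else 0
  have hw : ∀ l, (fun i => app 0 (h l) (D l i)) ∈ constTerms M := fun l => hM.le_rowSyms (hD l) (h l)
  have hsum := (constTerms M).sum_mem (t := s) fun l _ => hw l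
  have hvan : ∀ l ∈ s, ∀ f, (X - C l) ^ (p.natDegree + p.natDegree + s.sup n) ∣ f → ∀ m ∈ s,
      (fun i => app 0 f (D m i)) ∈ vanishing r l p.natDegree := fun l _ f hf m hm =>
    app_mem_vanishing hp (hden _ (hD m)) (hn m)
      ((pow_dvd_pow _ (Nat.add_le_add_left (Finset.le_sup hm) _)).trans hf)
  -- The difference vanishes to order `deg p` at the roots of `p` and is regular elsewhere, so it
  -- lies in `p ℂ[z]^r`.
  have hrest : ∀ i, ∃ g : ℂ[X], (u - ∑ l ∈ s, fun i => app 0 (h l) (D l i)) i = toRat p * toRat g := by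
    refine exists_eq_toRat_mul_of_vanishing hp (fun l hl => ?_) fun l hl => ?_
    · rw [← hs] at hl
      have h1 : u - ∑ m ∈ s, (fun i => app 0 (h m) (D m i)) =
          (u - fun i => (D l i).coeff 0) - ((fun i => app 0 (h l - 1) (D l i)) +
            ∑ m ∈ s.erase l, fun i => app 0 (h m) (D m i)) := by
        rw [← Finset.add_sum_erase _ _ hl]
        have h2 : (fun i => app 0 (h l) (D l i)) =
            (fun i => app 0 (h l - 1) (D l i)) + fun i => (D l i).coeff 0 := by
          funext i
          rw [Pi.add_apply, ← app_zero_one, ← app_add_left, sub_add_cancel]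
        rw [h2]
        abel
      rw [h1]
      refine sub_mem (hDu l) (add_mem (hvan l hl _ ?_ l hl) (sum_mem fun m hm => ?_))
      · simpa using hh l l hl
      · refine hvan l hl _ ?_ m (Finset.mem_of_mem_erase hm)
        simpa [(Finset.ne_of_mem_erase hm).symm] using hh m l hl
    · refine sub_mem ?_ (hreg l hl hsum)
      rw [← sub_add_cancel u fun i => (D l i).coeff 0]
      exact add_mem (vanishing_le_zero (hDu l))
        (hreg l hl (mem_constTerms.mpr ⟨D l, hD l, fun _ => rfl⟩))
  choose g hg using hrest
  rw [← sub_add_cancel u (∑ l ∈ s, fun i => app 0 (h l) (D l i)), funext hg]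
  exact add_mem (toRat_mul_mem hpM g) hsum

end AdelicGr
end

noncomputable section
namespace AdelicGr
open Polynomial Matrix

/-! ### The module of operators attached to a quadruple -/

/-- Solving `c (X + N) = e` lowers the degree by at least one: above the degree of `e` the top
coefficient of `c` has nothing to cancel against. This supplies the degree bounds for rows
multiplied by adjugates of characteristic matrices. -/
theorem coeff_eq_zero_of_X_mul_add {n : ℕ} {c e : Fin n → ℂ[X]} (N : Matrix (Fin n) (Fin n) ℂ)
    (h : ∀ k, X * c k + ∑ l, C (N l k) * c l = e k) {m : ℕ}
    (he : ∀ k j, m < j → (e k).coeff j = 0) (k : Fin n) (j : ℕ) (hj : m ≤ j) :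
    (c k).coeff j = 0 := by
  have hdesc : ∀ t, (∀ k j, m + t ≤ j → (c k).coeff j = 0) → ∀ k j, m ≤ j → (c k).coeff j = 0 := by
    intro t
    induction t with
    | zero => exact fun h => h
    | succ t ih =>
      intro ht
      refine ih fun k j hj => ?_
      have h1 := congrArg (fun p => coeff p (j + 1)) (h k)
      simp only [coeff_add, coeff_X_mul, finsetSum_coeff, coeff_C_mul] at h1
      rw [he k _ (by omega), Finset.sum_eq_zero, add_zero] at h1
      · exact h1
      · intro l _
        rw [ht l _ (by omega), mul_zero]
  exact hdesc (Finset.univ.sup fun k => (c k).natDegree + 1) (fun k j hj =>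
    coeff_eq_zero_of_natDegree_lt (lt_of_lt_of_le (Nat.lt_succ_self _)
      ((Finset.le_sup (f := fun k => (c k).natDegree + 1) (Finset.mem_univ k)).trans (by omega)))) k j hj

/-- Constant matrices, in a `ℂ`-algebra. -/
abbrev constMap (A : Type) [CommRing A] [Algebra ℂ A] {m n : ℕ} (M : Matrix (Fin m) (Fin n) ℂ) :
    Matrix (Fin m) (Fin n) A := M.map (algebraMap ℂ A)

variable {n r : ℕ} (q : CMQuad n r)

/-- `(z - Y)⁻¹ v`. -/
def quadRes : Matrix (Fin n) (Fin r) Rat1 :=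
  ((RatFunc.X : Rat1) • 1 - constMap Rat1 q.Y)⁻¹ * constMap Rat1 q.v

theorem charmatrix_map_toRat (Y : Matrix (Fin n) (Fin n) ℂ) :
    Y.charmatrix.map toRat = (RatFunc.X : Rat1) • 1 - constMap Rat1 Y := by
  ext k l
  by_cases hkl : k = l
  · subst hkl
    rw [Matrix.map_apply, charmatrix_apply_eq, map_sub, toRat_X, toRat_C, Matrix.sub_apply, Matrix.smul_apply,
      Matrix.one_apply_eq, smul_eq_mul, mul_one]
    rfl
  · rw [Matrix.map_apply, charmatrix_apply_ne _ _ _ hkl, map_neg, toRat_C, Matrix.sub_apply, Matrix.smul_apply,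
      Matrix.one_apply_ne hkl, smul_zero, zero_sub]
    rfl

theorem det_X_sub (Y : Matrix (Fin n) (Fin n) ℂ) :
    ((RatFunc.X : Rat1) • (1 : Matrix (Fin n) (Fin n) Rat1) - constMap Rat1 Y).det = toRat Y.charpoly := by
  rw [← charmatrix_map_toRat, charpoly]
  exact (RingHom.map_det (toRat : ℂ[X] →+* Rat1) _).symm

theorem isUnit_det_X_sub (Y : Matrix (Fin n) (Fin n) ℂ) :
    IsUnit ((RatFunc.X : Rat1) • (1 : Matrix (Fin n) (Fin n) Rat1) - constMap Rat1 Y).det := by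
  rw [det_X_sub]
  exact (toRat_ne_zero Y.charpoly_monic.ne_zero).isUnit

theorem X_smul_quadRes :
    (RatFunc.X : Rat1) • quadRes q = constMap Rat1 q.Y * quadRes q + constMap Rat1 q.v := by
  have h : ((RatFunc.X : Rat1) • 1 - constMap Rat1 q.Y) * quadRes q = constMap Rat1 q.v :=
    mul_nonsing_inv_cancel_left _ _ (isUnit_det_X_sub q.Y)
  rw [Matrix.sub_mul, smul_mul, Matrix.one_mul] at h
  rw [← h]
  abel

/-- The numerator is the adjugate of `z - Y` times `v`. Its degree bound comes from
`coeff_eq_zero_of_X_mul_add`. -/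
theorem exists_charpoly_mul_quadRes (k : Fin n) (i : Fin r) :
    ∃ b : ℂ[X], toRat q.Y.charpoly * quadRes q k i = toRat b ∧ b.degree < q.Y.charpoly.degree := by
  let b : Matrix (Fin n) (Fin r) ℂ[X] := q.Y.charmatrix.adjugate * q.v.map C
  have h1 : toRat q.Y.charpoly • quadRes q = b.map toRat := by
    have h2 : b.map toRat = ((RatFunc.X : Rat1) • 1 - constMap Rat1 q.Y).adjugate * constMap Rat1 q.v := by
      have h3 : b.map toRat = q.Y.charmatrix.adjugate.map toRat * (q.v.map C).map toRat :=
        Matrix.map_mul (f := (toRat : ℂ[X] →+* Rat1))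
      have h4 : q.Y.charmatrix.adjugate.map toRat = (q.Y.charmatrix.map toRat).adjugate :=
        RingHom.map_adjugate (toRat : ℂ[X] →+* Rat1) _
      rw [h3, h4, charmatrix_map_toRat, Matrix.map_map]
      congr 2
    rw [h2, quadRes, Matrix.inv_def, det_X_sub, smul_mul, smul_smul,
      Ring.mul_inverse_cancel _ (toRat_ne_zero q.Y.charpoly_monic.ne_zero).isUnit, one_smul]
  have h2 : ∀ k i, X * b k i + ∑ l, C ((-q.Y)ᵀ l k) * b l i = q.Y.charpoly * C (q.v k i) := by
    intro k i
    have h3 : q.Y.charmatrix * b = q.Y.charpoly • q.v.map C := by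
      rw [← Matrix.mul_assoc, mul_adjugate, smul_mul, Matrix.one_mul]
      rfl
    have h4 := congrFun (congrFun h3 k) i
    rw [charmatrix, Matrix.sub_mul, Matrix.sub_apply, scalar_apply, diagonal_mul, Matrix.mul_apply] at h4
    simp only [Matrix.smul_apply, Matrix.map_apply, smul_eq_mul, RingHom.mapMatrix_apply] at h4
    rw [← h4, sub_eq_add_neg, ← Finset.sum_neg_distrib]
    congr 1
    refine Finset.sum_congr rfl fun l _ => ?_
    rw [Matrix.transpose_apply, Matrix.neg_apply, map_neg, neg_mul]
  refine ⟨b k i, congrFun (congrFun h1 k) i, ?_⟩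
  rw [degree_eq_natDegree q.Y.charpoly_monic.ne_zero, degree_lt_iff_coeff_zero]
  refine coeff_eq_zero_of_X_mul_add (c := fun k => b k i) (-q.Y)ᵀ (fun k => h2 k i)
    (fun k j hj => ?_) k
  rw [coeff_mul_C, coeff_eq_zero_of_natDegree_lt hj, zero_mul]

theorem quadRes_mem_proper (k : Fin n) (i : Fin r) : quadRes q k i ∈ proper := by
  obtain ⟨b, hb, hdeg⟩ := exists_charpoly_mul_quadRes q k i
  refine ⟨b, q.Y.charpoly, hdeg, ?_⟩
  rw [← hb, mul_div_cancel_left₀ _ (toRat_ne_zero q.Y.charpoly_monic.ne_zero)]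

/-- The rows with polynomial part `d` and tail `c (z - Y)⁻¹ v`. -/
def quadRow (d : Fin r → ℂ[X][X]) (c : Fin n → ℂ[X]) (i : Fin r) : Sym :=
  polySym (d i) + ((fun k => cst (c k)) ᵥ* (quadRes q).map C) i

/-- `d w = c (x + X) + g (z - Y)`. -/
def QuadRel (d : Fin r → ℂ[X][X]) (c : Fin n → ℂ[X]) (g : Fin n → ℂ[X][X]) : Prop :=
  d ᵥ* constMap ℂ[X][X] q.w = (X : ℂ[X][X]) • (fun k => cstP (c k)) +
    (fun k => cstP (c k)) ᵥ* constMap ℂ[X][X] q.X + (C X : ℂ[X][X]) • g - g ᵥ* constMap ℂ[X][X] q.Y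

theorem QuadRel.cst_mul {d : Fin r → ℂ[X][X]} {c : Fin n → ℂ[X]} {g : Fin n → ℂ[X][X]}
    (h : QuadRel q d c g) (f : ℂ[X]) :
    QuadRel q (cstP f • d) (f • c) (cstP f • g) := by
  have h1 : (fun k => cstP ((f • c) k)) = cstP f • fun k => cstP (c k) := by
    funext k
    simp
  rw [QuadRel] at h ⊢
  rw [h1, smul_vecMul, smul_vecMul, smul_vecMul, h]
  module

theorem quadRow_cst_mul (d : Fin r → ℂ[X][X]) (c : Fin n → ℂ[X]) (f : ℂ[X]) :
    quadRow q (cstP f • d) (f • c) = fun i => cst f * quadRow q d c i := by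
  have h1 : (fun k => cst ((f • c) k)) = cst f • fun k => cst (c k) := by
    funext k
    simp
  funext i
  rw [quadRow, quadRow, h1, smul_vecMul, Pi.smul_apply, Pi.smul_apply, smul_eq_mul, smul_eq_mul,
    map_mul, polySym_cstP, mul_add]

/-- The space of operators attached to a quadruple. -/
def quadMod : Submodule ℂ (Fin r → Sym) where
  carrier := {D | ∃ d c g, QuadRel q d c g ∧ D = quadRow q d c}
  zero_mem' := by
    refine ⟨0, 0, 0, ?_, ?_⟩
    · have h1 : (fun k => cstP ((0 : Fin n → ℂ[X]) k)) = 0 := by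
        funext k
        simp
      rw [QuadRel, h1]
      simp
    · have h1 : (fun k => cst ((0 : Fin n → ℂ[X]) k)) = 0 := by
        funext k
        simp
      funext i
      rw [quadRow, h1]
      simp
  add_mem' := by
    rintro _ _ ⟨d, c, g, h, rfl⟩ ⟨d', c', g', h', rfl⟩
    refine ⟨d + d', c + c', g + g', ?_, ?_⟩
    · have h1 : (fun k => cstP ((c + c') k)) = (fun k => cstP (c k)) + fun k => cstP (c' k) := by
        funext k
        simp
      rw [QuadRel] at h h' ⊢
      rw [h1, add_vecMul, add_vecMul, add_vecMul, h, h']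
      module
    · have h1 : (fun k => cst ((c + c') k)) = (fun k => cst (c k)) + fun k => cst (c' k) := by
        funext k
        simp
      funext i
      rw [Pi.add_apply, quadRow, quadRow, quadRow, h1, add_vecMul, Pi.add_apply,
        Pi.add_apply, map_add]
      ring
  smul_mem' := by
    rintro a _ ⟨d, c, g, h, rfl⟩
    refine ⟨_, _, _, h.cst_mul q (C a), ?_⟩
    rw [quadRow_cst_mul]
    funext i
    simp [Algebra.smul_def, Polynomial.algebraMap_apply]

theorem derivative_vecMul {m n : ℕ} {A : Type} [CommRing A] [Algebra ℂ A] (u : Fin m → A[X])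
    (M : Matrix (Fin m) (Fin n) ℂ) : (fun i => derivative ((u ᵥ* constMap A[X] M) i)) =
      (fun i => derivative (u i)) ᵥ* constMap A[X] M := by
  funext i
  simp only [vecMul, dotProduct, Matrix.map_apply, map_sum, derivative_mul, Polynomial.algebraMap_apply,
    derivative_C, mul_zero, add_zero]

/-- Differentiating the relation in `x` produces an extra summand `c`. The moment equation `v w = Y
X - X Y - 1` cancels it, and `g` gains `c (x + X)`. This is where the moment equation enters. -/
theorem QuadRel.zop_rel {d : Fin r → ℂ[X][X]} {c : Fin n → ℂ[X]} {g : Fin n → ℂ[X][X]}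
    (h : QuadRel q d c g) :
    QuadRel q ((C X : ℂ[X][X]) • d + (fun i => derivative (d i)) +
        (fun k => cstP (c k)) ᵥ* constMap ℂ[X][X] q.v)
      (c ᵥ* constMap ℂ[X] q.Y + fun k => derivative (c k))
      ((C X : ℂ[X][X]) • g + (fun k => derivative (g k)) + (X : ℂ[X][X]) • (fun k => cstP (c k)) +
        (fun k => cstP (c k)) ᵥ* constMap ℂ[X][X] q.X) := by
  rw [QuadRel] at h ⊢
  have h1 : (fun k => cstP ((c ᵥ* constMap ℂ[X] q.Y + fun k => derivative (c k)) k)) =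
      (fun k => cstP (c k)) ᵥ* constMap ℂ[X][X] q.Y + fun k => derivative (cstP (c k)) := by
    funext k
    rw [Pi.add_apply, map_add, RingHom.map_vecMul, Matrix.map_map, Pi.add_apply, coe_mapRingHom,
      derivative_map]
    congr 3
    ext a
    simp [Polynomial.algebraMap_apply]
  have hd := congrArg (fun u : Fin n → ℂ[X][X] => fun k => derivative (u k)) h
  simp only [Pi.sub_apply, Pi.add_apply, Pi.smul_apply, derivative_add, derivative_sub, smul_eq_mul,
    derivative_mul, derivative_X, derivative_C, zero_mul, one_mul, zero_add] at hd
  have hv := fun m (u : Fin m → ℂ[X][X]) (M : Matrix (Fin m) (Fin n) ℂ) k =>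
    congrFun (derivative_vecMul u M) k
  simp only [hv] at hd
  have hd' : (fun i => derivative (d i)) ᵥ* constMap ℂ[X][X] q.w =
      (fun k => cstP (c k)) + (X : ℂ[X][X]) • (fun k => derivative (cstP (c k))) +
      (fun k => derivative (cstP (c k))) ᵥ* constMap ℂ[X][X] q.X +
      (C X : ℂ[X][X]) • (fun k => derivative (g k)) -
      (fun k => derivative (g k)) ᵥ* constMap ℂ[X][X] q.Y := hd
  have hmom : constMap ℂ[X][X] q.v * constMap ℂ[X][X] q.w =
      constMap ℂ[X][X] q.Y * constMap ℂ[X][X] q.X - constMap ℂ[X][X] q.X * constMap ℂ[X][X] q.Y -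
        1 := by
    have h2 : q.v * q.w = q.Y * q.X - q.X * q.Y - 1 := by
      rw [sub_sub, eq_sub_iff_add_eq', ← sub_eq_zero]
      have := sub_eq_zero.mpr q.moment
      rw [← this]
      abel
    have h3 := congrArg (fun M => (algebraMap ℂ ℂ[X][X]).mapMatrix M) h2
    rw [map_sub, map_sub, map_mul, map_mul, map_one] at h3
    exact Matrix.map_mul.symm.trans h3
  rw [h1, add_vecMul, add_vecMul, add_vecMul, add_vecMul, add_vecMul, add_vecMul, smul_vecMul,
    smul_vecMul, smul_vecMul, vecMul_vecMul, vecMul_vecMul, vecMul_vecMul, hmom, h, hd', vecMul_sub,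
    vecMul_sub, vecMul_one]
  module

/-- From `z (z - Y)⁻¹ v = Y (z - Y)⁻¹ v + v`: the first summand stays in the tail and the second
joins the polynomial part. -/
theorem quadRow_zop (d : Fin r → ℂ[X][X]) (c : Fin n → ℂ[X]) :
    (fun i => zop (quadRow q d c i)) =
      quadRow q ((C X : ℂ[X][X]) • d + (fun i => derivative (d i)) +
        (fun k => cstP (c k)) ᵥ* constMap ℂ[X][X] q.v)
      (c ᵥ* constMap ℂ[X] q.Y + fun k => derivative (c k)) := by
  have h1 : (fun k => cst ((c ᵥ* constMap ℂ[X] q.Y + fun k => derivative (c k)) k)) =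
      (fun k => cst (c k)) ᵥ* constMap Sym q.Y + fun k => derivative (cst (c k)) := by
    funext k
    rw [Pi.add_apply, map_add, RingHom.map_vecMul, Matrix.map_map, Pi.add_apply, coe_mapRingHom,
      derivative_map]
    congr 3
    ext a
    simp [Polynomial.algebraMap_apply]
  have h2 : (C RatFunc.X : Sym) • (quadRes q).map C = constMap Sym q.Y * (quadRes q).map C + constMap Sym q.v := by
    have h3 := congrArg (fun M => M.map (C : Rat1 →+* Sym)) (X_smul_quadRes q)
    rw [Matrix.map_add _ (map_add _), Matrix.map_mul, Matrix.map_map, Matrix.map_map] at h3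
    refine Eq.trans ?_ h3
    ext1 k i
    simp
  have h3 : ∀ i, derivative (((fun k => cst (c k)) ᵥ* (quadRes q).map C) i) =
      ((fun k => derivative (cst (c k))) ᵥ* (quadRes q).map C) i := by
    intro i
    simp only [vecMul, dotProduct, Matrix.map_apply, map_sum, derivative_mul, derivative_C, mul_zero,
      add_zero]
  have h4 : ∀ i, polySym (((fun k => cstP (c k)) ᵥ* constMap ℂ[X][X] q.v) i) =
      ((fun k => cst (c k)) ᵥ* constMap Sym q.v) i := by
    intro i
    rw [RingHom.map_vecMul, Matrix.map_map]
    have h5 : polySym ∘ (fun k => cstP (c k)) = fun k => cst (c k) := funext fun k => polySym_cstP _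
    have h6 : ⇑polySym ∘ ⇑(algebraMap ℂ ℂ[X][X]) = algebraMap ℂ Sym := by
      funext a
      simp [Polynomial.algebraMap_apply]
    rw [h5, h6]
  have h5 := congrArg (fun M => (fun k => cst (c k)) ᵥ* M) h2
  simp only [vecMul_smul, vecMul_add] at h5
  funext i
  have h6 := congrFun h5 i
  rw [Pi.smul_apply, smul_eq_mul, Pi.add_apply] at h6
  rw [quadRow, quadRow, h1, add_vecMul, vecMul_vecMul, zop_apply, mul_add, derivative_add, h3,
    h6, Pi.add_apply, Pi.add_apply, Pi.add_apply, map_add, map_add, h4, Pi.smul_apply, smul_eq_mul,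
    map_mul]
  have h7 : derivative (polySym (d i)) = polySym (derivative (d i)) := by
    rw [coe_mapRingHom, derivative_map]
  have h8 : polySym (C X) = C RatFunc.X := by
    rw [coe_mapRingHom, map_C]
    exact congrArg C toRat_X
  rw [h7, h8]
  ring

theorem rightStable_quadMod : RightStable (quadMod q) where
  X_mul := by
    rintro _ ⟨d, c, g, h, rfl⟩
    refine ⟨_, _, _, h.cst_mul q X, ?_⟩
    rw [quadRow_cst_mul]
    simp
  zop_mem := by
    rintro _ ⟨d, c, g, h, rfl⟩
    exact ⟨_, _, _, h.zop_rel q, quadRow_zop q d c⟩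

end AdelicGr
end

noncomputable section
namespace AdelicGr
open Polynomial Matrix

/-! ### The point of the adelic Grassmannian attached to a quadruple -/

theorem coeff_cst (g : ℂ[X]) (j : ℕ) : (cst g).coeff j = algebraMap ℂ Rat1 (g.coeff j) := by
  rw [coe_mapRingHom, coeff_map]

theorem eval_cstP (g : ℂ[X]) (x : ℂ) : (cstP g).eval (C x) = C (g.eval x) := by
  rw [coe_mapRingHom, eval_map]
  exact eval₂_hom _ _

section
variable {n r : ℕ} (q : CMQuad n r)

theorem coeff_quadRow (d : Fin r → ℂ[X][X]) (c : Fin n → ℂ[X]) (i : Fin r) (j : ℕ) :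
    (quadRow q d c i).coeff j = toRat ((d i).coeff j) + ∑ k, (c k).coeff j • quadRes q k i := by
  rw [quadRow, coeff_add, coe_mapRingHom, coeff_map, vecMul, dotProduct, finsetSum_coeff]
  congr 1
  refine Finset.sum_congr rfl fun k _ => ?_
  rw [Matrix.map_apply, coeff_mul_C, coeff_cst, Algebra.smul_def]

theorem eval_quadRow (d : Fin r → ℂ[X][X]) (c : Fin n → ℂ[X]) (i : Fin r) (x : ℂ) :
    (quadRow q d c i).eval (RatFunc.C x) =
      toRat ((d i).eval (C x)) + ∑ k, (c k).eval x • quadRes q k i := by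
  rw [quadRow, eval_add, eval_polySym, vecMul, dotProduct, eval_finsetSum]
  congr 1
  refine Finset.sum_congr rfl fun k _ => ?_
  rw [Matrix.map_apply, eval_mul, eval_C, eval_cst, Algebra.smul_def]
  rfl

theorem isDenom_of_mem_quadMod {D : Fin r → Sym} (hD : D ∈ quadMod q) : IsDenom q.Y.charpoly D := by
  obtain ⟨d, c, g, -, rfl⟩ := hD
  intro i j
  choose b hb hbdeg using fun k => exists_charpoly_mul_quadRes q k i
  refine ⟨q.Y.charpoly * (d i).coeff j + ∑ k, (c k).coeff j • b k, ?_⟩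
  rw [coeff_quadRow, mul_add, map_add, map_mul, Finset.mul_sum, map_sum]
  congr 1
  refine Finset.sum_congr rfl fun k _ => ?_
  rw [mul_smul_comm, hb, map_smul]

theorem charmatrix_map_C (Y : Matrix (Fin n) (Fin n) ℂ) :
    Y.charmatrix.map (C : ℂ[X] →+* ℂ[X][X]) = (C X : ℂ[X][X]) • 1 - constMap ℂ[X][X] Y := by
  ext1 k l
  by_cases hkl : k = l
  · subst hkl
    rw [Matrix.map_apply, charmatrix_apply_eq, map_sub, Matrix.sub_apply, Matrix.smul_apply,
      Matrix.one_apply_eq, smul_eq_mul, mul_one]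
    rfl
  · rw [Matrix.map_apply, charmatrix_apply_ne _ _ _ hkl, map_neg, Matrix.sub_apply,
      Matrix.smul_apply, Matrix.one_apply_ne hkl, smul_zero, zero_sub]
    rfl

/-- The relation is satisfied with `c = 0`, because the adjugate of `z - Y` divides the
characteristic polynomial by `z - Y`. -/
theorem C_charpoly_mul_mem_quadMod (d : Fin r → ℂ[X][X]) :
    (fun i => C (toRat q.Y.charpoly) * polySym (d i)) ∈ quadMod q := by
  let B : Matrix (Fin n) (Fin n) ℂ[X][X] := (C X : ℂ[X][X]) • 1 - constMap ℂ[X][X] q.Y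
  have hdet : B.det = C q.Y.charpoly := by
    rw [charpoly, RingHom.map_det]
    exact congrArg det (charmatrix_map_C q.Y).symm
  have h0 : (fun k => cstP ((0 : Fin n → ℂ[X]) k)) = 0 := by
    funext k
    simp
  have h0' : (fun k => cst ((0 : Fin n → ℂ[X]) k)) = 0 := by
    funext k
    simp
  refine ⟨(C q.Y.charpoly : ℂ[X][X]) • d, 0, (d ᵥ* constMap ℂ[X][X] q.w) ᵥ* B.adjugate, ?_, ?_⟩
  · have h1 : ((d ᵥ* constMap ℂ[X][X] q.w) ᵥ* B.adjugate) ᵥ* B =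
        (C q.Y.charpoly : ℂ[X][X]) • (d ᵥ* constMap ℂ[X][X] q.w) := by
      rw [vecMul_vecMul, adjugate_mul, hdet, vecMul_smul, vecMul_one]
    rw [vecMul_sub, vecMul_smul, vecMul_one] at h1
    rw [QuadRel, h0, smul_zero, zero_vecMul, zero_add, zero_add, h1, smul_vecMul]
  · funext i
    rw [quadRow, h0', zero_vecMul, Pi.zero_apply, add_zero, Pi.smul_apply, smul_eq_mul, map_mul]
    congr 1
    rw [coe_mapRingHom, map_C]
    rfl

/-- The space `W` with `W = β(X, Y; v, w)`. -/
def quadSpace : Submodule ℂ (RatVec r) := constTerms (quadMod q)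

theorem containsMultiples_quadSpace : ContainsMultiples q.Y.charpoly (quadSpace q) := by
  intro u hu
  obtain ⟨g, hg⟩ := mem_polyVec.mp hu
  refine mem_constTerms.mpr ⟨_, C_charpoly_mul_mem_quadMod q fun i => C (g i), fun i => ?_⟩
  rw [coeff_C_mul, coe_mapRingHom, coeff_map, coeff_C_zero, Pi.smul_apply, smul_eq_mul]
  have : u i = toRat (g i) := hg i
  rw [this]
  rfl

theorem isFat_quadSpace : IsFat (quadSpace q) := by
  refine ⟨⟨_, q.Y.charpoly_monic.ne_zero, containsMultiples_quadSpace q⟩, _,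
    q.Y.charpoly_monic.ne_zero, fun u hu => ?_⟩
  obtain ⟨D, hD, hDu⟩ := mem_constTerms.mp hu
  choose b hb using fun i => isDenom_of_mem_quadMod q hD i 0
  refine mem_polyVec.mpr ⟨b, fun i => ?_⟩
  rw [← hb, Pi.smul_apply, smul_eq_mul, hDu]
  rfl

theorem isPrimaryDecomposable_quadSpace : IsPrimaryDecomposable (quadSpace q) :=
  (rightStable_quadMod q).isPrimaryDecomposable q.Y.charpoly_monic.ne_zero
    (fun _ hD => isDenom_of_mem_quadMod q hD) (containsMultiples_quadSpace q)

/-! ### The Baker function of a quadruple inside its module. -/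

theorem vecMul_charmatrix_neg (c : Fin n → ℂ[X]) (M : Matrix (Fin n) (Fin n) ℂ) (k : Fin n) :
    (c ᵥ* (-M).charmatrix) k = X * c k + ∑ l, C (M l k) * c l := by
  rw [charmatrix, vecMul_sub, Pi.sub_apply, scalar_apply, vecMul_diagonal, mul_comm, sub_eq_add_neg]
  congr 1
  rw [vecMul, dotProduct, ← Finset.sum_neg_distrib]
  refine Finset.sum_congr rfl fun l _ => ?_
  simp [mul_comm]

theorem vecMul_adjugate_charmatrix_neg (e : Fin n → ℂ[X]) (M : Matrix (Fin n) (Fin n) ℂ) (k : Fin n) :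
    X * (e ᵥ* (-M).charmatrix.adjugate) k +
      ∑ l, C (M l k) * (e ᵥ* (-M).charmatrix.adjugate) l = (-M).charpoly * e k := by
  rw [← vecMul_charmatrix_neg, vecMul_vecMul, adjugate_mul, vecMul_smul, vecMul_one]
  rfl

/-- The rows of `χ(x) (1 + w (x + X)⁻¹ (z - Y)⁻¹ v)`. -/
def bakerRow (l : Fin r) : Fin r → Sym :=
  quadRow q (fun i => cstP (-q.X).charpoly * unitRow l i)
    ((fun k => C (q.w l k)) ᵥ* (-q.X).charmatrix.adjugate)

/-- The relation holds with `g = 0`: the tail coefficients `c` are `χ(x) w (x + X)⁻¹`, made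
polynomial by the adjugate. -/
theorem bakerRow_mem (l : Fin r) : bakerRow q l ∈ quadMod q := by
  refine ⟨_, _, 0, ?_, rfl⟩
  rw [QuadRel]
  funext k
  have h1 := congrArg cstP (vecMul_adjugate_charmatrix_neg (fun k => C (q.w l k)) q.X k)
  generalize (fun k => C (q.w l k)) ᵥ* (-q.X).charmatrix.adjugate = c at h1 ⊢
  have hX : cstP X = X := by simp
  have hC : ∀ a : ℂ, cstP (C a) = algebraMap ℂ ℂ[X][X] a := fun a => by
    simp [Polynomial.algebraMap_apply]
  rw [map_add, map_sum, map_mul, map_mul, hX, hC] at h1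
  simp only [map_mul, hC] at h1
  simp only [smul_zero, zero_vecMul, Pi.add_apply, Pi.sub_apply, Pi.zero_apply, Pi.smul_apply,
    add_zero, sub_zero, smul_eq_mul, vecMul, dotProduct, Matrix.map_apply]
  rw [Finset.sum_eq_single l]
  · rw [unitRow, if_pos rfl, mul_one]
    rw [← h1, Finset.sum_congr rfl fun j _ => mul_comm _ _]
  · intro i _ hi
    rw [unitRow, if_neg hi, mul_zero, zero_mul]
  · simp

theorem coeff_bakerRow_tail (l : Fin r) (k : Fin n) (j : ℕ) (hj : (-q.X).charpoly.natDegree ≤ j) :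
    (((fun k => C (q.w l k)) ᵥ* (-q.X).charmatrix.adjugate) k).coeff j = 0 := by
  refine coeff_eq_zero_of_X_mul_add q.X (vecMul_adjugate_charmatrix_neg _ _) (fun k j hj => ?_) k j hj
  rw [coeff_mul_C, coeff_eq_zero_of_natDegree_lt hj, zero_mul]

theorem bakerRow_sub (l i : Fin r) :
    bakerRow q l i - cst (-q.X).charpoly * (if i = l then 1 else 0) =
      quadRow q 0 ((fun k => C (q.w l k)) ᵥ* (-q.X).charmatrix.adjugate) i := by
  rw [bakerRow, quadRow, quadRow, map_mul, polySym_cstP, unitRow, Pi.zero_apply, map_zero]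
  split_ifs
  · rw [map_one]
    ring
  · rw [map_zero]
    ring

theorem coeff_bakerRow_sub_mem (l i : Fin r) (k : ℕ) :
    (bakerRow q l i - cst (-q.X).charpoly * (if i = l then 1 else 0)).coeff k ∈ proper := by
  rw [bakerRow_sub, coeff_quadRow, Pi.zero_apply, coeff_zero, map_zero, zero_add]
  exact proper.sum_mem fun k _ => proper.smul_mem _ (quadRes_mem_proper q k i)

theorem iota_bakerRow (l i : Fin r) :
    iota (bakerRow q l i) = polyVar2 0 (-q.X).charpoly * q.baker l i := by
  have hA : (-q.X).charmatrix.map (polyVar2 0) = xx • 1 + constMat q.X := by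
    ext a b
    by_cases hab : a = b
    · subst hab
      rw [Matrix.map_apply, charmatrix_apply_eq, Matrix.add_apply, Matrix.smul_apply,
        Matrix.one_apply_eq, map_sub, aeval_X, aeval_C, Matrix.neg_apply, map_neg, sub_neg_eq_add,
        smul_eq_mul, mul_one]
      rfl
    · rw [Matrix.map_apply, charmatrix_apply_ne _ _ _ hab, Matrix.add_apply, Matrix.smul_apply,
        Matrix.one_apply_ne hab, smul_zero, zero_add, map_neg, aeval_C, Matrix.neg_apply, map_neg,
        neg_neg]
      rfl
  have hdetA : (xx • (1 : Matrix (Fin n) (Fin n) Rat2) + constMat q.X).det =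
      polyVar2 0 (-q.X).charpoly := by
    rw [← hA, charpoly]
    exact (RingHom.map_det (polyVar2 0 : ℂ[X] →+* Rat2) _).symm
  have hadj : (-q.X).charmatrix.adjugate.map (polyVar2 0) =
      polyVar2 0 (-q.X).charpoly • (xx • 1 + constMat q.X)⁻¹ := by
    have h1 : (-q.X).charmatrix.adjugate.map (polyVar2 0) =
        ((-q.X).charmatrix.map (polyVar2 0)).adjugate :=
      RingHom.map_adjugate (polyVar2 0 : ℂ[X] →+* Rat2) _
    rw [h1, hA, Matrix.inv_def, smul_smul, hdetA, Ring.mul_inverse_cancel, one_smul]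
    rw [← hdetA]
    exact (det_add_constMat_ne_zero 0 q.X).isUnit
  have hres : (quadRes q).map (embed 1) = (zz • 1 - constMat q.Y)⁻¹ * constMat q.v := by
    have h1 := congrArg (fun M : Matrix (Fin n) (Fin r) Rat1 => M.map (embed 1 : Rat1 →+* Rat2))
      (X_smul_quadRes q)
    rw [Matrix.map_add _ (map_add _), Matrix.map_mul, Matrix.map_map, Matrix.map_map] at h1
    have h2 : ⇑(embed 1 : Rat1 →+* Rat2) ∘ ⇑(algebraMap ℂ Rat1) = algebraMap ℂ Rat2 := by
      funext a
      exact (embed 1).commutes a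
    rw [h2] at h1
    have h3 : ((RatFunc.X : Rat1) • quadRes q).map (embed 1 : Rat1 →+* Rat2) =
        zz • (quadRes q).map (embed 1) := by
      ext a b
      rw [Matrix.map_apply, Matrix.smul_apply, Matrix.smul_apply, smul_eq_mul, map_mul]
      congr 1
      exact embed_X 1
    rw [h3] at h1
    have h4 : (zz • 1 - constMat q.Y) * (quadRes q).map (embed 1) = constMat q.v := by
      rw [Matrix.sub_mul, smul_mul, Matrix.one_mul, h1]
      exact add_sub_cancel_left _ _
    rw [← h4]
    exact (nonsing_inv_mul_cancel_left _ _ (det_sub_constMat_ne_zero 1 q.Y).isUnit).symm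
  rw [bakerRow, quadRow, map_add, map_mul, polySym_cstP, map_mul, iota_cst, CMQuad.baker,
    Matrix.add_apply, mul_add, Matrix.one_apply, unitRow]
  congr 1
  · congr 1
    simp only [eq_comm (a := i)]
    split_ifs <;> simp
  · rw [RingHom.map_vecMul, Matrix.map_map]
    have h1 : ⇑iota ∘ ⇑(C : Rat1 →+* Sym) = embed 1 := by
      funext f
      exact iota_C f
    have h2 : (iota ∘ fun k => cst (((fun k => C (q.w l k)) ᵥ* (-q.X).charmatrix.adjugate) k)) =
        (constMat q.w l) ᵥ* (-q.X).charmatrix.adjugate.map (polyVar2 0) := by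
      funext k
      rw [Function.comp_apply, iota_cst]
      have h3 : (⇑(polyVar2 0 : ℂ[X] →+* Rat2) ∘ fun k => C (q.w l k)) = constMat q.w l :=
        funext fun j => aeval_C _ _
      rw [← h3]
      exact RingHom.map_vecMul (polyVar2 0 : ℂ[X] →+* Rat2) _ _ _
    rw [h1, h2, hadj, hres, vecMul_smul, smul_vecMul, Pi.smul_apply, smul_eq_mul]
    congr 1
    rw [vecMul_vecMul, Matrix.mul_assoc, Matrix.mul_assoc]
    rfl

theorem isReducedBaker_quadSpace : IsReducedBaker (quadSpace q) q.baker :=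
  isReducedBaker_of_mem_rowSyms (isFat_quadSpace q) (-q.X).charpoly_monic.ne_zero
    (fun l => (rightStable_quadMod q).le_rowSyms (bakerRow_mem q l)) (coeff_bakerRow_sub_mem q)
    (iota_bakerRow q)

end

end AdelicGr
end

noncomputable section
namespace AdelicGr
open Polynomial Matrix

/-! ### Leading coefficients for the space attached to a quadruple -/

theorem eq_of_eval_C_eq {a b : Sym} (h : ∀ x : ℂ, a.eval (RatFunc.C x) = b.eval (RatFunc.C x)) :
    a = b := by
  refine eq_of_infinite_eval_eq a b ?_
  refine (Set.infinite_range_of_injective (RatFunc.C_injective (K := ℂ))).mono ?_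
  rintro _ ⟨x, rfl⟩
  exact h x

section
variable {n r : ℕ} (q : CMQuad n r)

/-- `f ↦ (w f(Y))_{i l}`. -/
def quadFun (i : Fin r) (l : Fin n) : ℂ[X] →ₗ[ℂ] ℂ :=
  ∑ k, q.w i k • (entryLinearMap ℂ ℂ k l).comp (aeval q.Y).toLinearMap

theorem quadFun_apply (i : Fin r) (l : Fin n) (f : ℂ[X]) :
    quadFun q i l f = ∑ k, q.w i k * aeval q.Y f k l := by
  simp [quadFun]

/-- At each point, the row `c` is determined by `d`. -/
theorem QuadRel.eval_eq {d : Fin r → ℂ[X][X]} {c : Fin n → ℂ[X]} {g : Fin n → ℂ[X][X]}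
    (h : QuadRel q d c g) (x : ℂ) (l : Fin n) :
    ∑ i, quadFun q i l ((d i).eval (C x)) = x * (c l).eval x + ∑ k, q.X k l * (c k).eval x := by
  let γ : Fin n → ℂ := fun k => x * (c k).eval x + ∑ j, q.X j k * (c j).eval x
  have h1 : ∀ k, ∑ i, q.w i k • (d i).eval (C x) =
      C (γ k) + X * (g k).eval (C x) - ∑ j, q.Y j k • (g j).eval (C x) := by
    intro k
    have h2 := congrArg (eval (C x)) (congrFun h k)
    simp only [Pi.add_apply, Pi.sub_apply, Pi.smul_apply, smul_eq_mul, vecMul, dotProduct,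
      Matrix.map_apply, eval_add, eval_sub, eval_mul, eval_finsetSum, eval_cstP, eval_X, eval_C,
      Polynomial.algebraMap_apply, Algebra.algebraMap_self, RingHom.id_apply] at h2
    simp only [γ, smul_eq_C_mul, map_add, map_mul, map_sum]
    simp only [mul_comm (C (q.w _ _)), mul_comm (C (q.X _ _)), mul_comm (C (q.Y _ _))]
    exact h2
  -- Each `k` is evaluated at `z = Y` and its entry `(k, l)` is taken. In the sum over `k` the terms
  -- from `g (z - Y)` cancel.
  have h2 := Finset.sum_congr (rfl : (Finset.univ : Finset (Fin n)) = _) fun k _ =>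
    congrFun (congrFun (congrArg (aeval q.Y) (h1 k)) k) l
  simp only [map_add, map_sub, map_sum, map_mul, aeval_X, aeval_C, map_smul, Matrix.add_apply,
    Matrix.sub_apply, Matrix.sum_apply, Matrix.smul_apply, smul_eq_mul, Finset.sum_add_distrib,
    Finset.sum_sub_distrib] at h2
  have h3 : ∑ k, (q.Y * aeval q.Y ((g k).eval (C x))) k l =
      ∑ k, ∑ j, q.Y j k * aeval q.Y ((g j).eval (C x)) k l := by
    rw [Finset.sum_comm]
    exact Finset.sum_congr rfl fun k _ => Matrix.mul_apply
  rw [h3, add_sub_cancel_right, Finset.sum_comm, Finset.sum_eq_single l] at h2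
  · simp only [quadFun_apply]
    rw [h2, Matrix.algebraMap_matrix_apply, if_pos rfl]
    rfl
  · intro k _ hk
    rw [Matrix.algebraMap_matrix_apply, if_neg hk]
  · simp

/-- The tail of an operator mapping `ℂ[z]` to `quadSpace q` has smaller order. -/
theorem coeff_tail_eq_zero_of_mem {D : Fin r → Sym} (hD : D ∈ rowSyms (quadSpace q)) {m : ℕ}
    (hm : ∀ i k, m < k → (D i).coeff k = 0) (i : Fin r) : (tail (D i)).coeff m = 0 := by
  set χ := (-q.X).charpoly with hχ
  -- `D` lies in `rowSyms (quadSpace q)`, not visibly in `quadMod q`. At each `x` it agrees with an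
  -- element of `quadMod q` depending on `x`, whose tail coefficients satisfy `c(x) (x + X) = ε(x)`.
  -- Since `ε` depends only on the polynomial part of `D`, it is a polynomial row of degree at most
  -- `m`, and `κ = χ c` globally.
  let ε : Fin n → ℂ[X] := fun l => ∑ i, mapCoeff ((quadFun q i l).comp polyPart) (D i)
  let κ : Fin n → ℂ[X] := ε ᵥ* (-q.X).charmatrix.adjugate
  have hε : ∀ k j, m < j → (ε k).coeff j = 0 := by
    intro k j hj
    rw [finsetSum_coeff]
    refine Finset.sum_eq_zero fun i _ => ?_
    rw [coeff_mapCoeff, hm i j hj, map_zero]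
  have hκ : ∀ k j, χ.natDegree + m ≤ j → (κ k).coeff j = 0 := by
    refine coeff_eq_zero_of_X_mul_add q.X (vecMul_adjugate_charmatrix_neg _ _) fun k j hj => ?_
    refine coeff_eq_zero_of_natDegree_lt (lt_of_le_of_lt natDegree_mul_le ?_)
    have : (ε k).natDegree ≤ m := natDegree_le_iff_coeff_eq_zero.mpr (hε k)
    rw [← hχ]
    omega
  have key : cst χ * tail (D i) = quadRow q 0 κ i := by
    refine eq_of_eval_C_eq fun x => ?_
    obtain ⟨E, hE, hDE⟩ := exists_mem_of_memClosure (rightStable_quadMod q)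
      q.Y.charpoly_monic.ne_zero
      (fun g => by simpa using C_charpoly_mul_mem_quadMod q fun i => C (g i))
      (fun u hu => mem_constTerms.mp hu)
      (memClosure_of_mem_rowSyms q.Y.charpoly_monic.ne_zero (containsMultiples_quadSpace q) hD x)
    obtain ⟨d, c, g, hrel, rfl⟩ := hE
    simp only [eval_quadRow] at hDE
    have hprop : ∀ i, ∑ k, (c k).eval x • quadRes q k i ∈ proper := fun i =>
      proper.sum_mem fun k _ => proper.smul_mem _ (quadRes_mem_proper q k i)
    have hpp : ∀ i, polyPart ((D i).eval (RatFunc.C x)) = (d i).eval (C x) := fun i =>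
      polyPart_eq (by rw [hDE, add_sub_cancel_left]; exact hprop i)
    have hev : ∀ l, x * (c l).eval x + ∑ k, q.X k l * (c k).eval x = (ε l).eval x := by
      intro l
      rw [← hrel.eval_eq, eval_finsetSum]
      refine Finset.sum_congr rfl fun i _ => ?_
      have := eval_mapCoeff ((quadFun q i l).comp polyPart) (D i) x
      rw [LinearMap.comp_apply, hpp] at this
      exact this.symm
    have hκx : ∀ k, (κ k).eval x = χ.eval x * (c k).eval x := by
      intro k
      have h1 : ((fun k => C ((c k).eval x)) ᵥ* (-q.X).charmatrix) ᵥ* (-q.X).charmatrix.adjugate =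
          χ • fun k => C ((c k).eval x) := by
        rw [vecMul_vecMul, mul_adjugate, vecMul_smul, vecMul_one]
        rfl
      have h2 := congrArg (eval x) (congrFun h1 k)
      rw [Pi.smul_apply, smul_eq_mul, eval_mul, eval_C] at h2
      rw [← h2]
      change eval x (∑ l, ε l * (-q.X).charmatrix.adjugate l k) = eval x (∑ l,
        ((fun k => C ((c k).eval x)) ᵥ* (-q.X).charmatrix) l * (-q.X).charmatrix.adjugate l k)
      rw [eval_finsetSum, eval_finsetSum]
      refine Finset.sum_congr rfl fun l _ => ?_
      rw [eval_mul, eval_mul, ← hev, vecMul_charmatrix_neg]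
      simp only [eval_add, eval_mul, eval_X, eval_C, eval_finsetSum]
    have ht : (tail (D i)).eval (RatFunc.C x) = ∑ k, (c k).eval x • quadRes q k i := by
      refine (eval_mapCoeff tailPart (D i) x).trans ?_
      rw [tailPart_apply, hpp, hDE, add_sub_cancel_left]
    rw [eval_mul, eval_cst, ht, eval_quadRow, Pi.zero_apply, eval_zero, map_zero, zero_add,
      Finset.mul_sum]
    refine Finset.sum_congr rfl fun k _ => ?_
    rw [hκx, mul_smul, Algebra.smul_def (χ.eval x)]
    rfl
  -- The degree of `κ` is less than `deg χ + m`, so after division by the monic `χ` the tail has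
  -- order less than `m`.
  have hc := congrArg (fun p : Sym => p.coeff (χ.natDegree + m)) key
  have h1 : (cst χ).natDegree ≤ χ.natDegree := natDegree_map_le
  have h2 : (tail (D i)).natDegree ≤ m := natDegree_le_iff_coeff_eq_zero.mpr fun k hk => by
    rw [coeff_mapCoeff, hm i k hk, map_zero]
  rw [coeff_mul_add_eq_of_natDegree_le h1 h2, coeff_cst, (-q.X).charpoly_monic.coeff_natDegree,
    map_one, one_mul, coeff_quadRow, Pi.zero_apply, coeff_zero, map_zero, zero_add,
    Finset.sum_eq_zero] at hc
  · exact hc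
  · intro k _
    rw [hκ k _ le_rfl, zero_smul]

theorem leadingCoeffs_quadSpace : leadingCoeffs (quadSpace q) = (polyVec r : Set (RatVec r)) := by
  ext u
  rw [mem_leadingCoeffs_iff, SetLike.mem_coe, mem_polyVec]
  constructor
  · rintro ⟨D, hD, m, hm, hmu⟩
    refine ⟨fun i => polyPart ((D i).coeff m), fun i => ?_⟩
    have := coeff_tail_eq_zero_of_mem q hD hm i
    rw [coeff_mapCoeff, tailPart_apply, sub_eq_zero] at this
    rw [← hmu]
    exact this
  · rintro ⟨f, hf⟩
    have hcoeff : ∀ l i k, (-q.X).charpoly.natDegree ≤ k →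
        (bakerRow q l i).coeff k = (cst (-q.X).charpoly * (if i = l then 1 else 0)).coeff k := by
      intro l i k hk
      rw [← sub_eq_zero, ← coeff_sub, bakerRow_sub, coeff_quadRow, Pi.zero_apply, coeff_zero, map_zero, zero_add]
      exact Finset.sum_eq_zero fun j _ => by rw [coeff_bakerRow_tail q l j k hk, zero_smul]
    have hhigh : ∀ l i k, (-q.X).charpoly.natDegree < k → (bakerRow q l i).coeff k = 0 := by
      intro l i k hk
      rw [hcoeff l i k hk.le]
      split_ifs
      · rw [mul_one, coeff_cst, coeff_eq_zero_of_natDegree_lt hk, map_zero]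
      · simp
    -- Row `l` of `bakerRow` has leading coefficient `e_l` at order `deg χ`; composition with `f l`
    -- multiplies it by `f l`.
    refine ⟨∑ l, fun i => aeval zop (f l) (bakerRow q l i), (rowSyms _).sum_mem fun l _ =>
      (rightStable_rowSyms _).aeval_zop _ ((rightStable_quadMod q).le_rowSyms (bakerRow_mem q l)),
      (-q.X).charpoly.natDegree, fun i k hk => ?_, fun i => ?_⟩
    · rw [Finset.sum_apply, finsetSum_coeff]
      exact Finset.sum_eq_zero fun l _ => (coeff_aeval_zop (hhigh l i) (f l)).1 k hk
    · rw [Finset.sum_apply, finsetSum_coeff, Finset.sum_eq_single i]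
      · rw [(coeff_aeval_zop (hhigh i i) (f i)).2, hcoeff i i _ le_rfl, if_pos rfl, mul_one, coeff_cst,
          (-q.X).charpoly_monic.coeff_natDegree, map_one, mul_one, hf]
      · intro l _ hl
        rw [(coeff_aeval_zop (hhigh l i) (f l)).2, hcoeff l i _ le_rfl, if_neg hl.symm, mul_zero,
          coeff_zero, mul_zero]
      · simp

/-- `β` is defined for every quadruple. -/
theorem isBeta_quadSpace : IsBeta q (quadSpace q) :=
  ⟨⟨isFat_quadSpace q, isPrimaryDecomposable_quadSpace q, leadingCoeffs_quadSpace q⟩,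
    isReducedBaker_quadSpace q⟩

end

theorem isBispectralImage_bisp {r : ℕ} {U : Submodule ℂ (RatVec r)} (hU : U ∈ grAd r) :
    IsBispectralImage U (bisp U) := by
  obtain ⟨n, q, hq⟩ := exists_isBeta hU
  have h : ∃ V, IsBispectralImage U V := ⟨_, n, q, hq, isBeta_quadSpace q.bisp⟩
  rw [bisp, dif_pos h]
  exact h.choose_spec

end AdelicGr
end

noncomputable section
namespace AdelicGr
open Polynomial

/-! ### Actions of symbols -/

section SymAct
variable {K K' : Type} [CommRing K] [Algebra ℂ K] [CommRing K'] [Algebra ℂ K']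

/-- The operator `∑ φ(c_k) L^k` attached to the symbol `∑ c_k X^k`. -/
def symAct (φ : Rat1 →+* K) (L : Module.End ℂ K) : Sym →+ Module.End ℂ K where
  toFun c := c.sum fun k a => LinearMap.mulLeft ℂ (φ a) * L ^ k
  map_zero' := by rw [sum_zero_index]
  map_add' c d := by
    rw [sum_add_index]
    · intro k
      ext a
      simp
    · intro k a b
      ext e
      simp [add_mul]

theorem symAct_monomial (φ : Rat1 →+* K) (L : Module.End ℂ K) (k : ℕ) (a : Rat1) :
    symAct φ L (monomial k a) = LinearMap.mulLeft ℂ (φ a) * L ^ k := by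
  refine sum_monomial_index a (fun k a => LinearMap.mulLeft ℂ (φ a) * L ^ k) ?_
  ext b
  simp

theorem symAct_eq_sum (φ : Rat1 →+* K) (L : Module.End ℂ K) (c : Sym) :
    symAct φ L c = ∑ k ∈ c.support, LinearMap.mulLeft ℂ (φ (c.coeff k)) * L ^ k := rfl

theorem symAct_C_mul (φ : Rat1 →+* K) (L : Module.End ℂ K) (f : Rat1) (c : Sym) :
    symAct φ L (C f * c) = LinearMap.mulLeft ℂ (φ f) * symAct φ L c := by
  induction c using Polynomial.induction_on' with
  | add p q hp hq => rw [mul_add, map_add, map_add, hp, hq, mul_add]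
  | monomial k a =>
    rw [C_mul_monomial, symAct_monomial, symAct_monomial, ← mul_assoc, map_mul]
    congr 1
    ext b
    simp

/-- A linear map which intertwines the coefficients and the derivations intertwines the actions. -/
theorem map_symAct {φ : Rat1 →+* K} {L : Module.End ℂ K} {φ' : Rat1 →+* K'} {L' : Module.End ℂ K'}
    (T : K → K') (hadd : ∀ a b, T (a + b) = T a + T b) (hφ : ∀ f a, T (φ f * a) = φ' f * T a)
    (hL : ∀ a, T (L a) = L' (T a)) (c : Sym) (a : K) :
    T (symAct φ L c a) = symAct φ' L' c (T a) := by
  induction c using Polynomial.induction_on' with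
  | add p q hp hq => rw [map_add, map_add, LinearMap.add_apply, LinearMap.add_apply, hadd, hp, hq]
  | monomial k f =>
    have h : ∀ k, T ((L ^ k) a) = (L' ^ k) (T a) := by
      intro k
      induction k with
      | zero => rfl
      | succ k ih => rw [pow_succ', pow_succ', Module.End.mul_apply, Module.End.mul_apply, hL, ih]
    rw [symAct_monomial, symAct_monomial, Module.End.mul_apply, Module.End.mul_apply,
      LinearMap.mulLeft_apply, LinearMap.mulLeft_apply, hφ, h]

/-- Left composition of a symbol with `∂`. -/
def dop : Module.End ℂ Sym := LinearMap.mulLeft ℂ X + mapCoeff (ddz : Rat1 →ₗ[ℂ] Rat1)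

theorem dop_monomial (k : ℕ) (a : Rat1) :
    dop (monomial k a) = monomial (k + 1) a + monomial k (ddz a) := by
  have h1 : mapCoeff (ddz : Rat1 →ₗ[ℂ] Rat1) (monomial k a) = monomial k (ddz a) := by
    ext1 j
    rw [coeff_mapCoeff, coeff_monomial, coeff_monomial]
    split_ifs <;> simp
  rw [dop, LinearMap.add_apply, h1, LinearMap.mulLeft_apply, X_mul_monomial]

theorem symAct_dop {φ : Rat1 →+* K} {L : Module.End ℂ K}
    (h : ∀ f a, L (φ f * a) = φ f * L a + φ (ddz f) * a) (c : Sym) :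
    symAct φ L (dop c) = L * symAct φ L c := by
  induction c using Polynomial.induction_on' with
  | add p q hp hq => rw [map_add, map_add, map_add, hp, hq, mul_add]
  | monomial k a =>
    rw [dop_monomial, map_add, symAct_monomial, symAct_monomial, symAct_monomial]
    ext b
    simp only [LinearMap.add_apply, Module.End.mul_apply, LinearMap.mulLeft_apply, pow_succ', h]

/-- The symbol of a composition. -/
abbrev compSym : Sym →+ Module.End ℂ Sym := symAct C dop

/-- Leibniz' rule for `L` is the only relation defining the product of symbols, so every such action
is multiplicative. It is used for `ℂ(z)`, for `∂_x + z` and for `∂_z + x`. -/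
theorem symAct_compSym {φ : Rat1 →+* K} {L : Module.End ℂ K}
    (h : ∀ f a, L (φ f * a) = φ f * L a + φ (ddz f) * a) (c d : Sym) :
    symAct φ L (compSym c d) = symAct φ L c * symAct φ L d := by
  induction c using Polynomial.induction_on' with
  | add p q hp hq => rw [map_add, map_add, LinearMap.add_apply, map_add, hp, hq, add_mul]
  | monomial k f =>
    have hk : ∀ k, symAct φ L ((dop ^ k) d) = L ^ k * symAct φ L d := by
      intro k
      induction k with
      | zero => rw [pow_zero, pow_zero, one_mul]; rfl
      | succ k ih => rw [pow_succ', pow_succ', Module.End.mul_apply, symAct_dop h, ih, mul_assoc]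
    rw [symAct_monomial, symAct_monomial, Module.End.mul_apply, LinearMap.mulLeft_apply,
      symAct_C_mul, hk, mul_assoc]

end SymAct

theorem apply_eq_symAct (D : DiffOp) : D.1 = symAct (RingHom.id Rat1) ddz (symOf D) := by
  ext1 f
  rw [apply_eq_sum, symAct_eq_sum, sum_def, LinearMap.sum_apply]
  rfl

theorem symOf_mul (D E : DiffOp) : symOf (D * E) = compSym (symOf D) (symOf E) := by
  rw [← symOf_opOf (compSym (symOf D) (symOf E))]
  congr 1
  rw [← Subtype.coe_inj, apply_eq_symAct (opOf _), symOf_opOf, symAct_compSym, ← apply_eq_symAct,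
    ← apply_eq_symAct]
  · rfl
  · intro f a
    simp [mul_comm]

theorem symOf_add (D E : DiffOp) : symOf (D + E) = symOf D + symOf E := by
  rw [← symOf_opOf (symOf D + symOf E)]
  congr 1
  rw [← Subtype.coe_inj, apply_eq_symAct (opOf _), symOf_opOf, map_add, ← apply_eq_symAct,
    ← apply_eq_symAct]
  rfl

theorem symOf_algebraMap (a : ℂ) : symOf (algebraMap ℂ DiffOp a) = C (RatFunc.C a) := by
  rw [← symOf_opOf (C (RatFunc.C a))]
  congr 1
  rw [← Subtype.coe_inj, apply_eq_symAct (opOf _), symOf_opOf, ← monomial_zero_left, symAct_monomial,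
    pow_zero, mul_one]
  ext1 f
  change a • f = _
  rw [Algebra.smul_def]
  rfl

theorem app_compSym (x : ℂ[X]) (D : DiffOp) (c : Sym) :
    app 0 x (compSym (symOf D) c) = D.1 (app 0 x c) := by
  rw [apply_eq_symAct]
  refine map_symAct (app 0 x) (map_add _) (fun f a => app_C_mul _ _ _ _) (fun a => ?_) _ _
  induction a using Polynomial.induction_on' with
  | add p q hp hq => rw [map_add, map_add, map_add, map_add, hp, hq]
  | monomial k a =>
    rw [dop_monomial, map_add, app_monomial, app_monomial, app_monomial]
    simp only [Derivation.coeFn_coe, Derivation.leibniz, ddz_toRat, smul_eq_mul, pow_succ',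
      Module.End.mul_apply]
    rw [delta_zero, mul_comm (toRat _)]

/-! ### Derivations of `ℂ(x, z)` -/

theorem derivation_ext {D E : Derivation ℂ Rat2 Rat2} (h : ∀ i, D (var2 i) = E (var2 i)) : D = E := by
  have h1 : ∀ A : MvPolynomial (Fin 2) ℂ, D (algebraMap _ Rat2 A) = E (algebraMap _ Rat2 A) := by
    intro A
    have : D.compAlgebraMap (MvPolynomial (Fin 2) ℂ) = E.compAlgebraMap (MvPolynomial (Fin 2) ℂ) :=
      MvPolynomial.derivation_ext h
    exact congrFun (congrArg DFunLike.coe this) A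
  ext f
  obtain ⟨A, B, hB, rfl⟩ := IsFractionRing.div_surjective (A := MvPolynomial (Fin 2) ℂ) f
  rw [Derivation.leibniz_div, Derivation.leibniz_div, h1, h1]

theorem fracDeriv_var2 (d : Derivation ℂ (MvPolynomial (Fin 2) ℂ) (MvPolynomial (Fin 2) ℂ)) (i : Fin 2) :
    (fracDeriv d : Derivation ℂ Rat2 Rat2) (var2 i) =
      algebraMap _ Rat2 (d (MvPolynomial.X i)) := by
  have := quotRule_eq (K := Rat2) d (MvPolynomial.X i) 1 one_ne_zero
  simp only [map_one, div_one, one_mul, one_pow, Derivation.map_one_eq_zero, map_zero, mul_zero,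
    sub_zero] at this
  exact this

theorem ddxx_xx : ddxx (var2 0) = 1 := by
  rw [ddxx, fracDeriv_var2, MvPolynomial.pderiv_X_self, map_one]

theorem ddxx_zz : ddxx (var2 1) = 0 := by
  rw [ddxx, fracDeriv_var2, MvPolynomial.pderiv_X_of_ne (by decide), map_zero]

theorem ddzz_zz : ddzz (var2 1) = 1 := by
  rw [ddzz, fracDeriv_var2, MvPolynomial.pderiv_X_self, map_one]

theorem ddzz_xx : ddzz (var2 0) = 0 := by
  rw [ddzz, fracDeriv_var2, MvPolynomial.pderiv_X_of_ne (by decide), map_zero]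

theorem derivation_embed (D : Derivation ℂ Rat2 Rat2) (i : Fin 2) (f : Rat1) :
    D (embed i f) = embed i (ddz f) * D (var2 i) := by
  obtain ⟨a, b, hb, rfl⟩ := exists_eq_toRat_div f
  rw [map_div₀, Derivation.leibniz_div, Derivation.leibniz_div, embed_toRat, embed_toRat,
    Derivation.map_aeval, Derivation.map_aeval, ddz_toRat, ddz_toRat]
  simp only [smul_eq_mul, map_mul, map_sub, map_pow, map_inv₀, embed_toRat]
  ring

theorem ddxx_ddzz (F : Rat2) : ddxx (ddzz F) = ddzz (ddxx F) := by
  have h : ⁅ddxx, ddzz⁆ = (0 : Derivation ℂ Rat2 Rat2) := by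
    refine derivation_ext fun i => ?_
    rw [Derivation.commutator_apply]
    fin_cases i
    · change ddxx (ddzz (var2 0)) - ddzz (ddxx (var2 0)) = 0
      rw [ddzz_xx, ddxx_xx, map_zero, Derivation.map_one_eq_zero, sub_zero]
    · change ddxx (ddzz (var2 1)) - ddzz (ddxx (var2 1)) = 0
      rw [ddzz_zz, ddxx_zz, map_zero, Derivation.map_one_eq_zero, sub_zero]
  have := congrFun (congrArg DFunLike.coe h) F
  rw [Derivation.commutator_apply] at this
  exact sub_eq_zero.mp this

/-- `∂_x + z`. -/
abbrev shiftX : Module.End ℂ Rat2 := (ddxx : Rat2 →ₗ[ℂ] Rat2) + LinearMap.mulLeft ℂ zz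

/-- `∂_z + x`. -/
abbrev shiftZ : Module.End ℂ Rat2 := (ddzz : Rat2 →ₗ[ℂ] Rat2) + LinearMap.mulLeft ℂ xx

theorem shiftX_apply (F : Rat2) : shiftX F = ddxx F + zz * F := rfl

theorem shiftZ_apply (F : Rat2) : shiftZ F = ddzz F + xx * F := rfl

theorem shiftX_embed_mul (f : Rat1) (F : Rat2) :
    shiftX (embed 0 f * F) = embed 0 f * shiftX F + embed 0 (ddz f) * F := by
  rw [shiftX_apply, shiftX_apply, Derivation.leibniz, derivation_embed, ddxx_xx, smul_eq_mul,
    smul_eq_mul]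
  ring

theorem shiftZ_embed_mul (f : Rat1) (F : Rat2) :
    shiftZ (embed 1 f * F) = embed 1 f * shiftZ F + embed 1 (ddz f) * F := by
  rw [shiftZ_apply, shiftZ_apply, Derivation.leibniz, derivation_embed, ddzz_zz, smul_eq_mul,
    smul_eq_mul]
  ring

theorem shiftX_embed_one_mul (f : Rat1) (F : Rat2) :
    shiftX (embed 1 f * F) = embed 1 f * shiftX F := by
  rw [shiftX_apply, shiftX_apply, Derivation.leibniz, derivation_embed, ddxx_zz, smul_eq_mul,
    smul_eq_mul]
  ring

theorem shiftZ_embed_zero_mul (f : Rat1) (F : Rat2) :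
    shiftZ (embed 0 f * F) = embed 0 f * shiftZ F := by
  rw [shiftZ_apply, shiftZ_apply, Derivation.leibniz, derivation_embed, ddzz_xx, smul_eq_mul,
    smul_eq_mul]
  ring

/-- After removal of the factor `e^{xz}`, these are `∂_x` and `∂_z`. -/
theorem shiftX_shiftZ (F : Rat2) : shiftX (shiftZ F) = shiftZ (shiftX F) := by
  have h1 : ddxx xx = 1 := ddxx_xx
  have h2 : ddzz zz = 1 := ddzz_zz
  simp only [shiftX_apply, shiftZ_apply, map_add, Derivation.leibniz, smul_eq_mul, h1, h2, ddxx_ddzz]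
  ring

/-- The action of symbols on functions of `x`, through `∂_x + z`. -/
abbrev symX : Sym →+ Module.End ℂ Rat2 := symAct (embed 0 : Rat1 →+* Rat2) shiftX

/-- The action of symbols on functions of `z`, through `∂_z + x`. -/
abbrev symZ : Sym →+ Module.End ℂ Rat2 := symAct (embed 1 : Rat1 →+* Rat2) shiftZ

theorem actX_eq (D : DiffOp) : actX D = symX (symOf D) := by
  rw [actX, opOfCoeffs, symAct_eq_sum, support_symOf]
  refine Finset.sum_congr rfl fun k _ => ?_
  rw [coeff_symOf]
  exact congrArg (fun a => LinearMap.mulLeft ℂ a * shiftX ^ k) (eval_eq_embed 0 _)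

theorem actZ_eq (D : DiffOp) : actZ D = symZ (symOf D) := by
  rw [actZ, opOfCoeffs, symAct_eq_sum, support_symOf]
  refine Finset.sum_congr rfl fun k _ => ?_
  rw [coeff_symOf]
  exact congrArg (fun a => LinearMap.mulLeft ℂ a * shiftZ ^ k) (eval_eq_embed 1 _)

theorem actX_mul (D E : DiffOp) : actX (D * E) = actX D * actX E := by
  rw [actX_eq, actX_eq, actX_eq, symOf_mul]
  exact symAct_compSym shiftX_embed_mul _ _

theorem actZ_mul (D E : DiffOp) : actZ (D * E) = actZ D * actZ E := by
  rw [actZ_eq, actZ_eq, actZ_eq, symOf_mul]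
  exact symAct_compSym shiftZ_embed_mul _ _

theorem actX_add (D E : DiffOp) : actX (D + E) = actX D + actX E := by
  rw [actX_eq, actX_eq, actX_eq, symOf_add, map_add]

theorem actZ_add (D E : DiffOp) : actZ (D + E) = actZ D + actZ E := by
  rw [actZ_eq, actZ_eq, actZ_eq, symOf_add, map_add]

theorem actX_algebraMap (a : ℂ) (F : Rat2) : actX (algebraMap ℂ DiffOp a) F = a • F := by
  rw [actX_eq, symOf_algebraMap, ← monomial_zero_left, symAct_monomial, pow_zero, mul_one,
    LinearMap.mulLeft_apply, Algebra.smul_def]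
  congr 1
  exact embed_C 0 a

theorem actZ_algebraMap (a : ℂ) (F : Rat2) : actZ (algebraMap ℂ DiffOp a) F = a • F := by
  rw [actZ_eq, symOf_algebraMap, ← monomial_zero_left, symAct_monomial, pow_zero, mul_one,
    LinearMap.mulLeft_apply, Algebra.smul_def]
  congr 1
  exact embed_C 1 a

theorem symZ_embed_zero_mul (c : Sym) (f : Rat1) (F : Rat2) :
    symZ c (embed 0 f * F) = embed 0 f * symZ c F :=
  (map_symAct (fun F => embed 0 f * F) (mul_add _) (fun _ _ => mul_left_comm _ _ _)
    (fun a => (shiftZ_embed_zero_mul f a).symm) c F).symm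

/-- Operators in `x` commute with operators in `z`: coefficients of one kind are constants for the
other, and the two shifted derivations commute. -/
theorem actX_actZ (D E : DiffOp) (F : Rat2) : actX D (actZ E F) = actZ E (actX D F) := by
  rw [actX_eq, actZ_eq]
  refine (map_symAct (symZ (symOf E)) (map_add _) (symZ_embed_zero_mul _) (fun a => ?_) _ _).symm
  exact (map_symAct shiftX (map_add _) (shiftX_embed_one_mul) shiftX_shiftZ _ _).symm

/-- The left half of the dictionary: composing from the left with an operator in `z` is letting it
act on the function `d(x,z) e^{xz}`. -/
theorem iota_compSym (c d : Sym) : iota (compSym c d) = symZ c (iota d) := by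
  refine map_symAct iota (map_add _) (fun f a => ?_) (fun a => ?_) c d
  · rw [map_mul, iota_C]
    rfl
  · induction a using Polynomial.induction_on' with
    | add p q hp hq => rw [map_add, map_add, map_add, map_add, hp, hq]
    | monomial k a =>
      have h : ∀ k a, iota (monomial k a) = embed 1 a * xx ^ k := fun k a => eval₂_monomial _ _
      have h1 : shiftZ (xx ^ k) = xx ^ (k + 1) := by
        have : ddzz xx = 0 := ddzz_xx
        rw [shiftZ_apply, Derivation.leibniz_pow, this, smul_zero, nsmul_zero, zero_add, pow_succ']
      rw [dop_monomial, map_add, h, h, h, shiftZ_embed_mul, h1]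

/-- The right half of the dictionary: `D(z e^{xz}) = ∂_x D(e^{xz})`. -/
theorem iota_zop (c : Sym) : iota (zop c) = shiftX (iota c) := by
  induction c using Polynomial.induction_on' with
  | add p q hp hq => rw [map_add, map_add, map_add, map_add, hp, hq]
  | monomial k a =>
    have h : ∀ k a, iota (monomial k a) = embed 1 a * xx ^ k := fun k a => eval₂_monomial _ _
    have h1 : ddxx xx = 1 := ddxx_xx
    have h2 : embed 1 RatFunc.X = zz := embed_X 1
    rw [zop_apply, derivative_monomial, map_add, map_mul, iota_C, h, h, shiftX_embed_one_mul,
      shiftX_apply, Derivation.leibniz_pow, h1, h2, map_mul, map_natCast]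
    simp only [smul_eq_mul, mul_one, nsmul_eq_mul]
    ring

end AdelicGr
end

noncomputable section
namespace AdelicGr
open Polynomial

/-! ### Functions obtained from the Baker function by operators in `x` -/

theorem embed_zero_toRat (g : ℂ[X]) : embed 0 (toRat g) = iota (cst g) := by
  rw [embed_toRat, iota_cst]

/-- Factor `g` into linear factors. Each `∂ - a` is surjective on `ℂ[z]`: by integration if `a = 0`,
and because `∂` lowers the degree if `a ≠ 0`. -/
theorem aeval_derivative_surjective {g : ℂ[X]} (hg : g ≠ 0) :
    Function.Surjective (aeval (derivative : Module.End ℂ ℂ[X]) g) := by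
  have hlin : ∀ a : ℂ, Function.Surjective (aeval (derivative : Module.End ℂ ℂ[X]) (X - C a)) := by
    intro a f
    have happ : ∀ u : ℂ[X], aeval (derivative : Module.End ℂ ℂ[X]) (X - C a) u =
        derivative u - a • u := by
      intro u
      simp [Module.algebraMap_end_apply]
    simp only [happ]
    by_cases ha : a = 0
    · subst ha
      simp only [zero_smul, sub_zero]
      induction f using Polynomial.induction_on' with
      | add p q hp hq =>
        obtain ⟨u, rfl⟩ := hp
        obtain ⟨v, rfl⟩ := hq
        exact ⟨u + v, derivative_add⟩
      | monomial k c =>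
        refine ⟨monomial (k + 1) (c / (k + 1)), ?_⟩
        rw [derivative_monomial, Nat.add_sub_cancel]
        congr 1
        push_cast
        have : (k : ℂ) + 1 ≠ 0 := by exact_mod_cast Nat.succ_ne_zero k
        field_simp
    · have key : ∀ n : ℕ, ∀ f : ℂ[X], f.natDegree < n → ∃ u, derivative u - a • u = f := by
        intro n
        induction n with
        | zero => intro f hf; omega
        | succ n ih =>
          intro f hf
          by_cases hd : f.natDegree = 0
          · obtain ⟨c, rfl⟩ : ∃ c, f = C c := ⟨_, eq_C_of_natDegree_eq_zero hd⟩
            refine ⟨C (-(c / a)), ?_⟩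
            rw [derivative_C, smul_C, zero_sub, ← C_neg, smul_eq_mul]
            congr 1
            field_simp
          · obtain ⟨u, hu⟩ := ih (derivative f) (by
              have := natDegree_derivative_lt hd
              omega)
            -- If `u' - a u = f'`, then `(u - f) / a` solves the equation for `f`.
            refine ⟨a⁻¹ • (u - f), ?_⟩
            rw [derivative_smul, derivative_sub, smul_smul, mul_inv_cancel₀ ha, one_smul, ← hu,
              sub_sub_cancel, smul_smul, inv_mul_cancel₀ ha, one_smul, sub_sub_cancel]
      exact key _ f (Nat.lt_succ_self _)
  have key : ∀ n : ℕ, ∀ g : ℂ[X], g ≠ 0 → g.natDegree = n →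
      Function.Surjective (aeval (derivative : Module.End ℂ ℂ[X]) g) := by
    intro n
    induction n with
    | zero =>
      intro g hg hn f
      obtain ⟨a, rfl⟩ : ∃ a, g = C a := ⟨_, eq_C_of_natDegree_eq_zero hn⟩
      have ha : a ≠ 0 := by
        rintro rfl
        exact hg C_0
      exact ⟨a⁻¹ • f, by
        rw [aeval_C, Module.algebraMap_end_apply, smul_smul, mul_inv_cancel₀ ha, one_smul]⟩
    | succ n ih =>
      intro g hg hn
      obtain ⟨a, ha⟩ := IsAlgClosed.exists_root g (by
        rw [degree_eq_natDegree hg, hn]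
        exact_mod_cast Nat.succ_ne_zero n)
      obtain ⟨k, rfl⟩ := dvd_iff_isRoot.mpr ha
      have hk : k ≠ 0 := right_ne_zero_of_mul hg
      rw [natDegree_mul (X_sub_C_ne_zero a) hk, natDegree_X_sub_C] at hn
      rw [map_mul]
      exact (hlin a).comp (ih k hk (by omega))
  exact key _ g hg rfl

section
variable {r : ℕ} {U : Submodule ℂ (RatVec r)} {χ : ℂ[X]}

theorem app_zero_cst_mul (g f : ℂ[X]) (c : Sym) :
    app 0 f (cst g * c) = app 0 (aeval (derivative : Module.End ℂ ℂ[X]) g f) c := by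
  induction g using Polynomial.induction_on generalizing c with
  | C a =>
    have : cst (C a) * c = a • c := by
      simp [Algebra.smul_def, Polynomial.algebraMap_apply]
    rw [aeval_C, Module.algebraMap_end_apply, app_smul_left, this, LinearMap.map_smul_of_tower]
  | add p q hp hq =>
    rw [map_add, map_add, LinearMap.add_apply, app_add_left, add_mul, map_add, hp, hq]
  | monomial n a ih =>
    have h1 : cst (C a * X ^ (n + 1)) * c = cst (C a * X ^ n) * (X * c) := by
      simp only [map_mul, map_pow, coe_mapRingHom, map_X, pow_succ]
      ring
    have h2 : C a * X ^ (n + 1) = X * (C a * X ^ n) := by ring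
    rw [h1, ih, app_X_mul, h2, map_mul _ X, aeval_X, Module.End.mul_apply, delta_zero]

/-- A symbol which belongs to `rowSyms U` up to a factor `g(∂)` belongs to it. -/
theorem mem_rowSyms_of_cst_mul_mem {g : ℂ[X]} (hg : g ≠ 0) {c : Fin r → Sym}
    (h : (fun i => cst g * c i) ∈ rowSyms U) : c ∈ rowSyms U := by
  intro f
  obtain ⟨u, rfl⟩ := aeval_derivative_surjective hg f
  simpa only [app_zero_cst_mul] using h u

/-- The rows `F` such that `g(x) F` comes from `M`, for some `g ≠ 0`. -/
def genericSpan (M : Submodule ℂ (Fin r → Sym)) : Set (Fin r → Rat2) :=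
  {F | ∃ g : ℂ[X], g ≠ 0 ∧ ∃ c ∈ M, ∀ i, iota (cst g) * F i = iota (c i)}

theorem iota_cst_ne_zero {g : ℂ[X]} (hg : g ≠ 0) : iota (cst g) ≠ 0 := by
  rw [← map_zero iota]
  refine iota_injective.ne ?_
  rw [← map_zero cst]
  exact (map_injective _ (algebraMap ℂ Rat1).injective).ne hg

/-- Inverting polynomials in `x` adds no symbols to the module, since `rowSyms U` is saturated under
factors `g(∂)`. -/
theorem iota_mem_genericSpan_iff {c : Fin r → Sym} :
    (fun i => iota (c i)) ∈ genericSpan (rowSyms U) ↔ c ∈ rowSyms U := by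
  constructor
  · rintro ⟨g, hg, d, hd, h⟩
    refine mem_rowSyms_of_cst_mul_mem hg ?_
    convert! hd using 1
    funext i
    exact iota_injective (by rw [map_mul, h])
  · exact fun hc => ⟨1, one_ne_zero, c, hc, fun i => by rw [map_one, map_one, one_mul]⟩

theorem zero_mem_genericSpan (M : Submodule ℂ (Fin r → Sym)) : 0 ∈ genericSpan M :=
  ⟨1, one_ne_zero, 0, M.zero_mem, fun i => by simp⟩

theorem RightStable.add_mem_genericSpan {M : Submodule ℂ (Fin r → Sym)} (hM : RightStable M)
    {F G : Fin r → Rat2} (hF : F ∈ genericSpan M) (hG : G ∈ genericSpan M) :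
    F + G ∈ genericSpan M := by
  obtain ⟨g, hg, c, hc, hgc⟩ := hF
  obtain ⟨k, hk, d, hd, hkd⟩ := hG
  refine ⟨g * k, mul_ne_zero hg hk, _, M.add_mem (hM.cst_mul k hc) (hM.cst_mul g hd), fun i => ?_⟩
  rw [Pi.add_apply, Pi.add_apply, map_add, map_mul, map_mul, map_mul, map_mul, ← hgc, ← hkd]
  ring

theorem RightStable.embed_mul_mem_genericSpan {M : Submodule ℂ (Fin r → Sym)} (hM : RightStable M)
    (f : Rat1) {F : Fin r → Rat2} (hF : F ∈ genericSpan M) :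
    (fun i => embed 0 f * F i) ∈ genericSpan M := by
  obtain ⟨a, b, hb, rfl⟩ := exists_eq_toRat_div f
  obtain ⟨g, hg, c, hc, hgc⟩ := hF
  refine ⟨b * g, mul_ne_zero hb hg, _, hM.cst_mul a hc, fun i => ?_⟩
  have := iota_cst_ne_zero hb
  rw [map_div₀, embed_zero_toRat, embed_zero_toRat, map_mul, map_mul, map_mul, ← hgc]
  field_simp

/-- From `g² (∂_x + z) F = g (∂_x + z)(g F) - g' (g F)`. -/
theorem RightStable.shiftX_mem_genericSpan {M : Submodule ℂ (Fin r → Sym)} (hM : RightStable M)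
    {F : Fin r → Rat2} (hF : F ∈ genericSpan M) : (fun i => shiftX (F i)) ∈ genericSpan M := by
  obtain ⟨g, hg, c, hc, hgc⟩ := hF
  refine ⟨g * g, mul_ne_zero hg hg, _, M.sub_mem (hM.cst_mul g (hM.zop_mem c hc))
    (hM.cst_mul (derivative g) hc), fun i => ?_⟩
  rw [Pi.sub_apply, map_sub, map_mul, map_mul, map_mul, map_mul, iota_zop, ← hgc, ← embed_zero_toRat,
    ← embed_zero_toRat, shiftX_embed_mul, ddz_toRat]
  ring

theorem RightStable.symX_mem_genericSpan {M : Submodule ℂ (Fin r → Sym)} (hM : RightStable M)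
    (c : Sym) {F : Fin r → Rat2} (hF : F ∈ genericSpan M) :
    (fun i => symX c (F i)) ∈ genericSpan M := by
  induction c using Polynomial.induction_on' with
  | add p q hp hq =>
    rw [map_add]
    exact hM.add_mem_genericSpan hp hq
  | monomial k a =>
    rw [symAct_monomial]
    refine hM.embed_mul_mem_genericSpan a ?_
    induction k with
    | zero => exact hF
    | succ k ih =>
      rw [pow_succ']
      exact hM.shiftX_mem_genericSpan ih

/-- The element `χ(∂)^(k + 1) ∘ (∂_x + z)^k` of the module generated by the Baker function. -/
def IsFrame.power {M : Submodule ℂ (Fin r → Sym)} (h : IsFrame M χ) (l : Fin r) : ℕ → Fin r → Sym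
  | 0 => h.lift (unitRow l)
  | k + 1 => fun i => cst χ * zop (h.power l k i) - cst ((k + 1 : ℕ) * derivative χ) * h.power l k i

theorem IsFrame.power_mem {M : Submodule ℂ (Fin r → Sym)} (h : IsFrame M χ) (l : Fin r) (k : ℕ) :
    h.power l k ∈ M := by
  induction k with
  | zero => exact h.lift_mem _
  | succ k ih =>
    exact M.sub_mem (h.stable.cst_mul _ (h.stable.zop_mem _ ih)) (h.stable.cst_mul _ ih)

/-- The correction term in `power` is the derivative of `χ^(k+1)`, so that only `χ^(k+2) (∂_x +
z)^(k+1) P` remains at the next step. -/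
theorem IsFrame.iota_power {M : Submodule ℂ (Fin r → Sym)} (h : IsFrame M χ)
    {P : Matrix (Fin r) (Fin r) Rat2}
    (hP : ∀ l i, iota (h.lift (unitRow l) i) = iota (cst χ) * P l i) (l i : Fin r) (k : ℕ) :
    iota (h.power l k i) = iota (cst χ) ^ (k + 1) * (shiftX ^ k) (P l i) := by
  induction k with
  | zero =>
    rw [zero_add, pow_one, pow_zero]
    exact hP l i
  | succ k ih =>
    have h1 : embed 0 (ddz (toRat (χ ^ (k + 1)))) =
        ((k + 1 : ℕ) : Rat2) * (iota (cst χ) ^ k * iota (cst (derivative χ))) := by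
      rw [ddz_toRat, derivative_pow, embed_zero_toRat, C_eq_natCast, map_mul, map_mul, map_mul,
        map_mul, Nat.add_sub_cancel, map_pow, map_pow, map_natCast, map_natCast, mul_assoc]
    rw [IsFrame.power, map_sub, map_mul, map_mul, map_mul, map_mul, iota_zop, ih, ← map_pow,
      ← map_pow, ← embed_zero_toRat (χ ^ (k + 1)), shiftX_embed_mul, h1, embed_zero_toRat, map_pow,
      map_pow, pow_succ' shiftX, Module.End.mul_apply, map_natCast, map_natCast]
    ring

/-! ### The filtration by degree in `z`. -/

/-- Polynomials in `∂` and `z` of degree less than `k` in `z`. -/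
def degZ (k : ℕ) : Submodule ℂ ℂ[X][X] where
  carrier := {d | ∀ j m, k ≤ m → (d.coeff j).coeff m = 0}
  zero_mem' := by simp
  add_mem' hd he j m hm := by rw [coeff_add, coeff_add, hd j m hm, he j m hm, add_zero]
  smul_mem' a d hd j m hm := by rw [coeff_smul, coeff_smul, hd j m hm, smul_zero]

theorem exists_mem_degZ (d : ℂ[X][X]) : ∃ k, d ∈ degZ k := by
  refine ⟨d.support.sup fun j => (d.coeff j).natDegree + 1, fun j m hm => ?_⟩
  by_cases hj : j ∈ d.support
  · have : (d.coeff j).natDegree + 1 ≤ _ :=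
      Finset.le_sup (f := fun j => (d.coeff j).natDegree + 1) hj
    exact coeff_eq_zero_of_natDegree_lt (by omega)
  · rw [notMem_support_iff.mp hj, coeff_zero]

theorem degZ_mono {k l : ℕ} (h : k ≤ l) : degZ k ≤ degZ l := fun _ hd j m hm => hd j m (h.trans hm)

theorem eq_zero_of_mem_degZ_zero {d : ℂ[X][X]} (hd : d ∈ degZ 0) : d = 0 := by
  ext j m
  rw [hd j m (Nat.zero_le m), coeff_zero, coeff_zero]

theorem X_mul_mem_degZ {k : ℕ} {d : ℂ[X][X]} (hd : d ∈ degZ k) : X * d ∈ degZ k := by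
  intro j m hm
  rcases j with _ | j
  · simp
  · rw [coeff_X_mul, hd j m hm]

theorem cstP_mul_mem_degZ (g : ℂ[X]) {k : ℕ} {d : ℂ[X][X]} (hd : d ∈ degZ k) :
    cstP g * d ∈ degZ k := by
  induction g using Polynomial.induction_on with
  | C a =>
    have : cstP (C a) * d = a • d := by
      simp [Algebra.smul_def, Polynomial.algebraMap_apply]
    rw [this]
    exact (degZ k).smul_mem a hd
  | add p q hp hq =>
    rw [map_add, add_mul]
    exact (degZ k).add_mem hp hq
  | monomial n a ih =>
    have : cstP (C a * X ^ (n + 1)) * d = X * (cstP (C a * X ^ n) * d) := by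
      simp [pow_succ]
      ring
    rw [this]
    exact X_mul_mem_degZ ih

theorem derivative_mem_degZ {k : ℕ} {d : ℂ[X][X]} (hd : d ∈ degZ k) : derivative d ∈ degZ k := by
  intro j m hm
  rw [coeff_derivative]
  have : ((j : ℂ[X]) + 1) = C ((j : ℂ) + 1) := by simp
  rw [this, coeff_mul_C, hd _ m hm, zero_mul]

theorem C_X_mul_mem_degZ {k : ℕ} {d : ℂ[X][X]} (hd : d ∈ degZ k) : C X * d ∈ degZ (k + 1) := by
  intro j m hm
  obtain ⟨m, rfl⟩ := Nat.exists_eq_succ_of_ne_zero (show m ≠ 0 by omega)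
  rw [coeff_C_mul, coeff_X_mul, hd j m (by omega)]

theorem one_mem_degZ : (1 : ℂ[X][X]) ∈ degZ 1 := by
  intro j m hm
  rw [coeff_one]
  split_ifs
  · rw [coeff_one, if_neg (by omega)]
  · exact coeff_zero m

theorem cstP_mem_degZ (g : ℂ[X]) : cstP g ∈ degZ 1 := by
  simpa using cstP_mul_mem_degZ g one_mem_degZ

theorem C_X_pow_mem_degZ (k : ℕ) : (C X : ℂ[X][X]) ^ k ∈ degZ (k + 1) := by
  induction k with
  | zero => rw [pow_zero]; exact one_mem_degZ
  | succ k ih => rw [pow_succ']; exact C_X_mul_mem_degZ ih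

theorem coeff_cstP_mul_C_X_pow (a : ℂ[X]) (k j m : ℕ) :
    ((cstP a * C X ^ k).coeff j).coeff m = if m = k then a.coeff j else 0 := by
  rw [← C_pow, coeff_mul_C, coe_mapRingHom, coeff_map, coeff_C_mul_X_pow]

theorem exists_sub_mem_degZ {k : ℕ} {d : ℂ[X][X]} (hd : d ∈ degZ (k + 1)) :
    ∃ a : ℂ[X], d - cstP a * C X ^ k ∈ degZ k := by
  have ha : ∀ j, (∑ i ∈ d.support, monomial i ((d.coeff i).coeff k)).coeff j = (d.coeff j).coeff k := by
    intro j
    simp only [finsetSum_coeff, coeff_monomial, Finset.sum_ite_eq']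
    split_ifs with h
    · rfl
    · rw [notMem_support_iff.mp h, coeff_zero]
  refine ⟨∑ j ∈ d.support, monomial j ((d.coeff j).coeff k), fun j m hm => ?_⟩
  rw [coeff_sub, coeff_sub, coeff_cstP_mul_C_X_pow, ha]
  split_ifs with h
  · rw [h, sub_self]
  · rw [hd j m (by omega), sub_zero]

theorem eq_zero_of_cstP_mul_mem_degZ {a : ℂ[X]} {k : ℕ} (h : cstP a * C X ^ k ∈ degZ k) : a = 0 := by
  ext j
  have := h j k le_rfl
  rwa [coeff_cstP_mul_C_X_pow, if_pos rfl] at this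

theorem mem_degZ_succ_of_sub_mem {k : ℕ} {d : ℂ[X][X]} {l i : Fin r}
    (h : d - cstP χ ^ (k + 1) * C X ^ k * unitRow l i ∈ degZ k) : d ∈ degZ (k + 1) := by
  rw [← sub_add_cancel d (cstP χ ^ (k + 1) * C X ^ k * unitRow l i)]
  refine (degZ _).add_mem (degZ_mono (Nat.le_succ k) h) ?_
  rw [← map_pow]
  by_cases hi : i = l
  · simpa [unitRow, hi] using cstP_mul_mem_degZ (χ ^ (k + 1)) (C_X_pow_mem_degZ k)
  · simp [unitRow, hi]

/-- The leading term in `z` is `χ(∂)^(k+1) z^k e_l`; differentiation and residues contribute lower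
degree in `z`. This triangularity drives both existence and uniqueness of operators in `x`. -/
theorem IsFrame.rho_power {M : Submodule ℂ (Fin r → Sym)} (h : IsFrame M χ) (l i : Fin r) (k : ℕ) :
    rho (h.power l k i) - cstP χ ^ (k + 1) * C X ^ k * unitRow l i ∈ degZ k := by
  induction k with
  | zero =>
    rw [IsFrame.power, h.rho_lift]
    simp
  | succ k ih =>
    have hk := mem_degZ_succ_of_sub_mem ih
    have e : rho (h.power l (k + 1) i) - cstP χ ^ (k + 1 + 1) * C X ^ (k + 1) * unitRow l i =
        cstP χ * (C X * (rho (h.power l k i) - cstP χ ^ (k + 1) * C X ^ k * unitRow l i)) +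
        cstP χ * derivative (rho (h.power l k i)) +
        cstP (χ * resSym (h.power l k i)) -
        cstP ((k + 1 : ℕ) * derivative χ) * rho (h.power l k i) := by
      rw [IsFrame.power, map_sub, rho_cst_mul, rho_cst_mul, rho_zop, map_mul cstP χ]
      ring
    rw [e]
    exact (degZ _).sub_mem ((degZ _).add_mem ((degZ _).add_mem
      (cstP_mul_mem_degZ _ (C_X_mul_mem_degZ ih)) (cstP_mul_mem_degZ _ (derivative_mem_degZ hk)))
      (degZ_mono (by omega) (cstP_mem_degZ _))) (cstP_mul_mem_degZ _ hk)

theorem IsFrame.rho_power_mem {M : Submodule ℂ (Fin r → Sym)} (h : IsFrame M χ) (l i : Fin r) (k : ℕ) :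
    rho (h.power l k i) ∈ degZ (k + 1) :=
  mem_degZ_succ_of_sub_mem (h.rho_power l i k)

end

end AdelicGr
end

noncomputable section
namespace AdelicGr
open Polynomial

/-! ### Existence and uniqueness of operators in `x` applied to the Baker function. -/

theorem symAct_eq_sum_range {K : Type} [CommRing K] [Algebra ℂ K] (φ : Rat1 →+* K)
    (L : Module.End ℂ K) {c : Sym} {n : ℕ} (hc : ∀ k, n ≤ k → c.coeff k = 0) (F : K) :
    symAct φ L c F = ∑ k ∈ Finset.range n, φ (c.coeff k) * (L ^ k) F := by
  rw [symAct_eq_sum, LinearMap.sum_apply]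
  refine Finset.sum_subset (fun k hk => ?_) (fun k _ hk => ?_)
  · by_contra h
    exact mem_support_iff.mp hk (hc k (by simpa using h))
  · rw [notMem_support_iff.mp hk, map_zero]
    simp

theorem sum_mul_unitRow {r : ℕ} (a : Fin r → ℂ[X][X]) (i : Fin r) :
    ∑ l, a l * unitRow l i = a i := by
  rw [Finset.sum_eq_single i]
  · simp [unitRow]
  · intro l _ hl
    simp [unitRow, Ne.symm hl]
  · simp

section
variable {r : ℕ} {χ : ℂ[X]} {M : Submodule ℂ (Fin r → Sym)} {P : Matrix (Fin r) (Fin r) Rat2}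

/-- Division with respect to the degree in `z`: after multiplication by `χ^(K+1)`, a combination of
the elements `power l K` removes the coefficient of `z^K`. The induction ends because an element of
`M` without polynomial part is zero. -/
theorem IsFrame.exists_iota_eq_sum_symX (h : IsFrame M χ)
    (hP : ∀ l i, iota (h.lift (unitRow l) i) = iota (cst χ) * P l i) (K : ℕ) :
    ∀ c ∈ M, (∀ i, rho (c i) ∈ degZ K) →
      ∃ H : Fin r → Sym, ∀ j, iota (c j) = ∑ l, symX (H l) (P l j) := by
  induction K with
  | zero =>
    intro c hc hK
    rw [eq_zero_of_rho_eq_zero h.lead hc fun i => eq_zero_of_mem_degZ_zero (hK i)]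
    exact ⟨0, fun j => by simp⟩
  | succ K ih =>
    intro c hc hK
    choose a ha using fun i => exists_sub_mem_degZ (hK i)
    obtain ⟨H, hH⟩ := ih (fun i => cst (χ ^ (K + 1)) * c i - ∑ l, cst (a l) * h.power l K i) (by
      have := M.sub_mem (h.stable.cst_mul (χ ^ (K + 1)) hc)
        (M.sum_mem (t := Finset.univ) fun (l : Fin r) _ => h.stable.cst_mul (a l) (h.power_mem l K))
      convert! this using 1
      funext i
      simp) (fun i => by
      have e : rho (cst (χ ^ (K + 1)) * c i - ∑ l, cst (a l) * h.power l K i) =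
          cstP (χ ^ (K + 1)) * (rho (c i) - cstP (a i) * C X ^ K) -
            ∑ l, cstP (a l) *
              (rho (h.power l K i) - cstP χ ^ (K + 1) * C X ^ K * unitRow l i) := by
        have e1 := sum_mul_unitRow (fun l => cstP (a l)) i
        simp only [map_sub, map_sum, rho_cst_mul, mul_sub, Finset.sum_sub_distrib]
        have e2 : ∑ l, cstP (a l) * (cstP χ ^ (K + 1) * C X ^ K * unitRow l i) =
            cstP χ ^ (K + 1) * C X ^ K * cstP (a i) := by
          rw [← e1, Finset.mul_sum]
          exact Finset.sum_congr rfl fun l _ => by ring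
        rw [e2, map_pow]
        ring
      rw [e]
      exact (degZ K).sub_mem (cstP_mul_mem_degZ _ (ha i))
        ((degZ K).sum_mem fun l _ => cstP_mul_mem_degZ _ (h.rho_power l i K)))
    refine ⟨fun l => C (toRat (χ ^ (K + 1)))⁻¹ * H l + monomial K (toRat (a l)), fun j => ?_⟩
    have hne := iota_cst_ne_zero (pow_ne_zero (K + 1) h.monic.ne_zero)
    have := hH j
    rw [map_sub, map_mul, map_sum] at this
    simp only [map_mul, h.iota_power hP] at this
    simp only [map_add, LinearMap.add_apply, symAct_C_mul, symAct_monomial, Module.End.mul_apply,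
      LinearMap.mulLeft_apply, Finset.sum_add_distrib, ← Finset.mul_sum, ← this, RingHom.coe_coe,
      embed_zero_toRat, map_inv₀]
    rw [mul_sub, inv_mul_cancel_left₀ hne, Finset.mul_sum, sub_add, ← Finset.sum_sub_distrib,
      Finset.sum_eq_zero, sub_zero]
    intro l _
    rw [map_pow, map_pow] at hne ⊢
    field_simp
    ring

/-- Every row of the generic span is obtained from the Baker function by operators in `x`. -/
theorem IsFrame.exists_eq_sum_symX (h : IsFrame M χ)
    (hP : ∀ l i, iota (h.lift (unitRow l) i) = iota (cst χ) * P l i) {F : Fin r → Rat2}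
    (hF : F ∈ genericSpan M) : ∃ H : Fin r → Sym, ∀ j, F j = ∑ l, symX (H l) (P l j) := by
  obtain ⟨g, hg, c, hc, hgc⟩ := hF
  choose k hk using fun i => exists_mem_degZ (rho (c i))
  obtain ⟨H, hH⟩ := h.exists_iota_eq_sum_symX hP (Finset.univ.sup k) c hc fun i =>
    degZ_mono (Finset.le_sup (Finset.mem_univ i)) (hk i)
  refine ⟨fun l => C (toRat g)⁻¹ * H l, fun j => ?_⟩
  simp only [symAct_C_mul, Module.End.mul_apply, LinearMap.mulLeft_apply, RingHom.coe_coe,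
      embed_zero_toRat, map_inv₀, ← Finset.mul_sum, ← hH, ← hgc]
  rw [inv_mul_cancel_left₀ (iota_cst_ne_zero hg)]

/-- The operators in `x` are determined by their value at the Baker function. -/
theorem IsFrame.eq_zero_of_sum_symX_eq_zero (h : IsFrame M χ)
    (hP : ∀ l i, iota (h.lift (unitRow l) i) = iota (cst χ) * P l i) {H : Fin r → Sym}
    (hH : ∀ j, ∑ l, symX (H l) (P l j) = 0) : H = 0 := by
  obtain ⟨g, hg, hden⟩ := exists_isDenom H
  choose b hb using hden
  have key : ∀ K, (∀ l k, K ≤ k → (H l).coeff k = 0) → H = 0 := by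
    intro K
    induction K with
    | zero =>
      intro h0
      funext l
      ext1 k
      exact h0 l k (Nat.zero_le k)
    | succ K ih =>
      intro h0
      -- Multiplying the relation by `g χ^(K+1)` clears all denominators in `x` and turns it into a
      -- relation in `M` between the elements `power l k`. Its coefficient of `z^K` isolates `b l K
      -- χ^(K+1)`.
      have h1 : ∀ j, ∑ l, ∑ k ∈ Finset.range (K + 1),
          cst (b l k * χ ^ (K - k)) * h.power l k j = 0 := by
        intro j
        refine iota_injective ?_
        rw [map_zero, ← mul_zero (iota (cst (g * χ ^ (K + 1)))), ← hH j, map_sum, Finset.mul_sum]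
        refine Finset.sum_congr rfl fun l _ => ?_
        rw [symAct_eq_sum_range _ _ (h0 l), map_sum, Finset.mul_sum]
        refine Finset.sum_congr rfl fun k hk => ?_
        have hk' : K + 1 = K - k + (k + 1) := by
          have := Finset.mem_range.mp hk
          omega
        have e : iota (cst (b l k)) = iota (cst g) * embed 0 ((H l).coeff k) := by
          rw [← embed_zero_toRat, ← hb, map_mul, embed_zero_toRat]
        rw [map_mul iota, h.iota_power hP, map_mul, map_mul, e, map_pow, map_pow, map_mul, map_mul,
          hk', map_pow, map_pow, pow_add, RingHom.coe_coe]
        ring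
      refine ih fun l k hk => ?_
      rcases Nat.lt_or_ge K k with hk' | hk'
      · exact h0 l k hk'
      obtain rfl := le_antisymm hk hk'
      have h2 := congrArg rho (h1 l)
      rw [map_sum, map_zero] at h2
      simp only [map_add, map_sum, rho_cst_mul, Finset.sum_range_succ, Nat.sub_self, pow_zero, mul_one,
        Finset.sum_add_distrib] at h2
      have h3 : cstP (b l K * χ ^ (K + 1)) * C X ^ K ∈ degZ K := by
        have e : cstP (b l K * χ ^ (K + 1)) * C X ^ K =
            -∑ i, ∑ k ∈ Finset.range K, cstP (b i k * χ ^ (K - k)) * rho (h.power i k l) -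
            ∑ i, cstP (b i K) * (rho (h.power i K l) -
              cstP χ ^ (K + 1) * C X ^ K * unitRow i l) := by
          have e1 := sum_mul_unitRow (fun i => cstP (b i K)) l
          have e2 : ∑ i, cstP (b i K) * (cstP χ ^ (K + 1) * C X ^ K * unitRow i l) =
              cstP χ ^ (K + 1) * C X ^ K * cstP (b l K) := by
            rw [← e1, Finset.mul_sum]
            exact Finset.sum_congr rfl fun l _ => by ring
          simp only [mul_sub, Finset.sum_sub_distrib]
          rw [e2, map_mul, map_pow]
          linear_combination h2
        rw [e]
        refine (degZ K).sub_mem ((degZ K).neg_mem ((degZ K).sum_mem fun i _ =>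
          (degZ K).sum_mem fun k hk => cstP_mul_mem_degZ _ (degZ_mono ?_ (h.rho_power_mem i l k))))
          ((degZ K).sum_mem fun i _ => cstP_mul_mem_degZ _ (h.rho_power i l K))
        have := Finset.mem_range.mp hk
        omega
      have h4 : b l K = 0 := (mul_eq_zero.mp (eq_zero_of_cstP_mul_mem_degZ h3)).resolve_right
        (pow_ne_zero _ h.monic.ne_zero)
      have h5 := hb l K
      rw [h4, map_zero] at h5
      exact (mul_eq_zero.mp h5).resolve_left (toRat_ne_zero hg)
  obtain ⟨n, hn⟩ := exists_degree_bound H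
  exact key n fun l k hk => coeff_eq_zero_of_natDegree_lt ((hn l).trans_le hk)

end

end AdelicGr
end

noncomputable section
namespace AdelicGr
open Polynomial

/-! ### The algebra `𝒟(U)` through the Baker function -/

section
variable {r : ℕ} {χ : ℂ[X]} {U : Submodule ℂ (RatVec r)} {P : Matrix (Fin r) (Fin r) Rat2}

theorem app_sum_compSym (f : ℂ[X]) (D : Matrix (Fin r) (Fin r) DiffOpᵐᵒᵖ) (c : Fin r → Sym) :
    (fun j => app 0 f (∑ i, compSym (symOf (D i j).unop) (c i))) =
      starVec (fun i => app 0 f (c i)) D := by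
  funext j
  rw [map_sum]
  exact Finset.sum_congr rfl fun i _ => app_compSym _ _ _

/-- Elements of the module take polynomials into `U`, and their values at `1` exhaust `U`. Hence `U`
is stable exactly when the module is stable under composition from the left. -/
theorem mem_starAlg_iff (hfat : IsFat U) (hpd : IsPrimaryDecomposable U)
    {D : Matrix (Fin r) (Fin r) DiffOpᵐᵒᵖ} :
    D ∈ starAlg U ↔ ∀ c ∈ rowSyms U, (fun j => ∑ i, compSym (symOf (D i j).unop) (c i)) ∈ rowSyms U := by
  constructor
  · intro hD c hc f
    rw [app_sum_compSym]
    exact hD _ (hc f)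
  · intro h u hu
    obtain ⟨c, hc, hcu⟩ := exists_rowSyms_coeff_zero hfat hpd hu
    have := h c hc 1
    rw [app_sum_compSym] at this
    simpa only [app_zero_one, hcu] using this

theorem sum_mem_genericSpan {ι : Type} {M : Submodule ℂ (Fin r → Sym)} (hM : RightStable M)
    {s : Finset ι} {F : ι → Fin r → Rat2} (hF : ∀ i ∈ s, F i ∈ genericSpan M) :
    ∑ i ∈ s, F i ∈ genericSpan M :=
  Finset.sum_induction F (· ∈ genericSpan M) (fun _ _ => hM.add_mem_genericSpan)
    (zero_mem_genericSpan M) hF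

/-- `χ(x)` commutes with operators in `z`, so `D` sends the rows of the Baker function into the
generic span, where every row comes from operators in `x`. -/
theorem IsFrame.exists_operator (h : IsFrame (rowSyms U) χ)
    (hP : ∀ l i, iota (h.lift (unitRow l) i) = iota (cst χ) * P l i) (hfat : IsFat U)
    (hpd : IsPrimaryDecomposable U) {D : Matrix (Fin r) (Fin r) DiffOpᵐᵒᵖ} (hD : D ∈ starAlg U) :
    ∃ Θ : Matrix (Fin r) (Fin r) DiffOp, ∀ i j,
      ∑ k, actZ (D k j).unop (P i k) = ∑ k, actX (Θ i k) (P k j) := by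
  have hmem : ∀ i, (fun j => ∑ k, actZ (D k j).unop (P i k)) ∈ genericSpan (rowSyms U) := by
    refine fun i => ⟨χ, h.monic.ne_zero, _, (mem_starAlg_iff hfat hpd).mp hD _ (h.lift_mem (unitRow i)),
      fun j => ?_⟩
    rw [Finset.mul_sum, map_sum]
    refine Finset.sum_congr rfl fun k _ => ?_
    rw [iota_compSym, hP, ← embed_zero_toRat, symZ_embed_zero_mul, actZ_eq]
  choose H hH using fun i => h.exists_eq_sum_symX hP (hmem i)
  refine ⟨fun i k => opOf (H i k), fun i j => ?_⟩
  rw [hH]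
  simp only [actX_eq, symOf_opOf]

/-- An element of the module is `∑ H_l ψ_l` with operators `H_l` in `x`. They commute with `D`, so
`D` produces `∑ H_l (Θ ψ)_l`, again in the generic span. Being a row of symbols, it lies in the
module. -/
theorem IsFrame.mem_starAlg (h : IsFrame (rowSyms U) χ)
    (hP : ∀ l i, iota (h.lift (unitRow l) i) = iota (cst χ) * P l i) (hfat : IsFat U)
    (hpd : IsPrimaryDecomposable U) {D : Matrix (Fin r) (Fin r) DiffOpᵐᵒᵖ}
    {Θ : Matrix (Fin r) (Fin r) DiffOp}
    (hΘ : ∀ i j, ∑ k, actZ (D k j).unop (P i k) = ∑ k, actX (Θ i k) (P k j)) : D ∈ starAlg U := by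
  refine (mem_starAlg_iff hfat hpd).mpr fun c hc => iota_mem_genericSpan_iff.mp ?_
  obtain ⟨H, hH⟩ := h.exists_eq_sum_symX hP (iota_mem_genericSpan_iff.mpr hc)
  have hrow : ∀ k, P k ∈ genericSpan (rowSyms U) := fun k =>
    ⟨χ, h.monic.ne_zero, _, h.lift_mem (unitRow k), fun j => (hP k j).symm⟩
  have e : (fun j => iota (∑ i, compSym (symOf (D i j).unop) (c i))) =
      ∑ l, fun j => symX (H l) ((∑ k, fun j => symX (symOf (Θ l k)) (P k j)) j) := by
    funext j
    simp only [map_sum, iota_compSym, hH, Finset.sum_apply]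
    rw [Finset.sum_comm]
    refine Finset.sum_congr rfl fun l _ => ?_
    have e1 := hΘ l j
    simp only [actX_eq, actZ_eq] at e1
    rw [← map_sum, ← e1, map_sum]
    refine Finset.sum_congr rfl fun i _ => ?_
    have e2 := actX_actZ (opOf (H l)) (D i j).unop (P l i)
    rw [actX_eq, actZ_eq, symOf_opOf] at e2
    exact e2.symm
  rw [e]
  exact sum_mem_genericSpan h.stable fun l _ => h.stable.symX_mem_genericSpan _
    (sum_mem_genericSpan h.stable fun k _ => h.stable.symX_mem_genericSpan _ (hrow k))

theorem IsFrame.operator_unique (h : IsFrame (rowSyms U) χ)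
    (hP : ∀ l i, iota (h.lift (unitRow l) i) = iota (cst χ) * P l i)
    {Θ Θ' : Matrix (Fin r) (Fin r) DiffOp}
    (hΘ : ∀ i j, ∑ k, actX (Θ i k) (P k j) = ∑ k, actX (Θ' i k) (P k j)) : Θ = Θ' := by
  ext1 i k
  have := h.eq_zero_of_sum_symX_eq_zero hP (H := fun k => symOf (Θ i k) - symOf (Θ' i k)) fun j => by
    have := hΘ i j
    simp only [actX_eq] at this
    simp only [map_sub, LinearMap.sub_apply, Finset.sum_sub_distrib, this, sub_self]
  exact symOf_injective (sub_eq_zero.mp (congrFun this k))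

theorem exists_baker_frame (hU : U ∈ grAd r) :
    ∃ (χ : ℂ[X]) (h : IsFrame (rowSyms U) χ),
      ∀ l i, iota (h.lift (unitRow l) i) = iota (cst χ) * reducedBaker U l i := by
  obtain ⟨-, χ, h⟩ := exists_isFrame hU
  obtain ⟨n, q, -, hq⟩ := exists_isBeta hU
  refine ⟨χ, h, fun l i => ?_⟩
  rw [reducedBaker_eq hU hq, iota_cst]
  exact h.eq_of_isReducedBaker hU hq l i

theorem mem_starAlg_iff_exists (hU : U ∈ grAd r) {D : Matrix (Fin r) (Fin r) DiffOpᵐᵒᵖ} :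
    D ∈ starAlg U ↔ ∃ Θ, BakerRelation U D Θ := by
  obtain ⟨χ, h, hP⟩ := exists_baker_frame hU
  exact ⟨h.exists_operator hP hU.1 hU.2.1, fun ⟨_, hΘ⟩ => h.mem_starAlg hP hU.1 hU.2.1 hΘ⟩

theorem BakerRelation.unique (hU : U ∈ grAd r) {D : Matrix (Fin r) (Fin r) DiffOpᵐᵒᵖ}
    {Θ Θ' : Matrix (Fin r) (Fin r) DiffOp} (hΘ : BakerRelation U D Θ) (hΘ' : BakerRelation U D Θ') :
    Θ = Θ' := by
  obtain ⟨χ, h, hP⟩ := exists_baker_frame hU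
  exact h.operator_unique hP fun i j => (hΘ i j).symm.trans (hΘ' i j)

theorem BakerRelation.add {D D' : Matrix (Fin r) (Fin r) DiffOpᵐᵒᵖ}
    {Θ Θ' : Matrix (Fin r) (Fin r) DiffOp} (h : BakerRelation U D Θ) (h' : BakerRelation U D' Θ') :
    BakerRelation U (D + D') (Θ + Θ') := by
  intro i j
  simp only [Matrix.add_apply, MulOpposite.unop_add, actZ_add, actX_add, LinearMap.add_apply,
    Finset.sum_add_distrib, h i j, h' i j]

theorem actX_zero : actX 0 = 0 := by
  simpa using actX_add 0 0

theorem actZ_zero : actZ 0 = 0 := by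
  simpa using actZ_add 0 0

theorem actX_sum {ι : Type} (s : Finset ι) (D : ι → DiffOp) : actX (∑ i ∈ s, D i) = ∑ i ∈ s, actX (D i) :=
  map_sum (⟨⟨actX, actX_zero⟩, actX_add⟩ : DiffOp →+ Module.End ℂ Rat2) D s

theorem actZ_sum {ι : Type} (s : Finset ι) (D : ι → DiffOp) : actZ (∑ i ∈ s, D i) = ∑ i ∈ s, actZ (D i) :=
  map_sum (⟨⟨actZ, actZ_zero⟩, actZ_add⟩ : DiffOp →+ Module.End ℂ Rat2) D s

/-- `(ψ ⋆ D) ⋆ D' = (Θ.ψ) ⋆ D' = Θ.(ψ ⋆ D') = ΘΘ'.ψ`; the middle step is the commutation of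
operators in `x` and `z`. -/
theorem BakerRelation.mul {D D' : Matrix (Fin r) (Fin r) DiffOpᵐᵒᵖ}
    {Θ Θ' : Matrix (Fin r) (Fin r) DiffOp} (h : BakerRelation U D Θ) (h' : BakerRelation U D' Θ') :
    BakerRelation U (D * D') (Θ * Θ') := by
  intro i j
  simp only [Matrix.mul_apply, Finset.unop_sum, MulOpposite.unop_mul, actZ_sum, actX_sum, actZ_mul,
    actX_mul, LinearMap.sum_apply, Module.End.mul_apply]
  rw [Finset.sum_comm]
  simp only [← map_sum, h i _]
  simp only [map_sum, ← actX_actZ]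
  rw [Finset.sum_comm]
  simp only [← map_sum, h' _ j]
  simp only [map_sum]
  rw [Finset.sum_comm]

theorem bakerRelation_algebraMap (a : ℂ) :
    BakerRelation U (algebraMap ℂ _ a) (algebraMap ℂ _ a) := by
  intro i j
  rw [Finset.sum_eq_single j, Finset.sum_eq_single i]
  · rw [Matrix.algebraMap_matrix_apply, Matrix.algebraMap_matrix_apply, if_pos rfl, if_pos rfl,
      actX_algebraMap, MulOpposite.algebraMap_apply, MulOpposite.unop_op, actZ_algebraMap]
  · intro k _ hk
    rw [Matrix.algebraMap_matrix_apply, if_neg (Ne.symm hk), actX_zero, LinearMap.zero_apply]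
  · simp
  · intro k _ hk
    rw [Matrix.algebraMap_matrix_apply, if_neg hk, MulOpposite.unop_zero, actZ_zero,
      LinearMap.zero_apply]
  · simp

end

/-! ### Exchange of the variables -/

/-- The automorphism of `ℂ(x, z)` which exchanges `x` and `z`. -/
def swapXZ : Rat2 ≃ₐ[ℂ] Rat2 :=
  IsFractionRing.fieldEquivOfAlgEquiv ℂ Rat2 Rat2
    (MvPolynomial.renameEquiv ℂ (Equiv.swap (0 : Fin 2) 1))

theorem swapXZ_var2 (i : Fin 2) : swapXZ (var2 i) = var2 (Equiv.swap 0 1 i) := by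
  have h := IsFractionRing.fieldEquivOfAlgEquiv_algebraMap ℂ Rat2 Rat2
    (MvPolynomial.renameEquiv ℂ (Equiv.swap (0 : Fin 2) 1)) (MvPolynomial.X i)
  rw [MvPolynomial.renameEquiv_apply, MvPolynomial.rename_X] at h
  exact h

theorem swapXZ_xx : swapXZ xx = zz := swapXZ_var2 0

theorem swapXZ_zz : swapXZ zz = xx := swapXZ_var2 1

theorem swapXZ_embed (i : Fin 2) (f : Rat1) : swapXZ (embed i f) = embed (Equiv.swap 0 1 i) f := by
  obtain ⟨a, b, hb, rfl⟩ := exists_eq_toRat_div f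
  simp only [map_div₀, embed_toRat, ← aeval_algHom_apply, swapXZ_var2]

theorem swapXZ_derivation {D E : Derivation ℂ Rat2 Rat2}
    (h : ∀ i, swapXZ (D (var2 i)) = E (var2 (Equiv.swap 0 1 i))) (F : Rat2) :
    swapXZ (D F) = E (swapXZ F) := by
  have hconj : Derivation.mk' (swapXZ.toLinearMap ∘ₗ (D : Rat2 →ₗ[ℂ] Rat2) ∘ₗ
      swapXZ.symm.toLinearMap) (fun a b => by simp) = E := by
    refine derivation_ext fun i => ?_
    have hi : swapXZ.symm (var2 i) = var2 (Equiv.swap 0 1 i) := by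
      rw [AlgEquiv.symm_apply_eq, swapXZ_var2, Equiv.swap_apply_self]
    change swapXZ (D (swapXZ.symm (var2 i))) = _
    rw [hi, h, Equiv.swap_apply_self]
  rw [← hconj]
  change _ = swapXZ (D (swapXZ.symm (swapXZ F)))
  rw [AlgEquiv.symm_apply_apply]

theorem swapXZ_ddxx (F : Rat2) : swapXZ (ddxx F) = ddzz (swapXZ F) := by
  refine swapXZ_derivation (fun i => ?_) F
  fin_cases i
  · change swapXZ (ddxx (var2 0)) = ddzz (var2 1)
    rw [ddxx_xx, ddzz_zz, map_one]
  · change swapXZ (ddxx (var2 1)) = ddzz (var2 0)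
    rw [ddxx_zz, ddzz_xx, map_zero]

theorem swapXZ_ddzz (F : Rat2) : swapXZ (ddzz F) = ddxx (swapXZ F) := by
  refine swapXZ_derivation (fun i => ?_) F
  fin_cases i
  · change swapXZ (ddzz (var2 0)) = ddxx (var2 1)
    rw [ddxx_zz, ddzz_xx, map_zero]
  · change swapXZ (ddzz (var2 1)) = ddxx (var2 0)
    rw [ddxx_xx, ddzz_zz, map_one]

theorem swapXZ_actX (D : DiffOp) (F : Rat2) : swapXZ (actX D F) = actZ D (swapXZ F) := by
  rw [actX_eq, actZ_eq]
  refine map_symAct swapXZ (map_add _) (fun f a => ?_) (fun a => ?_) _ _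
  · rw [map_mul]
    exact congrArg (· * swapXZ a) (swapXZ_embed 0 f)
  · rw [shiftX_apply, shiftZ_apply, map_add, map_mul, swapXZ_ddxx, swapXZ_zz]

theorem swapXZ_actZ (D : DiffOp) (F : Rat2) : swapXZ (actZ D F) = actX D (swapXZ F) := by
  rw [actX_eq, actZ_eq]
  refine map_symAct swapXZ (map_add _) (fun f a => ?_) (fun a => ?_) _ _
  · rw [map_mul]
    exact congrArg (· * swapXZ a) (swapXZ_embed 1 f)
  · rw [shiftX_apply, shiftZ_apply, map_add, map_mul, swapXZ_ddzz, swapXZ_xx]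

theorem swapXZ_map_inv {n : ℕ} (A : Matrix (Fin n) (Fin n) Rat2) :
    A⁻¹.map swapXZ = (A.map swapXZ)⁻¹ := by
  have h1 := RingHom.map_adjugate (swapXZ : Rat2 →+* Rat2) A
  have h2 := RingHom.map_det (swapXZ : Rat2 →+* Rat2) A
  simp only [RingHom.mapMatrix_apply] at h1 h2
  rw [Matrix.inv_def, Matrix.inv_def, Ring.inverse_eq_inv, Ring.inverse_eq_inv]
  change _ = ((A.map (swapXZ : Rat2 →+* Rat2)).det)⁻¹ • (A.map (swapXZ : Rat2 →+* Rat2)).adjugate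
  rw [← h1, ← h2]
  ext i j
  simp

theorem swapXZ_map_constMat {m n : ℕ} (A : Matrix (Fin m) (Fin n) ℂ) :
    (constMat A).map swapXZ = constMat A := by
  ext i j
  simp [constMat]

/-- Transposition reverses the four factors and the exchange of `x` and `z` restores the order of
the resolvents. The signs of `v` and `w` cancel, and those of `X` and `Y` exchange `x + X` with `z -
Y`. -/
theorem bakerMat_bisp {n r : ℕ} (q : CMQuad n r) :
    q.bisp.baker = (q.baker.map swapXZ).transpose := by
  have hmul : ∀ {a b c : ℕ} (A : Matrix (Fin a) (Fin b) Rat2) (B : Matrix (Fin b) (Fin c) Rat2),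
      (A * B).map swapXZ = A.map swapXZ * B.map swapXZ := fun A B =>
    Matrix.map_mul (f := (swapXZ : Rat2 →+* Rat2))
  have hneg : ∀ {a b : ℕ} (A : Matrix (Fin a) (Fin b) ℂ),
      constMat (-A.transpose) = -(constMat A).transpose := by
    intro a b A
    ext i j
    simp [constMat]
  have h1 : (xx • (1 : Matrix (Fin n) (Fin n) Rat2) + constMat q.X).map swapXZ =
      zz • 1 + constMat q.X := by
    rw [Matrix.map_add _ (map_add swapXZ), swapXZ_map_constMat]
    congr 1
    ext i j
    simp [Matrix.one_apply, apply_ite swapXZ, swapXZ_xx]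
  have h2 : (zz • (1 : Matrix (Fin n) (Fin n) Rat2) - constMat q.Y).map swapXZ =
      xx • 1 - constMat q.Y := by
    rw [Matrix.map_sub _ (map_sub swapXZ), swapXZ_map_constMat]
    congr 1
    ext i j
    simp [Matrix.one_apply, apply_ite swapXZ, swapXZ_zz]
  have h3 : (zz • (1 : Matrix (Fin n) (Fin n) Rat2) - constMat q.bisp.Y) =
      (zz • 1 + constMat q.X).transpose := by
    rw [CMQuad.bisp, hneg, sub_neg_eq_add, Matrix.transpose_add, Matrix.transpose_smul,
      Matrix.transpose_one]
  have h4 : (xx • (1 : Matrix (Fin n) (Fin n) Rat2) + constMat q.bisp.X) =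
      (xx • 1 - constMat q.Y).transpose := by
    rw [CMQuad.bisp, hneg, ← sub_eq_add_neg, Matrix.transpose_sub, Matrix.transpose_smul,
      Matrix.transpose_one]
  rw [CMQuad.baker, CMQuad.baker, h3, h4, Matrix.map_add _ (map_add swapXZ), hmul, hmul, hmul,
    swapXZ_map_inv, swapXZ_map_inv, h1, h2, swapXZ_map_constMat, swapXZ_map_constMat,
    Matrix.map_one _ (map_zero swapXZ) (map_one swapXZ)]
  simp only [CMQuad.bisp, hneg, Matrix.transpose_add, Matrix.transpose_one, Matrix.transpose_mul,
    Matrix.transpose_nonsing_inv, Matrix.mul_assoc, Matrix.neg_mul, Matrix.mul_neg, neg_neg]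

/-! ### The anti-isomorphism. -/

section
variable {r : ℕ} {U V : Submodule ℂ (RatVec r)}

/-- Exchanging `x` and `z` in the relation and transposing swaps the two sides. The symmetry gives
both well-definedness and bijectivity of the correspondence. -/
theorem bakerRelation_iff {n : ℕ} {q : CMQuad n r} (hU : IsBeta q U) (hV : IsBeta q.bisp V)
    (D : Matrix (Fin r) (Fin r) DiffOpᵐᵒᵖ) (Θ : Matrix (Fin r) (Fin r) DiffOp) :
    BakerRelation U D Θ ↔
      BakerRelation V (Θ.transpose.map MulOpposite.op) (D.transpose.map MulOpposite.unop) := by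
  have h : ∀ i j, reducedBaker V i j = swapXZ (reducedBaker U j i) := by
    intro i j
    rw [reducedBaker_eq hU.1 hU.2, reducedBaker_eq hV.1 hV.2, bakerMat_bisp]
    rfl
  rw [BakerRelation, BakerRelation, forall_comm]
  refine forall_congr' fun i => forall_congr' fun j => ?_
  rw [← swapXZ.injective.eq_iff, eq_comm]
  simp only [map_sum, swapXZ_actX, swapXZ_actZ, h, Matrix.map_apply, Matrix.transpose_apply,
    MulOpposite.unop_op]

/-- The anti-isomorphism `D(z) ↦ Θ(z)ᵗ`, as a map of underlying sets. -/
def transposeOperator (hU : U ∈ grAd r) {n : ℕ} {q : CMQuad n r} (hq : IsBeta q U)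
    (hV : IsBeta q.bisp V) (D : starAlg U) : (starAlg V)ᵐᵒᵖ :=
  MulOpposite.op ⟨((mem_starAlg_iff_exists hU).mp D.2).choose.transpose.map MulOpposite.op,
    (mem_starAlg_iff_exists hV.1).mpr
      ⟨_, (bakerRelation_iff hq hV _ _).mp ((mem_starAlg_iff_exists hU).mp D.2).choose_spec⟩⟩

theorem bakerRelation_iff_transposeOperator (hU : U ∈ grAd r) {n : ℕ} {q : CMQuad n r}
    (hq : IsBeta q U) (hV : IsBeta q.bisp V) (D : starAlg U) (Θ : Matrix (Fin r) (Fin r) DiffOp) :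
    BakerRelation U D.1 Θ ↔
      (transposeOperator hU hq hV D).unop.1 = Θ.transpose.map MulOpposite.op := by
  have hD := ((mem_starAlg_iff_exists hU).mp D.2).choose_spec
  constructor
  · intro h
    rw [h.unique hU hD]
    rfl
  · intro h
    have e : ((mem_starAlg_iff_exists hU).mp D.2).choose = Θ := by
      ext1 i j
      exact MulOpposite.op_injective (congrFun (congrFun h j) i)
    rwa [← e]

/-- The operator `Θ` depends on `D` compatibly with sums, products and scalars; transposing it
reverses products. The symmetric relation supplies injectivity, by uniqueness on the side of `V`,
and preimages. -/
theorem exists_algEquiv (hU : U ∈ grAd r) (h : IsBispectralImage U V) :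
    ∃ B : starAlg U ≃ₐ[ℂ] (starAlg V)ᵐᵒᵖ,
      ∀ (D : starAlg U) (Θ : Matrix (Fin r) (Fin r) DiffOp),
        BakerRelation U D.1 Θ ↔ (B D).unop.1 = Θ.transpose.map MulOpposite.op := by
  obtain ⟨n, q, hq, hV⟩ := h
  have hB := bakerRelation_iff_transposeOperator hU hq hV
  have hex := fun D : starAlg U => (mem_starAlg_iff_exists hU).mp D.2
  have hext : ∀ {D E : (starAlg V)ᵐᵒᵖ}, D.unop.1 = E.unop.1 → D = E := fun h =>
    MulOpposite.unop_injective (Subtype.ext h)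
  have hadd : ∀ D E, transposeOperator hU hq hV (D + E) =
      transposeOperator hU hq hV D + transposeOperator hU hq hV E := by
    intro D E
    obtain ⟨Θ, hΘ⟩ := hex D
    obtain ⟨Ξ, hΞ⟩ := hex E
    refine hext (((hB (D + E) (Θ + Ξ)).mp (hΘ.add hΞ)).trans ?_)
    change _ = (transposeOperator hU hq hV D).unop.1 + (transposeOperator hU hq hV E).unop.1
    rw [(hB _ _).mp hΘ, (hB _ _).mp hΞ]
    rfl
  have hmul : ∀ D E, transposeOperator hU hq hV (D * E) =
      transposeOperator hU hq hV D * transposeOperator hU hq hV E := by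
    intro D E
    obtain ⟨Θ, hΘ⟩ := hex D
    obtain ⟨Ξ, hΞ⟩ := hex E
    refine hext (((hB (D * E) (Θ * Ξ)).mp (hΘ.mul hΞ)).trans ?_)
    change _ = (transposeOperator hU hq hV E).unop.1 * (transposeOperator hU hq hV D).unop.1
    rw [(hB _ _).mp hΘ, (hB _ _).mp hΞ]
    ext1 i j
    simp [Matrix.mul_apply, Finset.op_sum]
  have halg : ∀ a : ℂ, transposeOperator hU hq hV (algebraMap ℂ _ a) = algebraMap ℂ _ a := by
    intro a
    refine hext (((hB (algebraMap ℂ _ a) (algebraMap ℂ _ a)).mp (bakerRelation_algebraMap a)).trans ?_)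
    change _ = algebraMap ℂ (Matrix (Fin r) (Fin r) DiffOpᵐᵒᵖ) a
    ext1 i j
    rw [Matrix.map_apply, Matrix.transpose_apply, Matrix.algebraMap_matrix_apply,
      Matrix.algebraMap_matrix_apply]
    simp only [eq_comm (a := j)]
    split_ifs <;> rfl
  let f : starAlg U →ₐ[ℂ] (starAlg V)ᵐᵒᵖ :=
    { toFun := transposeOperator hU hq hV
      map_one' := by
        rw [← map_one (algebraMap ℂ (starAlg U)), halg, map_one]
      map_mul' := hmul
      map_zero' := by
        rw [← map_zero (algebraMap ℂ (starAlg U)), halg, map_zero]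
      map_add' := hadd
      commutes' := halg }
  have hbij : Function.Bijective f := by
    constructor
    · intro D E hDE
      obtain ⟨Θ, hΘ⟩ := hex D
      have hΞ : BakerRelation U E.1 Θ := (hB _ _).mpr (by
        rw [← (hB _ _).mp hΘ]
        exact congrArg (fun a : (starAlg V)ᵐᵒᵖ => a.unop.1) hDE.symm)
      have := ((bakerRelation_iff hq hV _ _).mp hΘ).unique hV.1 ((bakerRelation_iff hq hV _ _).mp hΞ)
      refine Subtype.ext (Matrix.ext fun i j => ?_)
      exact MulOpposite.unop_injective (congrFun (congrFun this j) i)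
    · intro E
      obtain ⟨Ξ, hΞ⟩ := (mem_starAlg_iff_exists hV.1).mp E.unop.2
      have h : BakerRelation U (Ξ.transpose.map MulOpposite.op)
          (E.unop.1.transpose.map MulOpposite.unop) := (bakerRelation_iff hq hV _ _).mpr hΞ
      refine ⟨⟨_, (mem_starAlg_iff_exists hU).mpr ⟨_, h⟩⟩, hext ?_⟩
      exact (hB ⟨_, _⟩ _).mp h
  exact ⟨AlgEquiv.ofBijective f hbij, hB⟩

end

end AdelicGr
end

/-- The equivalence encodes both existence and uniqueness of `Θ`, since entrywise `op` after
transposition is a bijection. The opposite algebra as target expresses that products are reversed.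
-/
theorem mainTheorem4 (r : ℕ) (hr : 0 < r) (U : Submodule ℂ (AdelicGr.RatVec r))
    (hU : U ∈ AdelicGr.grAd r) :
    AdelicGr.IsBispectralImage U (AdelicGr.bisp U) ∧
    ∃ B : AdelicGr.starAlg U ≃ₐ[ℂ] (AdelicGr.starAlg (AdelicGr.bisp U))ᵐᵒᵖ,
      ∀ (D : AdelicGr.starAlg U) (Θ : Matrix (Fin r) (Fin r) AdelicGr.DiffOp),
        AdelicGr.BakerRelation U D.1 Θ ↔ (B D).unop.1 = Θ.transpose.map MulOpposite.op :=
  ⟨AdelicGr.isBispectralImage_bisp hU,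
    AdelicGr.exists_algEquiv hU (AdelicGr.isBispectralImage_bisp hU)⟩
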